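/- Conventions. Manifolds are Hausdorff, second countable, smooth and without boundary, of a single finite dimension; a submanifold is a nonempty embedded submanifold (again of a single dimension). A relation $r : X \rightharpoonup Y$ is given by its graph $\mathrm{Gr}(r)\subset Y\times X$; relations are composed as usual, and a composition $rs$ is *simple* if for every $(z,x)\in \mathrm{Gr}(rs)$ the intermediate point $y$ with $(z,y)\in\mathrm{Gr}(r)$, $(y,x)\in\mathrm{Gr}(s)$ is unique. A relation between manifolds is *differentiable* if its graph is a submanifold; its tangent lift $Tr : TX\rightharpoonup TY$ has graph $T\,\mathrm{Gr}(r)$, and its phase lift $Pr : T^*X\rightharpoonup T^*Y$ consists of the pairs $(\alpha,\beta)\in T^*_yY\times T^*_xX$ with $(y,x)\in\mathrm{Gr}(r)$ and $\langle\alpha,u\rangle=\langle\beta,v\rangle$ for all $(u,v)\in T_{(y,x)}\mathrm{Gr}(r)$. Two such relations $s : X \rightharpoonup Y$, $r : Y\rightharpoonup Z$ are *transverse* if $Tr\,Ts$ and $Pr\,Ps$ are simple compositions and $rs$ is differentiable. A *differentiable reduction* is a differentiable relation of the form $f i^T$, where $i$ is the inclusion of a submanifold and $f$ is a surjective submersion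 defined on that submanifold. A *groupoid* $(\Gamma,m,e,s)$ is a set $\Gamma$ with relations $m:\Gamma\times\Gamma\rightharpoonup\Gamma$, $e:\{1\}\rightharpoonup\Gamma$ and an involution $s$ of $\Gamma$ such that $m(m\times \mathrm{id})=m(\mathrm{id}\times m)$, $m(e\times \mathrm{id})=m(\mathrm{id}\times e)=\mathrm{id}$, $sm=m(s\times s)\sigma$ with $\sigma$ the flip, and $\emptyset\ne m(s(x),x)\subset \Gamma^0:=e(\{1\})$ for all $x$; $e_L(x),e_R(x)\in\Gamma^0$ denote the left and right identities of $x$. It is a *differential groupoid* if $\Gamma$ is a manifold, $m$ is a differentiable reduction, $e$ is a differentiable relation, $s$ is a diffeomorphism, and $m$ is transverse to each of $m\times \mathrm{id}$, $\mathrm{id}\times m$, $e\times \mathrm{id}$, $\mathrm{id}\times e$. A *morphism of differential groupoids* $h:\Gamma\rightharpoonup\Gamma'$ is a differentiable relation with $hm=m'(h\times h)$, $hs=s'h$, $he=e'$ such that $m'$ and $h\times h$ are transverse and $h$ and $e$ are transverse. A *differential subgroupoid* of $\Gamma$ is a submanifold $\tilde\Gamma\subset\Gamma$ that is a differential groupoid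 for the structure induced from $\Gamma$; it is *horizontal* (wide) if $\Gamma^0\subset\tilde\Gamma$. **Lemma.** Let $\Gamma$ be a differential groupoid and $\tilde\Gamma\subset\Gamma$ a horizontal differential subgroupoid. Let $R=\{(x,y)\in\Gamma\times\Gamma : s(x)y \text{ is defined and lies in } \tilde\Gamma\}$ (an equivalence relation on $\Gamma$), let $Y=\Gamma/\tilde\Gamma$ be the set of its classes with the quotient topology, and let $\pi : \Gamma \to Y$, $x\mapsto [x]$. Put $f:Y\to\Gamma^0$, $f([x])=e_L(x)$; $\Gamma\times_fY=\{(x,y)\in\Gamma\times Y : e_R(x)=f(y)\}$; $g:\Gamma\times_fY\to Y$, $g(x,[x'])=[xx']$; and let $h:\Gamma\rightharpoonup Y\times Y$ be the relation with graph $\{(g(x,y),y;x) : (x,y)\in\Gamma\times_fY\}$. Then: a) $R$ is a submanifold of $\Gamma\times\Gamma$. b) The map $R\ni(x,y)\mapsto x\in\Gamma$ is a surjective submersion. If moreover $\tilde\Gamma$ is closed in $\Gamma$, then $Y$ carries a smooth structure such that: c) $Y$ is a manifold, $\pi$ is a submersion, and $f$ is a surjective submersion onto the submanifold $\Gamma^0$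 of $\Gamma$. d) $\Gamma\times_fY$ is a submanifold of $\Gamma\times Y$, and $g$ is a surjective submersion. e) $h$ is a morphism of differential groupoids from $\Gamma$ to the pair groupoid $Y\times Y$ (in which $(x,z)(z,y)=(x,y)$, $s(x,y)=(y,x)$ and the identities are the diagonal). -/

import Mathlib

open scoped Manifold ContDiff Topology
open Set Function Manifold

noncomputable section

/-! ### Relations

A relation `r : X ⇸ Y` is given by its graph, a subset of `Y × X`, i.e. a `SetRel Y X`.
With this convention the composition `r s` (first `s`, then `r`) is `r.comp s`. -/

namespace GraphRel

/-- The cartesian product of two relations. -/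
def prod {X Y Z T : Type*} (r : SetRel Y X) (s : SetRel T Z) : SetRel (Y × T) (X × Z) :=
  {p | (p.1.1, p.2.1) ∈ r ∧ (p.1.2, p.2.2) ∈ s}

/-- A mapping `f : X → Y` regarded as a relation `X ⇸ Y`. -/
def ofMap {X Y : Type*} (f : X → Y) : SetRel Y X := {p | p.1 = f p.2}

/-- The composition `r s` is simple: the intermediate point is unique. -/
def SimpleComp {X Y Z : Type*} (r : SetRel Z Y) (s : SetRel Y X) : Prop :=
  ∀ z x, (z, x) ∈ r.comp s → ∃! y, (z, y) ∈ r ∧ (y, x) ∈ s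

end GraphRel

/-- The one point set `{1}`, which is also the one point manifold. -/
abbrev OnePt : Type := EuclideanSpace ℝ (Fin 0)

/-! ### Groupoids in the language of relations -/

/-- A groupoid `(Γ, m, e, s)`: the multiplication `m : Γ × Γ ⇸ Γ` and the identity `e : {1} ⇸ Γ`
are relations and `s` is an involution of `Γ`. -/
structure RelGroupoid (Γ : Type*) where
  m : SetRel Γ (Γ × Γ)
  e : SetRel Γ OnePt
  s : Γ → Γ
  involutive : Involutive s
  /-- `m (m × id) = m (id × m)` -/
  assoc : ∀ w x y z : Γ, (w, ((x, y), z)) ∈ m.comp (GraphRel.prod m SetRel.id) ↔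
    (w, (x, (y, z))) ∈ m.comp (GraphRel.prod SetRel.id m)
  /-- `m (e × id) = id` -/
  one_mul : ∀ (x y : Γ) (o : OnePt), (x, (o, y)) ∈ m.comp (GraphRel.prod e SetRel.id) ↔ x = y
  /-- `m (id × e) = id` -/
  mul_one : ∀ (x y : Γ) (o : OnePt), (x, (y, o)) ∈ m.comp (GraphRel.prod SetRel.id e) ↔ x = y
  /-- `s m = m (s × s) ∼` with the flip `∼` -/
  inverse : (GraphRel.ofMap s).comp m =
    (m.comp (GraphRel.prod (GraphRel.ofMap s) (GraphRel.ofMap s))).comp (GraphRel.ofMap Prod.swap)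
  /-- strong positivity, first half: `m (s x, x)` is not empty -/
  pos_nonempty : ∀ x, ∃ a, (a, (s x, x)) ∈ m
  /-- strong positivity, second half: `m (s x, x)` consists of identities -/
  pos_subset : ∀ x a, (a, (s x, x)) ∈ m → ∃ o, (a, o) ∈ e

namespace RelGroupoid

variable {Γ Γ' : Type*} (G : RelGroupoid Γ)

/-- The set of identities `Γ⁰ = e({1})`. -/
def units : Set Γ := {a | ∃ o : OnePt, (a, o) ∈ G.e}

theorem mem_e_iff {a : Γ} (o : OnePt) : (a, o) ∈ G.e ↔ a ∈ G.units :=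
  ⟨fun h => ⟨o, h⟩, fun ⟨o', h⟩ => by rwa [Subsingleton.elim o o']⟩

theorem assoc_iff (w x y z : Γ) :
    (∃ u, (w, (u, z)) ∈ G.m ∧ (u, (x, y)) ∈ G.m) ↔
      ∃ v, (w, (x, v)) ∈ G.m ∧ (v, (y, z)) ∈ G.m := by
  have h := G.assoc w x y z
  simp only [SetRel.comp, GraphRel.prod, SetRel.id, mem_ofPred_eq, Prod.exists] at h
  constructor
  · rintro ⟨u, h1, h2⟩
    obtain ⟨a, b, h3, h4, h5⟩ := h.1 ⟨u, z, h1, h2, rfl⟩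
    exact ⟨b, by rwa [← h4], h5⟩
  · rintro ⟨v, h1, h2⟩
    obtain ⟨a, b, h3, h4, h5⟩ := h.2 ⟨x, v, h1, rfl, h2⟩
    exact ⟨a, by rwa [← h5], h4⟩

theorem one_mul_iff (x y : Γ) : (∃ a ∈ G.units, (x, (a, y)) ∈ G.m) ↔ x = y := by
  rw [← G.one_mul x y 0]
  simp only [SetRel.comp, GraphRel.prod, SetRel.id, mem_ofPred_eq, Prod.exists]
  constructor
  · rintro ⟨a, ha, h⟩
    exact ⟨a, y, h, (G.mem_e_iff _).2 ha, rfl⟩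
  · rintro ⟨a, b, h, ha, rfl⟩
    exact ⟨a, (G.mem_e_iff _).1 ha, h⟩

theorem mul_one_iff (x y : Γ) : (∃ a ∈ G.units, (x, (y, a)) ∈ G.m) ↔ x = y := by
  rw [← G.mul_one x y 0]
  simp only [SetRel.comp, GraphRel.prod, SetRel.id, mem_ofPred_eq, Prod.exists]
  constructor
  · rintro ⟨a, ha, h⟩
    exact ⟨y, a, h, rfl, (G.mem_e_iff _).2 ha⟩
  · rintro ⟨a, b, h, rfl, hb⟩
    exact ⟨b, (G.mem_e_iff _).1 hb, h⟩

theorem s_mul {x y z : Γ} (h : (z, (x, y)) ∈ G.m) : (G.s z, (G.s y, G.s x)) ∈ G.m := by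
  have h1 : (G.s z, (x, y)) ∈ (GraphRel.ofMap G.s).comp G.m := ⟨z, rfl, h⟩
  rw [G.inverse] at h1
  obtain ⟨⟨a, b⟩, ⟨⟨c, d⟩, h2, h3, h4⟩, h5⟩ := h1
  simp only [GraphRel.ofMap, mem_ofPred_eq, Prod.swap_prod_mk, Prod.mk.injEq] at h3 h4 h5
  obtain ⟨rfl, rfl⟩ := h5
  subst h3 h4
  exact h2

theorem exists_left_unit (x : Γ) : ∃ a ∈ G.units, (x, (a, x)) ∈ G.m := (G.one_mul_iff x x).2 rfl

theorem exists_right_unit (x : Γ) : ∃ a ∈ G.units, (x, (x, a)) ∈ G.m := (G.mul_one_iff x x).2 rfl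

/-- The left identity `e_L(x)` of `x`. -/
def eL (x : Γ) : Γ := (G.exists_left_unit x).choose

/-- The right identity `e_R(x)` of `x`. -/
def eR (x : Γ) : Γ := (G.exists_right_unit x).choose

theorem eL_mem (x : Γ) : G.eL x ∈ G.units := (G.exists_left_unit x).choose_spec.1
theorem eR_mem (x : Γ) : G.eR x ∈ G.units := (G.exists_right_unit x).choose_spec.1
theorem eL_mul (x : Γ) : (x, (G.eL x, x)) ∈ G.m := (G.exists_left_unit x).choose_spec.2
theorem mul_eR (x : Γ) : (x, (x, G.eR x)) ∈ G.m := (G.exists_right_unit x).choose_spec.2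

theorem eq_of_unit_mul {a x y : Γ} (ha : a ∈ G.units) (h : (x, (a, y)) ∈ G.m) : x = y :=
  (G.one_mul_iff x y).1 ⟨a, ha, h⟩

theorem eq_of_mul_unit {a x y : Γ} (ha : a ∈ G.units) (h : (x, (y, a)) ∈ G.m) : x = y :=
  (G.mul_one_iff x y).1 ⟨a, ha, h⟩

theorem units_eq {a b c : Γ} (ha : a ∈ G.units) (hb : b ∈ G.units) (h : (c, (a, b)) ∈ G.m) :
    a = b := by
  rw [← G.eq_of_unit_mul ha h, G.eq_of_mul_unit hb h]

theorem eL_unique {a x y : Γ} (ha : a ∈ G.units) (h : (y, (a, x)) ∈ G.m) : a = G.eL x := by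
  obtain ⟨u, -, hu⟩ := (G.assoc_iff y a (G.eL x) x).2 ⟨x, h, G.eL_mul x⟩
  exact G.units_eq ha (G.eL_mem x) hu

theorem eR_unique {a x y : Γ} (ha : a ∈ G.units) (h : (y, (x, a)) ∈ G.m) : a = G.eR x := by
  obtain ⟨v, -, hv⟩ := (G.assoc_iff y x (G.eR x) a).1 ⟨x, h, G.mul_eR x⟩
  exact (G.units_eq (G.eR_mem x) ha hv).symm

theorem eR_eq_eL {x y z : Γ} (h : (z, (x, y)) ∈ G.m) : G.eR x = G.eL y := by
  obtain ⟨v, -, hv⟩ := (G.assoc_iff z x (G.eR x) y).1 ⟨x, h, G.mul_eR x⟩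
  exact G.eL_unique (G.eR_mem x) hv

theorem eL_mul_eq {x y z : Γ} (h : (z, (x, y)) ∈ G.m) : G.eL z = G.eL x := by
  obtain ⟨v, hv, -⟩ := (G.assoc_iff z (G.eL x) x y).1 ⟨x, h, G.eL_mul x⟩
  obtain rfl := G.eq_of_unit_mul (G.eL_mem x) hv
  exact (G.eL_unique (G.eL_mem x) hv).symm

theorem s_mul_self (x : Γ) : (G.eR x, (G.s x, x)) ∈ G.m := by
  obtain ⟨a, ha⟩ := G.pos_nonempty x
  have hau : a ∈ G.units := G.pos_subset x a ha
  obtain ⟨u, hu, -⟩ := (G.assoc_iff a (G.s x) x (G.eR x)).2 ⟨x, ha, G.mul_eR x⟩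
  obtain ⟨v, hv, hv'⟩ := (G.assoc_iff a (G.s x) x (G.eR x)).1 ⟨a, by
    have := G.eq_of_mul_unit (G.eR_mem x) hu
    rwa [← this] at hu, ha⟩
  obtain rfl := G.eq_of_mul_unit (G.eR_mem x) hu
  rwa [← G.units_eq hau (G.eR_mem x) hu]

theorem self_mul_s (x : Γ) : (G.eR (G.s x), (x, G.s x)) ∈ G.m := by
  have := G.s_mul_self (G.s x)
  rwa [G.involutive] at this

theorem eR_s (x : Γ) : G.eR (G.s x) = G.eL x := G.eR_eq_eL (G.s_mul_self x)

theorem exists_mul {x y : Γ} (h : G.eR x = G.eL y) : ∃ z, (z, (x, y)) ∈ G.m := by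
  have h1 : (x, (x, G.eR (G.s y))) ∈ G.m := by
    rw [G.eR_s, ← h]; exact G.mul_eR x
  obtain ⟨u, -, hu⟩ := (G.assoc_iff x x y (G.s y)).2 ⟨_, h1, G.self_mul_s y⟩
  exact ⟨u, hu⟩

theorem eR_mul_eq {x y z : Γ} (h : (z, (x, y)) ∈ G.m) : G.eR z = G.eR y := by
  obtain ⟨u, hu, -⟩ := (G.assoc_iff z x y (G.eR y)).2 ⟨y, h, G.mul_eR y⟩
  obtain rfl := G.eq_of_mul_unit (G.eR_mem y) hu
  exact (G.eR_unique (G.eR_mem y) hu).symm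

theorem mul_unique {x y z z' : Γ} (h : (z, (x, y)) ∈ G.m) (h' : (z', (x, y)) ∈ G.m) : z = z' := by
  have h1 : (z, (z, G.eR z')) ∈ G.m := by
    rw [G.eR_mul_eq h', ← G.eR_mul_eq h]; exact G.mul_eR z
  obtain ⟨q, hq, hq'⟩ := (G.assoc_iff z z (G.s z') z').2 ⟨_, h1, G.s_mul_self z'⟩
  obtain ⟨d, hd1, hd2⟩ := (G.assoc_iff q x y (G.s z')).1 ⟨z, hq', h⟩
  have hd : d = G.s x := by
    obtain ⟨p, hp, hp'⟩ := (G.assoc_iff d y (G.s y) (G.s x)).2 ⟨_, hd2, G.s_mul h'⟩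
    exact G.eq_of_unit_mul (G.pos_subset (G.s y) p (by rwa [G.involutive])) hp
  subst hd
  exact G.eq_of_unit_mul (G.pos_subset (G.s x) q (by rwa [G.involutive])) hq

theorem left_cancel {x y z : Γ} (h : (z, (x, y)) ∈ G.m) : (y, (G.s x, z)) ∈ G.m := by
  have h1 : (y, (G.eR x, y)) ∈ G.m := by rw [G.eR_eq_eL h]; exact G.eL_mul y
  obtain ⟨v, hv, hv'⟩ := (G.assoc_iff y (G.s x) x y).1 ⟨_, h1, G.s_mul_self x⟩
  rwa [G.mul_unique h hv']

/-- The product `xy` of a composable pair. -/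
def mul (x y : Γ) (h : G.eR x = G.eL y) : Γ := (G.exists_mul h).choose

theorem mul_mem {x y : Γ} (h : G.eR x = G.eL y) : (G.mul x y h, (x, y)) ∈ G.m :=
  (G.exists_mul h).choose_spec

/-- An (algebraic) morphism of groupoids is a relation `h : Γ ⇸ Γ'` with
`h m = m' (h × h)`, `h s = s' h` and `h e = e'`. -/
structure IsMorphism (G : RelGroupoid Γ) (G' : RelGroupoid Γ') (h : SetRel Γ' Γ) : Prop where
  map_m : h.comp G.m = G'.m.comp (GraphRel.prod h h)
  map_s : h.comp (GraphRel.ofMap G.s) = (GraphRel.ofMap G'.s).comp h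
  map_e : h.comp G.e = G'.e

/-- The pair groupoid `Y × Y`: `(x, z)(z, y) = (x, y)`, `s(x, y) = (y, x)`, and the identities
are the diagonal. -/
def pair (Y : Type*) : RelGroupoid (Y × Y) where
  m := {p | ∃ x y z : Y, p = ((x, y), ((x, z), (z, y)))}
  e := {p | p.1.1 = p.1.2}
  s := Prod.swap
  involutive := Prod.swap_swap
  assoc := by
    rintro ⟨w, w'⟩ ⟨x, x'⟩ ⟨y, y'⟩ ⟨z, z'⟩
    simp only [SetRel.comp, GraphRel.prod, SetRel.id, mem_ofPred_eq, Prod.exists, Prod.mk.injEq]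
    grind
  one_mul := by
    rintro ⟨x, x'⟩ ⟨y, y'⟩ o
    simp only [SetRel.comp, GraphRel.prod, SetRel.id, mem_ofPred_eq, Prod.exists, Prod.mk.injEq]
    grind
  mul_one := by
    rintro ⟨x, x'⟩ ⟨y, y'⟩ o
    simp only [SetRel.comp, GraphRel.prod, SetRel.id, mem_ofPred_eq, Prod.exists, Prod.mk.injEq]
    grind
  inverse := by
    ext ⟨⟨w, w'⟩, ⟨x, x'⟩, ⟨y, y'⟩⟩
    simp only [SetRel.comp, GraphRel.prod, GraphRel.ofMap, mem_ofPred_eq, Prod.exists,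
      Prod.mk.injEq, Prod.swap_prod_mk]
    grind
  pos_nonempty := by
    rintro ⟨x, y⟩
    exact ⟨(y, y), y, y, x, rfl⟩
  pos_subset := by
    rintro ⟨x, y⟩ ⟨a, b⟩ ⟨u, v, w, h⟩
    simp only [Prod.mk.injEq, Prod.swap_prod_mk] at h
    refine ⟨0, ?_⟩
    simp only [mem_ofPred_eq]
    grind

/-! ### Subgroupoids and the quotient by a horizontal subgroupoid -/

/-- `Gt` is the structure that `G` induces on the subset `K`: its multiplication and identity
relations are the intersections of those of `G` with `K × K × K` and `K × {1}`, and its inverse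
is the restriction of that of `G`. -/
structure Induces (G : RelGroupoid Γ) (K : Set Γ) (Gt : RelGroupoid K) : Prop where
  m_iff : ∀ x y z : K, (z, (x, y)) ∈ Gt.m ↔ ((z : Γ), ((x : Γ), (y : Γ))) ∈ G.m
  e_iff : ∀ (a : K) (o : OnePt), (a, o) ∈ Gt.e ↔ ((a : Γ), o) ∈ G.e
  s_eq : ∀ x : K, (Gt.s x : Γ) = G.s x

/-- `K ⊆ Γ` is a subgroupoid: the induced structure is a groupoid. -/
def IsSubgroupoid (K : Set Γ) : Prop := ∃ Gt : RelGroupoid K, G.Induces K Gt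

/-- A subgroupoid is horizontal (wide) if it contains all the identities. -/
def IsHorizontal (K : Set Γ) : Prop := G.units ∩ K = G.units

variable {G}

theorem IsSubgroupoid.s_mem {K : Set Γ} (hK : G.IsSubgroupoid K) {x : Γ} (hx : x ∈ K) :
    G.s x ∈ K := by
  obtain ⟨Gt, h⟩ := hK
  rw [← h.s_eq ⟨x, hx⟩]
  exact Subtype.coe_prop _

theorem IsSubgroupoid.mul_mem {K : Set Γ} (hK : G.IsSubgroupoid K) {x y z : Γ}
    (hx : x ∈ K) (hy : y ∈ K) (h : (z, (x, y)) ∈ G.m) : z ∈ K := by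
  obtain ⟨Gt, hG⟩ := hK
  have hu : ∀ a : K, a ∈ Gt.units → (a : Γ) ∈ G.units := fun a ⟨o, ho⟩ => ⟨o, (hG.e_iff a o).1 ho⟩
  have h1 : ((Gt.eR ⟨x, hx⟩ : K) : Γ) = G.eR x :=
    G.eR_unique (hu _ (Gt.eR_mem _)) ((hG.m_iff _ _ _).1 (Gt.mul_eR ⟨x, hx⟩))
  have h2 : ((Gt.eL ⟨y, hy⟩ : K) : Γ) = G.eL y :=
    G.eL_unique (hu _ (Gt.eL_mem _)) ((hG.m_iff _ _ _).1 (Gt.eL_mul ⟨y, hy⟩))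
  obtain ⟨w, hw⟩ := Gt.exists_mul (x := ⟨x, hx⟩) (y := ⟨y, hy⟩)
    (Subtype.ext (by rw [h1, h2, G.eR_eq_eL h]))
  rw [G.mul_unique h ((hG.m_iff _ _ _).1 hw)]
  exact w.2

variable (G) in
/-- The relation `R` on `Γ`: `(x, y) ∈ R` iff `s(x) y` is defined and lies in `K`. -/
def cosetRel (K : Set Γ) : Set (Γ × Γ) := {p | ∃ z ∈ K, (z, (G.s p.1, p.2)) ∈ G.m}

variable (G) in
/-- A horizontal subgroupoid of `G`. -/
structure HorizontalSubgroupoid where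
  carrier : Set Γ
  isSubgroupoid : G.IsSubgroupoid carrier
  isHorizontal : G.IsHorizontal carrier

namespace HorizontalSubgroupoid

variable (K : G.HorizontalSubgroupoid)

/-- `R` as an equivalence relation. -/
def setoid : Setoid Γ where
  r x y := (x, y) ∈ G.cosetRel K.carrier
  iseqv :=
    { refl := fun x => by
        have h : G.eR x ∈ G.units ∩ K.carrier := by
          rw [show G.units ∩ K.carrier = G.units from K.isHorizontal]; exact G.eR_mem x
        exact ⟨G.eR x, h.2, G.s_mul_self x⟩
      symm := by
        rintro x y ⟨z, hz, h⟩
        refine ⟨G.s z, K.isSubgroupoid.s_mem hz, ?_⟩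
        have := G.s_mul h
        rwa [G.involutive] at this
      trans := by
        rintro x y w ⟨z, hz, h⟩ ⟨z', hz', h'⟩
        have hy : (w, (y, z')) ∈ G.m := by
          have := G.left_cancel h'
          rwa [G.involutive] at this
        have hzz : G.eR z = G.eL z' := by
          rw [G.eR_mul_eq h]; exact G.eR_eq_eL hy
        obtain ⟨c, hc⟩ := G.exists_mul hzz
        refine ⟨c, K.isSubgroupoid.mul_mem hz hz' hc, ?_⟩
        obtain ⟨v, hv, hv'⟩ := (G.assoc_iff c (G.s x) y z').1 ⟨z, hc, h⟩
        rwa [G.mul_unique hv' hy] at hv }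

/-- The set `Y = Γ/Γ̃` of equivalence classes of `R`. -/
def QuotientSpace : Type _ := Quotient K.setoid

/-- The quotient topology. -/
instance [TopologicalSpace Γ] : TopologicalSpace K.QuotientSpace :=
  inferInstanceAs (TopologicalSpace (Quotient K.setoid))

/-- The canonical projection `π : Γ → Y`, `x ↦ [x]`. -/
def proj (x : Γ) : K.QuotientSpace := Quotient.mk K.setoid x

/-- The map `f : Y → Γ⁰`, `[x] ↦ e_L(x)`. -/
def anchor : K.QuotientSpace → G.units :=
  Quotient.lift (fun x => (⟨G.eL x, G.eL_mem x⟩ : G.units)) (by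
    rintro x y ⟨z, -, h⟩
    refine Subtype.ext ?_
    change G.eL x = G.eL y
    rw [← G.eR_s, G.eR_eq_eL h])

/-- `Γ ×_f Y = {(x, y) : e_R(x) = f(y)}`. -/
def fiberProd : Set (Γ × K.QuotientSpace) := {p | G.eR p.1 = K.anchor p.2}

theorem act_wellDefined {x x₁ x₂ p q : Γ} (h : (x₁, x₂) ∈ G.cosetRel K.carrier)
    (hp : (p, (x, x₁)) ∈ G.m) (hq : (q, (x, x₂)) ∈ G.m) : K.proj p = K.proj q := by
  obtain ⟨z, hz, h⟩ := h
  refine Quotient.sound ⟨z, hz, ?_⟩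
  obtain ⟨u, hu, hu'⟩ := (G.assoc_iff z (G.s x₁) (G.s x) q).2 ⟨x₂, h, G.left_cancel hq⟩
  change (z, (G.s p, q)) ∈ G.m
  rwa [G.mul_unique hu' (G.s_mul hp)] at hu

theorem exists_act (p : K.fiberProd) :
    ∃ y : K.QuotientSpace, ∀ (x' : Γ) (z : Γ), K.proj x' = p.1.2 → (z, (p.1.1, x')) ∈ G.m →
      y = K.proj z := by
  obtain ⟨⟨x, y⟩, hp⟩ := p
  induction y using Quotient.inductionOn with
  | h x₀ =>
    obtain ⟨z₀, hz₀⟩ := G.exists_mul (x := x) (y := x₀) hp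
    refine ⟨K.proj z₀, fun x' z hx' hz => ?_⟩
    exact K.act_wellDefined (Quotient.exact hx'.symm) hz₀ hz

/-- The map `g : Γ ×_f Y → Y`, `(x, [x']) ↦ [x x']`. -/
def act (p : K.fiberProd) : K.QuotientSpace := (K.exists_act p).choose

theorem act_mk (x x' : Γ) (h : G.eR x = G.eL x') :
    K.act ⟨(x, K.proj x'), h⟩ = K.proj (G.mul x x' h) :=
  (K.exists_act ⟨(x, K.proj x'), h⟩).choose_spec x' _ rfl (G.mul_mem h)

/-- The relation `h : Γ ⇸ Y × Y` with graph `{(g(x, y), y; x) : (x, y) ∈ Γ ×_f Y}`. -/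
def actionRel : SetRel (K.QuotientSpace × K.QuotientSpace) Γ :=
  {q | ∃ p : K.fiberProd, q = ((K.act p, p.1.2), p.1.1)}

end HorizontalSubgroupoid

end RelGroupoid

/-! ### Manifolds, submanifolds and differentiable relations -/

section Manifolds

variable {E H : Type*} [NormedAddCommGroup E] [NormedSpace ℝ E] [TopologicalSpace H]
  (I : ModelWithCorners ℝ E H) {M : Type*} [TopologicalSpace M] [ChartedSpace H M]

variable (M) in
/-- A manifold: Hausdorff, finite dimensional, smooth, without boundary, with a countable basis. -/
structure IsSmoothManifold : Prop where
  isManifold : IsManifold I ∞ M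
  finiteDimensional : FiniteDimensional ℝ E
  boundaryless : I.Boundaryless
  t2Space : T2Space M
  secondCountable : SecondCountableTopology M

/-- A smooth structure on a subset `S` of a manifold, for the relative topology,
for which the inclusion is a smooth embedding. -/
structure SubmanifoldStructure (S : Set M) where
  dim : ℕ
  chartedSpace : ChartedSpace (EuclideanSpace ℝ (Fin dim)) S
  isManifold : IsManifold (𝓡 dim) ∞ S
  isSmoothEmbedding : IsSmoothEmbedding (𝓡 dim) I ∞ (Subtype.val : S → M)

/-- A submanifold: a nonempty embedded submanifold. -/
def IsSubmanifold (S : Set M) : Prop := S.Nonempty ∧ Nonempty (SubmanifoldStructure I S)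

/-- The tangent set `TS ⊆ TM` of a submanifold `S ⊆ M`: the velocities of smooth curves in `S`. -/
def tangentSet (S : Set M) : Set (TangentBundle I M) :=
  {V | ∃ γ : ℝ → M, ContMDiffAt 𝓘(ℝ, ℝ) I ∞ γ 0 ∧ (∀ᶠ t in 𝓝 0, γ t ∈ S) ∧
    V = ⟨γ 0, mfderiv 𝓘(ℝ, ℝ) I γ 0 (1 : ℝ)⟩}

variable (M) in
/-- The set of covectors `T*M`. -/
def CotangentSet : Type _ := Σ x : M, (TangentSpace I x →L[ℝ] ℝ)

end Manifolds

section DifferentiableRelations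

variable {EX HX X EY HY Y EZ HZ Z : Type*}
  [NormedAddCommGroup EX] [NormedSpace ℝ EX] [TopologicalSpace HX] (IX : ModelWithCorners ℝ EX HX)
  [TopologicalSpace X] [ChartedSpace HX X]
  [NormedAddCommGroup EY] [NormedSpace ℝ EY] [TopologicalSpace HY] (IY : ModelWithCorners ℝ EY HY)
  [TopologicalSpace Y] [ChartedSpace HY Y]
  [NormedAddCommGroup EZ] [NormedSpace ℝ EZ] [TopologicalSpace HZ] (IZ : ModelWithCorners ℝ EZ HZ)
  [TopologicalSpace Z] [ChartedSpace HZ Z]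

/-- A relation `r : X ⇸ Y` is differentiable if its graph is a submanifold of `Y × X`. -/
def IsDifferentiableRel (r : SetRel Y X) : Prop := IsSubmanifold (IY.prod IX) (r : Set (Y × X))

/-- The tangent lift `Tr : TX ⇸ TY`, with graph `T Gr(r) ⊆ T(Y × X) = TY × TX`. -/
def tangentLift (r : SetRel Y X) : SetRel (TangentBundle IY Y) (TangentBundle IX X) :=
  {p | (equivTangentBundleProd IY Y IX X).symm p ∈ tangentSet (IY.prod IX) (r : Set (Y × X))}

/-- The phase lift `Pr : T*X ⇸ T*Y`: `(α, β)` is in its graph iff `⟨α, u⟩ = ⟨β, v⟩` for all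
`(u, v)` tangent to `Gr(r)` at `(π(α), π(β)) ∈ Gr(r)`. -/
def phaseLift (r : SetRel Y X) : SetRel (CotangentSet IY Y) (CotangentSet IX X) :=
  {p | (p.1.1, p.2.1) ∈ r ∧
    ∀ (u : TangentSpace IY p.1.1) (v : TangentSpace IX p.2.1),
      ((⟨p.1.1, u⟩ : TangentBundle IY Y), (⟨p.2.1, v⟩ : TangentBundle IX X)) ∈
        tangentLift IX IY r → p.1.2 u = p.2.2 v}

/-- Transversality of `s : X ⇸ Y` and `r : Y ⇸ Z`: the tangent lifts and the phase lifts have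
simple composition, and `r s` is a differentiable relation. -/
structure Transverse (r : SetRel Z Y) (s : SetRel Y X) : Prop where
  tangent : GraphRel.SimpleComp (tangentLift IY IZ r) (tangentLift IX IY s)
  phase : GraphRel.SimpleComp (phaseLift IY IZ r) (phaseLift IX IY s)
  differentiable : IsDifferentiableRel IX IZ (r.comp s)

/-- A differentiable reduction: a differentiable relation `X ⇸ Y` of the form `f iᵀ`, where `i` is
the inclusion of a submanifold `C ⊆ X` and `f : C → Y` is a surjective submersion. -/
def IsDifferentiableReduction (r : SetRel Y X) : Prop :=
  IsDifferentiableRel IX IY r ∧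
  ∃ (C : Set X) (_ : C.Nonempty) (A : SubmanifoldStructure IX C) (f : C → Y),
    letI := A.chartedSpace
    Surjective f ∧ IsSubmersion (𝓡 A.dim) IY ∞ f ∧
    r = (GraphRel.ofMap f).comp (GraphRel.ofMap (Subtype.val : C → X)).inv

end DifferentiableRelations

/-! ### Differential groupoids -/

namespace RelGroupoid

section

variable {E H Γ : Type*} [NormedAddCommGroup E] [NormedSpace ℝ E] [TopologicalSpace H]
  (I : ModelWithCorners ℝ E H) [TopologicalSpace Γ] [ChartedSpace H Γ] (G : RelGroupoid Γ)

/-- A differential groupoid. -/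
structure IsDifferential : Prop where
  manifold : IsSmoothManifold I Γ
  m_reduction : IsDifferentiableReduction (I.prod I) I G.m
  e_differentiable : IsDifferentiableRel (𝓡 0) I G.e
  s_diffeo : ∃ φ : Γ ≃ₘ^∞⟮I, I⟯ Γ, ⇑φ = G.s
  /-- `m` and `m × id` are transverse -/
  m_m_id : Transverse ((I.prod I).prod I) (I.prod I) I G.m (GraphRel.prod G.m SetRel.id)
  /-- `m` and `id × m` are transverse -/
  m_id_m : Transverse (I.prod (I.prod I)) (I.prod I) I G.m (GraphRel.prod SetRel.id G.m)
  /-- `m` and `e × id` are transverse -/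
  m_e_id : Transverse ((𝓡 0).prod I) (I.prod I) I G.m (GraphRel.prod G.e SetRel.id)
  /-- `m` and `id × e` are transverse -/
  m_id_e : Transverse (I.prod (𝓡 0)) (I.prod I) I G.m (GraphRel.prod SetRel.id G.e)

/-- `K ⊆ Γ` is a differential subgroupoid: it is a submanifold, and with the induced structure
it is a differential groupoid. -/
def IsDifferentialSubgroupoid (K : Set Γ) : Prop :=
  K.Nonempty ∧ ∃ A : SubmanifoldStructure I K,
    letI := A.chartedSpace
    ∃ Gt : RelGroupoid K, G.Induces K Gt ∧ Gt.IsDifferential (𝓡 A.dim)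

end

variable {E H Γ E' H' Γ' : Type*}
  [NormedAddCommGroup E] [NormedSpace ℝ E] [TopologicalSpace H] (I : ModelWithCorners ℝ E H)
  [TopologicalSpace Γ] [ChartedSpace H Γ]
  [NormedAddCommGroup E'] [NormedSpace ℝ E'] [TopologicalSpace H'] (I' : ModelWithCorners ℝ E' H')
  [TopologicalSpace Γ'] [ChartedSpace H' Γ']

/-- A morphism `h : Γ ⇸ Γ'` of differential groupoids. -/
structure IsDifferentialMorphism (G : RelGroupoid Γ) (G' : RelGroupoid Γ') (h : SetRel Γ' Γ) :
    Prop where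
  source : G.IsDifferential I
  target : G'.IsDifferential I'
  morphism : G.IsMorphism G' h
  differentiable : IsDifferentiableRel I I' h
  /-- `m'` and `h × h` are transverse -/
  m_h_h : Transverse (I.prod I) (I'.prod I') I' G'.m (GraphRel.prod h h)
  /-- `h` and `e` are transverse -/
  h_e : Transverse (𝓡 0) I I' h G.e

end RelGroupoid

end

/-! A smooth map is a submersion exactly when a smooth local section passes through every point of
its source (`isSubmersion_of_local_sections`, `Manifold.IsSubmersionAt.exists_local_section`), and a
subset is a submanifold once it is near each of its points diffeomorphic, by ambient maps, to a
fixed `ℝᵈ` (`nonempty_submanifoldStructure`). Both criteria rest on the inverse function theorem.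
With them, most of the geometry reduces to explicit groupoid formulas.

A local section of the multiplication through `(x, s(x))`, restricted to identities, yields a
section of `e_L`; hence `e_L` and `e_R` are submersions onto `Γ⁰`
(`IsDifferential.exists_smoothMaps`). Applied to `Γ̃` itself, this gives sections of `e_L` with
values in `Γ̃`. Now `(x, y) ↦ (s(x)y, x)` identifies `R` with the fiber product of `e_L` on `Γ̃` and
`e_R` on `Γ`, and `x' ↦ x'σ(e_R(x'))` gives sections of `R → Γ`. This is a) and b). The same
sections show that `π` is open.

The heart is `exists_isSliceAt`. Near the identity `e_R(x₀)`, trivialize `e_L` on `Γ̃` with `Γ⁰` as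
zero section, so that the elements of `Γ̃` there are `m(a, t)` with `a ∈ Γ⁰`, `t ∈ ℝᶜ`. The map `t ↦
x₀ m(e_R(x₀), t)` is an immersion; choose a disc through `x₀` complementary to it. Then `(t, w) ↦ w
m(e_R(w), t)`, with `w` in the disc, is a local diffeomorphism. If two points `w`, `w'` of the disc
near `x₀` are equivalent, then `s(w)w'` lies in `Γ̃` close to `e_R(x₀)`; since `Γ̃` has the relative
topology, it equals `m(e_R(w), t)` with `t` small, and injectivity gives `w = w'`. So small discs
are charts of `Y`. Closedness of `Γ̃` makes `R` closed, hence `Y` Hausdorff.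

Through local sections of `π`, the maps `f` and `g` become expressions in `e_L` and the
multiplication, hence a smooth action whose anchor has local sections
(`HorizontalSubgroupoid.smoothAction`); c) and d) follow.

For e), the morphism equations are the action axioms. For tangent lifts, membership is expressed by
velocities of curves, and the intermediate velocity is a function of the outer ones. For phase lifts
the dual condition is checked: the tangent spaces of the two graphs must together span the tangent
space at the intermediate point (`simpleComp_phaseLift`); the required curves are lifted through
sections of `e_R` and of `f`. The composites are differentiable because `m'(h × h) = hm` and `he =
e'`. -/

set_option linter.unusedSectionVars false

/-! ### Germs of smooth maps on subsets of manifolds -/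

section SmoothGerm

variable {E H M E' H' N E'' H'' P E₃ H₃ Q : Type*}
  [NormedAddCommGroup E] [NormedSpace ℝ E] [TopologicalSpace H] {I : ModelWithCorners ℝ E H}
  [TopologicalSpace M] [ChartedSpace H M]
  [NormedAddCommGroup E'] [NormedSpace ℝ E'] [TopologicalSpace H'] {J : ModelWithCorners ℝ E' H'}
  [TopologicalSpace N] [ChartedSpace H' N]
  [NormedAddCommGroup E''] [NormedSpace ℝ E''] [TopologicalSpace H'']
  {L : ModelWithCorners ℝ E'' H''} [TopologicalSpace P] [ChartedSpace H'' P]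
  [NormedAddCommGroup E₃] [NormedSpace ℝ E₃] [TopologicalSpace H₃]
  {L' : ModelWithCorners ℝ E₃ H₃} [TopologicalSpace Q] [ChartedSpace H₃ Q]

variable (I J) in
/-- `f` is smooth within `S` at all points of `S` near `p`. -/
def SmoothGerm (f : M → N) (S : Set M) (p : M) : Prop :=
  ∀ᶠ x in 𝓝[S] p, ContMDiffWithinAt I J ∞ f S x

theorem ContMDiffOn.smoothGerm {f : M → N} {S : Set M} (h : ContMDiffOn I J ∞ f S) (p : M) :
    SmoothGerm I J f S p :=
  Filter.eventually_of_mem self_mem_nhdsWithin h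

theorem ContMDiff.smoothGerm {f : M → N} (h : ContMDiff I J ∞ f) (S : Set M) (p : M) :
    SmoothGerm I J f S p :=
  h.contMDiffOn.smoothGerm p

theorem contMDiffOn_of_smoothGerm {f : M → N} {S : Set M}
    (h : ∀ p ∈ S, SmoothGerm I J f S p) : ContMDiffOn I J ∞ f S :=
  fun p hp => (h p hp).self_of_nhdsWithin hp

theorem contMDiff_of_smoothGerm {f : M → N} (h : ∀ p, SmoothGerm I J f univ p) :
    ContMDiff I J ∞ f :=
  contMDiffOn_univ.1 (contMDiffOn_of_smoothGerm fun p _ => h p)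

namespace SmoothGerm

theorem contMDiffWithinAt {f : M → N} {S : Set M} {p : M} (h : SmoothGerm I J f S p)
    (hp : p ∈ S) : ContMDiffWithinAt I J ∞ f S p :=
  h.self_of_nhdsWithin hp

theorem contMDiffAt {f : M → N} {p : M} (h : SmoothGerm I J f univ p) : ContMDiffAt I J ∞ f p :=
  h.self_of_nhdsWithin (mem_univ p)

theorem continuousWithinAt {f : M → N} {S : Set M} {p : M} (h : SmoothGerm I J f S p)
    (hp : p ∈ S) : ContinuousWithinAt f S p :=
  (h.contMDiffWithinAt hp).continuousWithinAt

theorem tendsto {f : M → N} {S : Set M} {T : Set N} {p : M} (h : SmoothGerm I J f S p)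
    (hp : p ∈ S) (hm : ∀ᶠ x in 𝓝[S] p, f x ∈ T) :
    Filter.Tendsto f (𝓝[S] p) (𝓝[T] (f p)) :=
  tendsto_nhdsWithin_iff.2 ⟨h.continuousWithinAt hp, hm⟩

theorem comp {f : M → N} {g : N → P} {S : Set M} {T : Set N} {p : M}
    (hg : SmoothGerm J L g T (f p)) (hf : SmoothGerm I J f S p) (hp : p ∈ S)
    (hm : ∀ᶠ x in 𝓝[S] p, f x ∈ T) : SmoothGerm I L (fun x => g (f x)) S p := by
  have ht := hf.tendsto hp hm
  filter_upwards [hf, ht.eventually hg, eventually_eventually_nhdsWithin.2 hm] with x h1 h2 h3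
  exact (h2.comp' x h1).mono_of_mem_nhdsWithin (Filter.inter_mem self_mem_nhdsWithin h3)

theorem comp_of_eq {f : M → N} {g : N → P} {S : Set M} {T : Set N} {p : M} {q : N}
    (hg : SmoothGerm J L g T q) (hf : SmoothGerm I J f S p) (hp : p ∈ S) (hq : f p = q)
    (hm : ∀ᶠ x in 𝓝[S] p, f x ∈ T) : SmoothGerm I L (fun x => g (f x)) S p := by
  subst hq
  exact hg.comp hf hp hm

theorem comp_univ {f : M → N} {g : N → P} {S : Set M} {p : M} {q : N}
    (hg : SmoothGerm J L g univ q) (hf : SmoothGerm I J f S p) (hp : p ∈ S) (hq : f p = q) :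
    SmoothGerm I L (fun x => g (f x)) S p :=
  hg.comp_of_eq hf hp hq (Filter.Eventually.of_forall fun _ => mem_univ _)

theorem congr {f f' : M → N} {S : Set M} {p : M} (h : SmoothGerm I J f S p)
    (he : ∀ᶠ x in 𝓝[S] p, f' x = f x) : SmoothGerm I J f' S p := by
  filter_upwards [h, eventually_eventually_nhdsWithin.2 he, self_mem_nhdsWithin] with x h1 h2 h3
  exact h1.congr_of_eventuallyEq h2 (h2.self_of_nhdsWithin h3)

theorem prodMk {f : M → N} {g : M → P} {S : Set M} {p : M} (hf : SmoothGerm I J f S p)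
    (hg : SmoothGerm I L g S p) : SmoothGerm I (J.prod L) (fun x => (f x, g x)) S p := by
  filter_upwards [hf, hg] with x h1 h2
  exact h1.prodMk h2

theorem fst {f : M → N × P} {S : Set M} {p : M} (hf : SmoothGerm I (J.prod L) f S p) :
    SmoothGerm I J (fun x => (f x).1) S p := by
  filter_upwards [hf] with x h1
  exact h1.fst

theorem snd {f : M → N × P} {S : Set M} {p : M} (hf : SmoothGerm I (J.prod L) f S p) :
    SmoothGerm I L (fun x => (f x).2) S p := by
  filter_upwards [hf] with x h1
  exact h1.snd

theorem mono {f : M → N} {S S' : Set M} {p : M} (h : SmoothGerm I J f S p) (hS : S' ⊆ S) :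
    SmoothGerm I J f S' p := by
  have := h.filter_mono (nhdsWithin_mono p hS)
  filter_upwards [this] with x hx
  exact hx.mono hS

theorem id (S : Set M) (p : M) : SmoothGerm I I (fun x => x) S p := contMDiff_id.smoothGerm S p

theorem const (c : N) (S : Set M) (p : M) : SmoothGerm I J (fun _ => c) S p :=
  contMDiff_const.smoothGerm S p

/-- This is why germs ask for smoothness at all nearby points: being `C^∞` at one point gives a
neighbourhood for each finite order, but the inverse function theorem is to be used on one
neighbourhood that serves all orders. -/
theorem eventually_contDiffAt {f : E → E'} {p : E}
    (h : SmoothGerm 𝓘(ℝ, E) 𝓘(ℝ, E') f univ p) : ∀ᶠ x in 𝓝 p, ContDiffAt ℝ ∞ f x := by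
  rw [SmoothGerm, nhdsWithin_univ] at h
  filter_upwards [h] with x hx
  exact (contMDiffWithinAt_univ.1 hx).contDiffAt

end SmoothGerm

theorem smoothGerm_fst {S : Set (M × N)} {p : M × N} :
    SmoothGerm (I.prod J) I Prod.fst S p := contMDiff_fst.smoothGerm S p

theorem smoothGerm_snd {S : Set (M × N)} {p : M × N} :
    SmoothGerm (I.prod J) J Prod.snd S p := contMDiff_snd.smoothGerm S p

/-! ### Germs of diffeomorphisms between subsets of manifolds -/

variable (I J) in
/-- `f` and `g` are mutually inverse smooth maps between neighbourhoods of `p` in `S`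
and of `q` in `T`. -/
structure SetDiffeoAt (S : Set M) (p : M) (T : Set N) (q : N) (f : M → N) (g : N → M) : Prop where
  mem : p ∈ S
  map : f p = q
  smooth : SmoothGerm I J f S p
  smooth_inv : SmoothGerm J I g T q
  left : ∀ᶠ x in 𝓝[S] p, f x ∈ T ∧ g (f x) = x
  right : ∀ᶠ y in 𝓝[T] q, g y ∈ S ∧ f (g y) = y

namespace SetDiffeoAt

variable {S : Set M} {p : M} {T : Set N} {q : N} {f : M → N} {g : N → M}

theorem mem' (h : SetDiffeoAt I J S p T q f g) : q ∈ T :=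
  h.map ▸ (h.left.self_of_nhdsWithin h.mem).1

theorem map_inv (h : SetDiffeoAt I J S p T q f g) : g q = p :=
  h.map ▸ (h.left.self_of_nhdsWithin h.mem).2

theorem symm (h : SetDiffeoAt I J S p T q f g) : SetDiffeoAt J I T q S p g f :=
  ⟨h.mem', h.map_inv, h.smooth_inv, h.smooth, h.right, h.left⟩

theorem tendsto (h : SetDiffeoAt I J S p T q f g) : Filter.Tendsto f (𝓝[S] p) (𝓝[T] q) := by
  have := h.smooth.tendsto h.mem (h.left.mono fun _ hx => hx.1)
  rwa [h.map] at this

theorem trans {W : Set P} {w : P} {f' : N → P} {g' : P → N} (h : SetDiffeoAt I J S p T q f g)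
    (h' : SetDiffeoAt J L T q W w f' g') :
    SetDiffeoAt I L S p W w (fun x => f' (f x)) (fun z => g (g' z)) where
  mem := h.mem
  map := by rw [h.map, h'.map]
  smooth := h'.smooth.comp_of_eq h.smooth h.mem h.map (h.left.mono fun _ hx => hx.1)
  smooth_inv := h.smooth_inv.comp_of_eq h'.smooth_inv h'.mem' h'.map_inv
    (h'.right.mono fun _ hx => hx.1)
  left := by
    filter_upwards [h.left, h.tendsto.eventually h'.left] with x h1 h2
    exact ⟨h2.1, by rw [h2.2, h1.2]⟩
  right := by
    filter_upwards [h'.right, h'.symm.tendsto.eventually h.right] with x h1 h2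
    exact ⟨h2.1, by rw [h2.2, h1.2]⟩

theorem prod {S' : Set P} {p' : P} {T' : Set Q} {q' : Q} {f' : P → Q} {g' : Q → P}
    (h : SetDiffeoAt I J S p T q f g) (h' : SetDiffeoAt L L' S' p' T' q' f' g') :
    SetDiffeoAt (I.prod L) (J.prod L') (S ×ˢ S') (p, p') (T ×ˢ T') (q, q')
      (Prod.map f f') (Prod.map g g') where
  mem := ⟨h.mem, h'.mem⟩
  map := by simp [h.map, h'.map]
  smooth := by
    refine SmoothGerm.prodMk ?_ ?_
    · exact h.smooth.comp (f := Prod.fst) (p := (p, p')) smoothGerm_fst ⟨h.mem, h'.mem⟩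
        (Filter.eventually_of_mem self_mem_nhdsWithin fun x hx => hx.1)
    · exact h'.smooth.comp (f := Prod.snd) (p := (p, p')) smoothGerm_snd ⟨h.mem, h'.mem⟩
        (Filter.eventually_of_mem self_mem_nhdsWithin fun x hx => hx.2)
  smooth_inv := by
    refine SmoothGerm.prodMk ?_ ?_
    · exact h.smooth_inv.comp (f := Prod.fst) (p := (q, q')) smoothGerm_fst ⟨h.mem', h'.mem'⟩
        (Filter.eventually_of_mem self_mem_nhdsWithin fun x hx => hx.1)
    · exact h'.smooth_inv.comp (f := Prod.snd) (p := (q, q')) smoothGerm_snd ⟨h.mem', h'.mem'⟩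
        (Filter.eventually_of_mem self_mem_nhdsWithin fun x hx => hx.2)
  left := by
    rw [nhdsWithin_prod_eq]
    filter_upwards [h.left.prod_mk h'.left] with x hx
    exact ⟨⟨hx.1.1, hx.2.1⟩, Prod.ext hx.1.2 hx.2.2⟩
  right := by
    rw [nhdsWithin_prod_eq]
    filter_upwards [h.right.prod_mk h'.right] with x hx
    exact ⟨⟨hx.1.1, hx.2.1⟩, Prod.ext hx.1.2 hx.2.2⟩

theorem congr {f' : M → N} (h : SetDiffeoAt I J S p T q f g)
    (he : ∀ᶠ x in 𝓝[S] p, f' x = f x) : SetDiffeoAt I J S p T q f' g where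
  mem := h.mem
  map := by rw [he.self_of_nhdsWithin h.mem, h.map]
  smooth := h.smooth.congr he
  smooth_inv := h.smooth_inv
  left := by
    filter_upwards [h.left, he] with x h1 h2
    rwa [h2]
  right := by
    filter_upwards [h.right, h.symm.tendsto.eventually he] with x h1 h2
    rwa [h2]

/-- A smooth bijection between subsets with smooth inverse. -/
theorem of_contMDiffOn (hf : ContMDiffOn I J ∞ f S) (hg : ContMDiffOn J I ∞ g T)
    (hfT : ∀ x ∈ S, f x ∈ T ∧ g (f x) = x) (hgS : ∀ y ∈ T, g y ∈ S ∧ f (g y) = y) (hp : p ∈ S) :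
    SetDiffeoAt I J S p T (f p) f g :=
  ⟨hp, rfl, hf.smoothGerm p, hg.smoothGerm _, Filter.eventually_of_mem self_mem_nhdsWithin hfT,
    Filter.eventually_of_mem self_mem_nhdsWithin hgS⟩

end SetDiffeoAt

end SmoothGerm

/-! ### The inverse function theorem -/

section InverseFunction

variable {E E' : Type*} [NormedAddCommGroup E] [NormedSpace ℝ E] [NormedAddCommGroup E']
  [NormedSpace ℝ E'] [FiniteDimensional ℝ E]

/-- Invertible operators form an open set and the derivative is continuous, so the local inverse can
be restricted to an open set where `f` is smooth with invertible derivative. There the inverse is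
smooth at every point of the target, not only at the image of `p`. -/
theorem exists_smooth_openPartialHomeomorph {f : E → E'} {p : E} (e : E ≃L[ℝ] E')
    (hf : ∀ᶠ x in 𝓝 p, ContDiffAt ℝ ∞ f x) (he : HasFDerivAt f (e : E →L[ℝ] E') p) :
    ∃ Φ : OpenPartialHomeomorph E E', p ∈ Φ.source ∧ ⇑Φ = f ∧ ContDiffOn ℝ ∞ Φ Φ.source ∧
      ContDiffOn ℝ ∞ Φ.symm Φ.target := by
  have : CompleteSpace E := FiniteDimensional.complete ℝ E
  have hfp : ContDiffAt ℝ ∞ f p := hf.self_of_nhds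
  have hn : (∞ : WithTop ℕ∞) ≠ 0 := by simp
  let Ψ := hfp.toOpenPartialHomeomorph f he hn
  have hcont : ContinuousAt (fderiv ℝ f) p := (hfp.fderiv_right (m := 0) (by simp)).continuousAt
  have hinv : ∀ᶠ x in 𝓝 p, fderiv ℝ f x ∈ range ((↑) : (E ≃L[ℝ] E') → E →L[ℝ] E') := by
    refine hcont.eventually ?_
    rw [he.fderiv]
    exact ContinuousLinearEquiv.nhds e
  obtain ⟨O, hO, hOo, hpO⟩ := eventually_nhds_iff.1 (hf.and hinv)
  have hsrc : (Ψ.restrOpen O hOo).source = Ψ.source ∩ O := rfl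
  refine ⟨Ψ.restrOpen O hOo, ⟨hfp.mem_toOpenPartialHomeomorph_source he hn, hpO⟩, rfl, ?_, ?_⟩
  · intro x hx
    exact (hO x hx.2).1.contDiffWithinAt
  · intro y hy
    have hx := (Ψ.restrOpen O hOo).map_target hy
    obtain ⟨e', he'⟩ := (hO _ hx.2).2
    refine ((Ψ.restrOpen O hOo).contDiffAt_symm hy (f₀' := e') ?_ (hO _ hx.2).1).contDiffWithinAt
    rw [he']
    exact ((hO _ hx.2).1.differentiableAt hn).hasFDerivAt

end InverseFunction

/-! ### Normal forms of submersions and immersions between vector spaces -/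

section NormalForms

variable {E E' F : Type*} [NormedAddCommGroup E] [NormedSpace ℝ E] [NormedAddCommGroup E']
  [NormedSpace ℝ E'] [NormedAddCommGroup F] [NormedSpace ℝ F] [FiniteDimensional ℝ E]
  [FiniteDimensional ℝ E'] [FiniteDimensional ℝ F]

/-- Chain rule for `f ∘ σ = id`. A section thus stands in for surjectivity of the derivative and
also supplies a splitting of it. -/
theorem rightInverse_fderiv {f : E → E'} {σ : E' → E} {u : E} {b : E'}
    (hf : DifferentiableAt ℝ f u) (hσ : DifferentiableAt ℝ σ b) (hu : σ b = u)
    (h : ∀ᶠ y in 𝓝 b, f (σ y) = y) : RightInverse (fderiv ℝ σ b) (fderiv ℝ f u) := by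
  intro v
  subst hu
  have h1 : HasFDerivAt (fun y => f (σ y)) ((fderiv ℝ f (σ b)).comp (fderiv ℝ σ b)) b :=
    hf.hasFDerivAt.comp b hσ.hasFDerivAt
  have h2 : HasFDerivAt (fun y => f (σ y)) (ContinuousLinearMap.id ℝ E') b :=
    (hasFDerivAt_id b).congr_of_eventuallyEq h
  exact congrArg (fun A : E' →L[ℝ] E' => A v) (h1.unique h2)

theorem finrank_le_of_local_section {f : E → E'} {σ : E' → E} {u : E} {b : E'}
    (hf : DifferentiableAt ℝ f u) (hσ : DifferentiableAt ℝ σ b) (hu : σ b = u)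
    (h : ∀ᶠ y in 𝓝 b, f (σ y) = y) : Module.finrank ℝ E' ≤ Module.finrank ℝ E :=
  LinearMap.finrank_le_finrank_of_injective (f := (fderiv ℝ σ b).toLinearMap)
    (rightInverse_fderiv hf hσ hu h).injective

/-- A map with a local section is locally a projection along which the section is straight. -/
theorem exists_submersion_chart {f : E → E'} {σ : E' → E} {u : E} {b : E'}
    (hf : ∀ᶠ x in 𝓝 u, ContDiffAt ℝ ∞ f x) (hσ : ∀ᶠ y in 𝓝 b, ContDiffAt ℝ ∞ σ y)
    (hu : σ b = u) (hb : f u = b) (h : ∀ᶠ y in 𝓝 b, f (σ y) = y)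
    (hF : Module.finrank ℝ E' + Module.finrank ℝ F = Module.finrank ℝ E) :
    ∃ (Λ : E ≃L[ℝ] E' × F) (Φ : OpenPartialHomeomorph E (E' × F)), u ∈ Φ.source ∧
      (∀ x, Φ x = (f x, (Λ (x - σ (f x))).2)) ∧
      ContDiffOn ℝ ∞ Φ Φ.source ∧ ContDiffOn ℝ ∞ Φ.symm Φ.target := by
  have hn : (∞ : WithTop ℕ∞) ≠ 0 := by simp
  have hfd := hf.self_of_nhds.differentiableAt hn
  have hσd := hσ.self_of_nhds.differentiableAt hn
  have hri := rightInverse_fderiv hfd hσd hu h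
  set f' := fderiv ℝ f u
  set σ' := fderiv ℝ σ b
  -- The splitting `x ↦ (f' x, x - σ' (f' x))` of `E` as `E' × ker f'`; the kernel is then
  -- identified with `F` by dimension.
  let e₁ := ContinuousLinearEquiv.equivOfRightInverse f' σ' hri
  have hdim : Module.finrank ℝ f'.ker = Module.finrank ℝ F := by
    have := e₁.toLinearEquiv.finrank_eq
    rw [Module.finrank_prod] at this
    omega
  let i : f'.ker ≃L[ℝ] F := ContinuousLinearEquiv.ofFinrankEq hdim
  let Λ : E ≃L[ℝ] E' × F := e₁.trans ((ContinuousLinearEquiv.refl ℝ E').prodCongr i)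
  have hΛ1 : ∀ x, (Λ x).1 = f' x := fun x => rfl
  -- The second component of `Λ` kills the range of `σ'`. Subtracting `σ (f x)` therefore leaves the
  -- derivative at `u` equal to `Λ`, while it sends the section to the zero section.
  have hΛ2 : ∀ x, (Λ (x - σ' (f' x))).2 = (Λ x).2 := by
    intro x
    change i (e₁ (x - σ' (f' x))).2 = i (e₁ x).2
    congr 1
    apply Subtype.ext
    have h1 := hri (f' x)
    simp [e₁, h1]
  have hsmooth : ∀ᶠ x in 𝓝 u, ContDiffAt ℝ ∞ (fun x => (f x, (Λ (x - σ (f x))).2)) x := by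
    have ht : Filter.Tendsto f (𝓝 u) (𝓝 b) := by
      have := hf.self_of_nhds.continuousAt
      rwa [ContinuousAt, hb] at this
    filter_upwards [hf, ht.eventually hσ] with x h1 h2
    refine h1.prodMk ?_
    have h3 : ContDiffAt ℝ ∞ (fun x => x - σ (f x)) x := contDiffAt_id.sub (h2.comp x h1)
    have h4 : ContDiff ℝ ∞ (fun v => (Λ v).2) := contDiff_snd.comp Λ.contDiff
    exact h4.contDiffAt.comp x h3
  have hder : HasFDerivAt (fun x => (f x, (Λ (x - σ (f x))).2)) (Λ : E →L[ℝ] E' × F) u := by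
    have h1 : HasFDerivAt f f' u := hfd.hasFDerivAt
    have h2 : HasFDerivAt (fun x => σ (f x)) (σ'.comp f') u := by
      refine HasFDerivAt.comp u ?_ h1
      rw [hb]
      exact hσd.hasFDerivAt
    have h3 := (hasFDerivAt_id u).sub h2
    have h4 := ((ContinuousLinearMap.snd ℝ E' F).comp
      (Λ : E →L[ℝ] E' × F)).hasFDerivAt.comp u h3
    refine (h1.prodMk h4).congr_fderiv ?_
    ext x
    · exact (hΛ1 x).symm
    · exact hΛ2 x
  obtain ⟨Φ, h1, h2, h3, h4⟩ := exists_smooth_openPartialHomeomorph Λ hsmooth hder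
  exact ⟨Λ, Φ, h1, fun x => by rw [h2], h3, h4⟩

/-- Choose a complement of the range; the dimension hypothesis identifies it with `F`. -/
theorem exists_equiv_extending (f' : E →L[ℝ] E') (hinj : Injective f')
    (hF : Module.finrank ℝ E + Module.finrank ℝ F = Module.finrank ℝ E') :
    ∃ Λ : (E × F) ≃L[ℝ] E', ∀ x, Λ (x, 0) = f' x := by
  obtain ⟨C, hC⟩ := Submodule.exists_isCompl (f'.toLinearMap.range)
  have hdim : Module.finrank ℝ F = Module.finrank ℝ C := by
    have h1 := Submodule.finrank_add_eq_of_isCompl hC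
    rw [LinearMap.finrank_range_of_inj hinj] at h1
    omega
  let i : F ≃ₗ[ℝ] C := LinearEquiv.ofFinrankEq _ _ hdim
  exact ⟨(((LinearEquiv.ofInjective f'.toLinearMap hinj).prodCongr i).trans
      (Submodule.prodEquivOfIsCompl _ _ hC)).toContinuousLinearEquiv, fun x => by simp⟩

/-- A map with a left inverse that is differentiable within its range has injective derivative. -/
theorem fderiv_injective_of_left_inverse {f : E → E'} {q : E' → E} {S : Set E'} {u : E}
    (hf : DifferentiableAt ℝ f u) (hq : DifferentiableWithinAt ℝ q S (f u))
    (h : ∀ᶠ v in 𝓝 u, f v ∈ S ∧ q (f v) = v) : Injective (fderiv ℝ f u) := by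
  have hW : f ⁻¹' S ∈ 𝓝 u := h.mono fun v hv => hv.1
  -- Derivatives within `S` need not be unique, but `f ⁻¹' S` is a neighbourhood of `u`, so the
  -- composite has an ordinary derivative, and any choice of derivative of `q` within `S` is a left
  -- inverse of that of `f`.
  have hcomp := (hq.hasFDerivWithinAt.comp u hf.hasFDerivAt.hasFDerivWithinAt
    (s := f ⁻¹' S) (fun v hv => hv)).hasFDerivAt hW
  have hid : HasFDerivAt (q ∘ f) (ContinuousLinearMap.id ℝ E) u :=
    (hasFDerivAt_id u).congr_of_eventuallyEq (h.mono fun v hv => hv.2)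
  have heq := hcomp.unique hid
  refine LeftInverse.injective (g := fderivWithin ℝ q S (f u)) fun v => ?_
  exact congrArg (fun A : E →L[ℝ] E => A v) heq

/-- A map with injective derivative is locally a linear embedding. -/
theorem exists_immersion_chart {f : E → E'} {u : E}
    (hf : ∀ᶠ x in 𝓝 u, ContDiffAt ℝ ∞ f x) (hinj : Injective (fderiv ℝ f u))
    (hF : Module.finrank ℝ E + Module.finrank ℝ F = Module.finrank ℝ E') :
    ∃ (Λ : (E × F) ≃L[ℝ] E') (Φ : OpenPartialHomeomorph (E × F) E'), (u, 0) ∈ Φ.source ∧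
      (∀ x, Φ x = f x.1 + Λ (0, x.2)) ∧
      ContDiffOn ℝ ∞ Φ Φ.source ∧ ContDiffOn ℝ ∞ Φ.symm Φ.target := by
  have hn : (∞ : WithTop ℕ∞) ≠ 0 := by simp
  have hfd := hf.self_of_nhds.differentiableAt hn
  set f' := fderiv ℝ f u
  obtain ⟨Λ, hΛ₀⟩ := exists_equiv_extending (F := F) f' hinj hF
  have hΛ : ∀ x, Λ x = f' x.1 + Λ (0, x.2) := by
    intro x
    rw [← hΛ₀ x.1, ← map_add]
    simp
  have hsmooth : ∀ᶠ x in 𝓝 (u, (0 : F)), ContDiffAt ℝ ∞ (fun x => f x.1 + Λ (0, x.2)) x := by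
    have ht : Filter.Tendsto Prod.fst (𝓝 (u, (0 : F))) (𝓝 u) := continuous_fst.tendsto _
    filter_upwards [ht.eventually hf] with x h1
    refine (h1.comp x contDiffAt_fst).add ?_
    exact (Λ.contDiff.comp (contDiff_const.prodMk contDiff_snd)).contDiffAt
  have hder : HasFDerivAt (fun x : E × F => f x.1 + Λ (0, x.2)) (Λ : E × F →L[ℝ] E') (u, 0) := by
    have h1 : HasFDerivAt (fun x : E × F => f x.1) (f'.comp (ContinuousLinearMap.fst ℝ E F))
        (u, 0) := HasFDerivAt.comp (u, (0 : F)) hfd.hasFDerivAt hasFDerivAt_fst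
    have h2 := ((Λ : E × F →L[ℝ] E').comp
      ((ContinuousLinearMap.inr ℝ E F).comp (ContinuousLinearMap.snd ℝ E F))).hasFDerivAt
      (x := (u, (0 : F)))
    refine (h1.add h2).congr_fderiv ?_
    refine ContinuousLinearMap.ext fun x => ?_
    exact (hΛ x).symm
  obtain ⟨Φ, h1, h2, h3, h4⟩ := exists_smooth_openPartialHomeomorph Λ hsmooth hder
  exact ⟨Λ, Φ, h1, fun x => by rw [h2], h3, h4⟩

end NormalForms

/-! ### Charts -/

section Charts

variable {E H M E' H' N : Type*}
  [NormedAddCommGroup E] [NormedSpace ℝ E] [TopologicalSpace H] {I : ModelWithCorners ℝ E H}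
  [TopologicalSpace M] [ChartedSpace H M]
  [NormedAddCommGroup E'] [NormedSpace ℝ E'] [TopologicalSpace H'] {J : ModelWithCorners ℝ E' H'}
  [TopologicalSpace N] [ChartedSpace H' N]

theorem SmoothGerm.of_contMDiffOn_open {f : M → N} {U : Set M} (hU : IsOpen U)
    (hf : ContMDiffOn I J ∞ f U) {p : M} (hp : p ∈ U) : SmoothGerm I J f univ p := by
  rw [SmoothGerm, nhdsWithin_univ]
  filter_upwards [hU.mem_nhds hp] with x hx
  exact contMDiffWithinAt_univ.2 (hf.contMDiffAt (hU.mem_nhds hx))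

/-- A chart is a germ of diffeomorphism onto the model vector space. -/
theorem setDiffeoAt_extChartAt [I.Boundaryless] [IsManifold I ∞ M] (p : M) :
    SetDiffeoAt I 𝓘(ℝ, E) univ p univ (extChartAt I p p) (extChartAt I p)
      (extChartAt I p).symm where
  mem := mem_univ p
  map := rfl
  smooth := SmoothGerm.of_contMDiffOn_open (chartAt H p).open_source contMDiffOn_extChartAt
    (mem_chart_source H p)
  smooth_inv := SmoothGerm.of_contMDiffOn_open (isOpen_extChartAt_target p)
    (contMDiffOn_extChartAt_symm p) (mem_extChartAt_target p)
  left := by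
    rw [nhdsWithin_univ]
    filter_upwards [extChartAt_source_mem_nhds (I := I) p] with x hx
    exact ⟨mem_univ _, (extChartAt I p).left_inv hx⟩
  right := by
    rw [nhdsWithin_univ]
    filter_upwards [extChartAt_target_mem_nhds (I := I) p] with x hx
    exact ⟨mem_univ _, (extChartAt I p).right_inv hx⟩

/-- A smooth linear equivalence as a germ of diffeomorphism. -/
theorem ContinuousLinearEquiv.setDiffeoAt (e : E ≃L[ℝ] E') (p : E) :
    SetDiffeoAt 𝓘(ℝ, E) 𝓘(ℝ, E') univ p univ (e p) e e.symm :=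
  SetDiffeoAt.of_contMDiffOn e.contDiff.contMDiff.contMDiffOn
    e.symm.contDiff.contMDiff.contMDiffOn (fun x _ => ⟨mem_univ _, e.symm_apply_apply x⟩)
    (fun x _ => ⟨mem_univ _, e.apply_symm_apply x⟩) (mem_univ p)

theorem OpenPartialHomeomorph.setDiffeoAt {Φ : OpenPartialHomeomorph E E'}
    (h1 : ContDiffOn ℝ ∞ Φ Φ.source) (h2 : ContDiffOn ℝ ∞ Φ.symm Φ.target) {p : E}
    (hp : p ∈ Φ.source) : SetDiffeoAt 𝓘(ℝ, E) 𝓘(ℝ, E') univ p univ (Φ p) Φ Φ.symm where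
  mem := mem_univ p
  map := rfl
  smooth := SmoothGerm.of_contMDiffOn_open Φ.open_source h1.contMDiffOn hp
  smooth_inv := SmoothGerm.of_contMDiffOn_open Φ.open_target h2.contMDiffOn (Φ.map_source hp)
  left := by
    rw [nhdsWithin_univ]
    filter_upwards [Φ.open_source.mem_nhds hp] with x hx
    exact ⟨mem_univ _, Φ.left_inv hx⟩
  right := by
    rw [nhdsWithin_univ]
    filter_upwards [Φ.open_target.mem_nhds (Φ.map_source hp)] with x hx
    exact ⟨mem_univ _, Φ.right_inv hx⟩

variable (I) in
/-- The chart `φ` followed by the diffeomorphism `Φ` between open subsets of the model space. -/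
noncomputable def modifiedChart [I.Boundaryless] (φ : OpenPartialHomeomorph M H)
    (Φ : OpenPartialHomeomorph E E) : OpenPartialHomeomorph M H :=
  φ.trans ((I.toHomeomorph.toOpenPartialHomeomorph.trans Φ).trans
    I.toHomeomorph.symm.toOpenPartialHomeomorph)

theorem modifiedChart_source [I.Boundaryless] (φ : OpenPartialHomeomorph M H)
    (Φ : OpenPartialHomeomorph E E) :
    (modifiedChart I φ Φ).source = φ.source ∩ φ.extend I ⁻¹' Φ.source := by
  ext x
  simp [modifiedChart]

theorem modifiedChart_extend_apply [I.Boundaryless] (φ : OpenPartialHomeomorph M H)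
    (Φ : OpenPartialHomeomorph E E) (x : M) :
    (modifiedChart I φ Φ).extend I x = Φ (φ.extend I x) := by
  simp [modifiedChart, I.right_inv (I.range_eq_univ ▸ mem_univ _)]

theorem modifiedChart_extend_symm_apply [I.Boundaryless] (φ : OpenPartialHomeomorph M H)
    (Φ : OpenPartialHomeomorph E E) (x : E) :
    ((modifiedChart I φ Φ).extend I).symm x = (φ.extend I).symm (Φ.symm x) := by
  simp [modifiedChart, I.right_inv (I.range_eq_univ ▸ mem_univ _)]

/-- Without boundary `I` is a homeomorphism, so `Φ` conjugated by `I` belongs to the smooth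
groupoid, under which the maximal atlas is stable. This turns normal forms in vector spaces into the
charts that define submersions and immersions. -/
theorem modifiedChart_mem_maximalAtlas [I.Boundaryless] {φ : OpenPartialHomeomorph M H}
    (hφ : φ ∈ IsManifold.maximalAtlas I ∞ M) {Φ : OpenPartialHomeomorph E E}
    (h1 : ContDiffOn ℝ ∞ Φ Φ.source) (h2 : ContDiffOn ℝ ∞ Φ.symm Φ.target) :
    modifiedChart I φ Φ ∈ IsManifold.maximalAtlas I ∞ M := by
  have hr : ∀ x, I (I.symm x) = x := fun x => I.right_inv (I.range_eq_univ ▸ mem_univ _)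
  set Ψ := (I.toHomeomorph.toOpenPartialHomeomorph.trans Φ).trans
    I.toHomeomorph.symm.toOpenPartialHomeomorph
  have hΨ : Ψ ∈ contDiffGroupoid ∞ I := by
    rw [contDiffGroupoid, mem_groupoid_of_pregroupoid]
    constructor
    · refine h1.congr_mono (fun x _ => ?_) (fun x hx => ?_)
      · simp [Ψ, hr]
      · simpa [Ψ, hr] using hx.1
    · refine h2.congr_mono (fun x _ => ?_) (fun x hx => ?_)
      · simp [Ψ, hr]
      · simpa [Ψ, hr] using hx.1
  rw [IsManifold.mem_maximalAtlas_iff, mem_maximalAtlas_iff] at hφ ⊢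
  intro e he
  obtain ⟨ha, hb⟩ := hφ e he
  constructor
  · change (φ.trans Ψ).symm.trans e ∈ _
    rw [OpenPartialHomeomorph.trans_symm_eq_symm_trans_symm, OpenPartialHomeomorph.trans_assoc]
    exact (contDiffGroupoid ∞ I).trans ((contDiffGroupoid ∞ I).symm hΨ) ha
  · change e.symm.trans (φ.trans Ψ) ∈ _
    rw [← OpenPartialHomeomorph.trans_assoc]
    exact (contDiffGroupoid ∞ I).trans hb hΨ

end Charts

/-! ### Submersions and local sections -/

section Submersions

variable {E H M E' H' N : Type*}
  [NormedAddCommGroup E] [NormedSpace ℝ E] [TopologicalSpace H] {I : ModelWithCorners ℝ E H}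
  [TopologicalSpace M] [ChartedSpace H M]
  [NormedAddCommGroup E'] [NormedSpace ℝ E'] [TopologicalSpace H'] {J : ModelWithCorners ℝ E' H'}
  [TopologicalSpace N] [ChartedSpace H' N]
  [I.Boundaryless] [J.Boundaryless] [IsManifold I ∞ M] [IsManifold J ∞ N]

theorem mem_extend_target_iff (φ : OpenPartialHomeomorph M H) (v : E) :
    v ∈ (φ.extend I).target ↔ I.symm v ∈ φ.target := by
  simp [I.range_eq_univ]

theorem isOpen_extend_target_of_boundaryless (φ : OpenPartialHomeomorph M H) :
    IsOpen (φ.extend I).target := by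
  have : (φ.extend I).target = I.symm ⁻¹' φ.target := by
    ext v
    exact mem_extend_target_iff φ v
  rw [this]
  exact φ.open_target.preimage I.continuous_symm

theorem contMDiffOn_extend_symm_of_boundaryless {φ : OpenPartialHomeomorph M H}
    (hφ : φ ∈ IsManifold.maximalAtlas I ∞ M) :
    ContMDiffOn 𝓘(ℝ, E) I ∞ (φ.extend I).symm (φ.extend I).target := by
  have := contMDiffOn_extend_symm hφ
  rwa [← OpenPartialHomeomorph.extend_target'] at this

theorem extend_mem_target (φ : OpenPartialHomeomorph M H) {x : M} (hx : x ∈ φ.source) :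
    φ.extend I x ∈ (φ.extend I).target :=
  (φ.extend I).map_source (by rwa [OpenPartialHomeomorph.extend_source])

/-- In adapted charts the map is the first projection of `Λ`; the section freezes the second
coordinate at its value at `x`. -/
theorem Manifold.IsSubmersionAt.exists_local_section {f : M → N} {x : M}
    (h : IsSubmersionAt I J ∞ f x) :
    ∃ σ : N → M, SmoothGerm J I σ univ (f x) ∧ σ (f x) = x ∧ ∀ᶠ y in 𝓝 (f x), f (σ y) = y := by
  obtain ⟨F, _, _, φ, ψ, hx, hfx, hφ, hψ, hsub, Λ, hw⟩ := h
  set t : F := (Λ (φ.extend I x)).2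
  let a : N → E := fun y => Λ.symm (ψ.extend J y, t)
  have hax : a (f x) = φ.extend I x := by
    have h1 : ψ.extend J (f x) = (Λ (φ.extend I x)).1 := by
      have := hw (extend_mem_target φ hx)
      simpa only [comp_apply, φ.extend_left_inv hx] using this
    simp only [a, h1, t, Prod.mk.eta, ContinuousLinearEquiv.symm_apply_apply]
  have ha : ContMDiffOn J 𝓘(ℝ, E) ∞ a ψ.source := by
    have h1 : ContMDiffOn J 𝓘(ℝ, E') ∞ (ψ.extend J) ψ.source := ψ.contMDiffOn_extend hψ
    have h2 : ContDiff ℝ ∞ (fun v : E' => Λ.symm (v, t)) :=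
      Λ.symm.contDiff.comp (contDiff_id.prodMk contDiff_const)
    exact h2.contMDiff.comp_contMDiffOn h1
  have hag : SmoothGerm J 𝓘(ℝ, E) a univ (f x) :=
    SmoothGerm.of_contMDiffOn_open ψ.open_source ha hfx
  have hT : a ⁻¹' (φ.extend I).target ∈ 𝓝 (f x) := by
    have := (ha.contMDiffAt (ψ.open_source.mem_nhds hfx)).continuousAt
    exact this.preimage_mem_nhds
      ((isOpen_extend_target_of_boundaryless φ).mem_nhds (hax ▸ extend_mem_target φ hx))
  refine ⟨fun y => (φ.extend I).symm (a y), ?_, ?_, ?_⟩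
  · refine SmoothGerm.comp_univ (q := φ.extend I x) ?_ hag (mem_univ _) hax
    exact SmoothGerm.of_contMDiffOn_open (isOpen_extend_target_of_boundaryless φ)
      (contMDiffOn_extend_symm_of_boundaryless hφ) (extend_mem_target φ hx)
  · simp only [hax]
    exact φ.extend_left_inv hx
  · filter_upwards [hT, ψ.open_source.mem_nhds hfx] with y hy hy'
    have h1 := hw hy
    simp only [comp_apply] at h1
    have h2 : (Λ (a y)).1 = ψ.extend J y := by simp [a]
    rw [h2] at h1
    refine (ψ.extend J).injOn ?_ ?_ h1
    · rw [OpenPartialHomeomorph.extend_source]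
      refine hsub ?_
      have := (φ.extend I).map_target hy
      rwa [OpenPartialHomeomorph.extend_source] at this
    · rwa [OpenPartialHomeomorph.extend_source]

/-- A smooth map with a smooth local section through every point is a submersion. -/
theorem isSubmersion_of_local_sections [FiniteDimensional ℝ E] [FiniteDimensional ℝ E']
    {f : M → N} (hf : ContMDiff I J ∞ f)
    (h : ∀ x, ∃ σ : N → M, SmoothGerm J I σ univ (f x) ∧ σ (f x) = x ∧
      ∀ᶠ y in 𝓝 (f x), f (σ y) = y) : IsSubmersion I J ∞ f := by
  refine IsSubmersionOfComplement.isSubmersion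
    (F := EuclideanSpace ℝ (Fin (Module.finrank ℝ E - Module.finrank ℝ E'))) fun x => ?_
  obtain ⟨σ, hσ, hσx, hσf⟩ := h x
  have hφ := setDiffeoAt_extChartAt (I := I) x
  have hψ := setDiffeoAt_extChartAt (I := J) (f x)
  set u := extChartAt I x x
  set b := extChartAt J (f x) (f x)
  have hfs : SmoothGerm 𝓘(ℝ, E) 𝓘(ℝ, E')
      (fun v => extChartAt J (f x) (f ((extChartAt I x).symm v))) univ u := by
    refine hψ.smooth.comp_univ (f := fun v => f ((extChartAt I x).symm v)) ?_
      (mem_univ _) (by rw [hφ.map_inv])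
    exact (hf.smoothGerm univ x).comp_univ hφ.smooth_inv (mem_univ _) hφ.map_inv
  have hσs : SmoothGerm 𝓘(ℝ, E') 𝓘(ℝ, E)
      (fun v => extChartAt I x (σ ((extChartAt J (f x)).symm v))) univ b := by
    refine hφ.smooth.comp_univ (f := fun v => σ ((extChartAt J (f x)).symm v)) ?_
      (mem_univ _) (by rw [hψ.map_inv, hσx])
    exact hσ.comp_univ hψ.smooth_inv (mem_univ _) hψ.map_inv
  have hsec : ∀ᶠ v in 𝓝 b, extChartAt J (f x) (f ((extChartAt I x).symm
      (extChartAt I x (σ ((extChartAt J (f x)).symm v))))) = v := by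
    have t1 : Filter.Tendsto (extChartAt J (f x)).symm (𝓝 b) (𝓝 (f x)) := by
      simpa only [nhdsWithin_univ] using hψ.symm.tendsto
    have t2 : Filter.Tendsto σ (𝓝 (f x)) (𝓝 x) := by
      have := hσ.contMDiffAt.continuousAt
      rwa [ContinuousAt, hσx] at this
    have l1 := hφ.left
    have r1 := hψ.right
    rw [nhdsWithin_univ] at l1 r1
    filter_upwards [(t2.comp t1).eventually l1, t1.eventually hσf, r1] with v h1 h2 h3
    simp only [comp_apply] at h1
    rw [h1.2, h2, h3.2]
  -- This makes the truncated subtraction in the dimension of the complement a true one.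
  have hle : Module.finrank ℝ E' ≤ Module.finrank ℝ E :=
    finrank_le_of_local_section (hfs.eventually_contDiffAt.self_of_nhds.differentiableAt (by simp))
      (hσs.eventually_contDiffAt.self_of_nhds.differentiableAt (by simp))
      (by rw [hψ.map_inv, hσx]) hsec
  obtain ⟨Λ, Φ, hu, hΦ, hΦ1, hΦ2⟩ := exists_submersion_chart
    (F := EuclideanSpace ℝ (Fin (Module.finrank ℝ E - Module.finrank ℝ E')))
    hfs.eventually_contDiffAt hσs.eventually_contDiffAt
    (by rw [hψ.map_inv, hσx]) (by rw [hφ.map_inv]) hsec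
    (by rw [finrank_euclideanSpace_fin]; omega)
  -- `Φ` lands in the product; composing with `Λ⁻¹` returns to `E`, so that in the modified chart
  -- the map is `v ↦ (Λ v).1`.
  let Φ' : OpenPartialHomeomorph E E := Φ.trans Λ.symm.toHomeomorph.toOpenPartialHomeomorph
  have hs : Φ'.source = Φ.source := by simp [Φ']
  have ht : ∀ v, v ∈ Φ'.target ↔ Λ v ∈ Φ.target := by intro v; simp [Φ']
  refine IsSubmersionAtOfComplement.mk_of_continuousAt hf.continuous.continuousAt Λ
    (modifiedChart I (chartAt H x) Φ') (chartAt H' (f x)) ?_ (mem_chart_source H' (f x)) ?_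
    (IsManifold.chart_mem_maximalAtlas _) ?_
  · rw [modifiedChart_source, hs]
    exact ⟨mem_chart_source H x, hu⟩
  · refine modifiedChart_mem_maximalAtlas (IsManifold.chart_mem_maximalAtlas _) ?_ ?_
    · rw [hs]
      exact Λ.symm.contDiff.comp_contDiffOn hΦ1
    · exact hΦ2.comp Λ.contDiff.contDiffOn (fun v hv => (ht v).1 hv)
  · intro v hv
    have hvt : Λ v ∈ Φ.target := by
      have h1 := ((modifiedChart I (chartAt H x) Φ').extend I).map_target hv
      have h2 := ((modifiedChart I (chartAt H x) Φ').extend I).right_inv hv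
      rw [OpenPartialHomeomorph.extend_source, modifiedChart_source] at h1
      rw [modifiedChart_extend_apply] at h2
      rw [← ht, ← h2]
      exact Φ'.map_source h1.2
    have h1 : Φ'.symm v = Φ.symm (Λ v) := by simp [Φ']
    simp only [comp_apply, modifiedChart_extend_symm_apply, h1]
    have h2 := congrArg Prod.fst (hΦ (Φ.symm (Λ v)))
    rw [Φ.right_inv hvt] at h2
    exact h2.symm

/-- A smooth map with injective derivatives in charts is an immersion. -/
theorem isImmersion_of_fderiv_injective [FiniteDimensional ℝ E] [FiniteDimensional ℝ E']
    {f : M → N} (hf : ContMDiff I J ∞ f)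
    (h : ∀ x, Injective (fderiv ℝ (fun v => extChartAt J (f x) (f ((extChartAt I x).symm v)))
      (extChartAt I x x))) : IsImmersion I J ∞ f := by
  refine IsImmersionOfComplement.isImmersion
    (F := EuclideanSpace ℝ (Fin (Module.finrank ℝ E' - Module.finrank ℝ E))) fun x => ?_
  have hφ := setDiffeoAt_extChartAt (I := I) x
  have hψ := setDiffeoAt_extChartAt (I := J) (f x)
  set u := extChartAt I x x
  set b := extChartAt J (f x) (f x)
  have hfs : SmoothGerm 𝓘(ℝ, E) 𝓘(ℝ, E')
      (fun v => extChartAt J (f x) (f ((extChartAt I x).symm v))) univ u := by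
    refine hψ.smooth.comp_univ (f := fun v => f ((extChartAt I x).symm v)) ?_
      (mem_univ _) (by rw [hφ.map_inv])
    exact (hf.smoothGerm univ x).comp_univ hφ.smooth_inv (mem_univ _) hφ.map_inv
  have hle : Module.finrank ℝ E ≤ Module.finrank ℝ E' :=
    LinearMap.finrank_le_finrank_of_injective (f := (fderiv ℝ _ _).toLinearMap) (h x)
  obtain ⟨Λ, Φ, hu, hΦ, hΦ1, hΦ2⟩ := exists_immersion_chart
    (F := EuclideanSpace ℝ (Fin (Module.finrank ℝ E' - Module.finrank ℝ E)))
    hfs.eventually_contDiffAt (h x) (by rw [finrank_euclideanSpace_fin]; omega)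
  let Φ' : OpenPartialHomeomorph E' E' := Φ.symm.trans Λ.toHomeomorph.toOpenPartialHomeomorph
  have hs : Φ'.source = Φ.target := by simp [Φ']
  have ht : ∀ v, v ∈ Φ'.target ↔ Λ.symm v ∈ Φ.source := by intro v; simp [Φ']
  have hΦb : Φ (u, 0) = b := by
    rw [hΦ, hφ.map_inv]
    simp [b, show ((0 : E), (0 : EuclideanSpace ℝ (Fin (Module.finrank ℝ E' -
      Module.finrank ℝ E)))) = 0 from rfl]
  -- The source chart is shrunk to the points whose coordinates `v` have `(v, 0)` in the source of
  -- `Φ`, since the normal form needs `Φ⁻¹ (Φ (v, 0)) = (v, 0)` on the whole chart.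
  let O : Set M := (extChartAt I x).source ∩
    (fun y => (extChartAt I x y, (0 : EuclideanSpace ℝ (Fin (Module.finrank ℝ E' -
      Module.finrank ℝ E))))) ⁻¹' Φ.source
  have hO : IsOpen O :=
    ((continuousOn_extChartAt x).prodMk continuousOn_const).isOpen_inter_preimage
      (isOpen_extChartAt_source x) Φ.open_source
  refine IsImmersionAtOfComplement.mk_of_continuousAt hf.continuous.continuousAt Λ
    ((chartAt H x).restr O) (modifiedChart J (chartAt H' (f x)) Φ') ?_ ?_ ?_ ?_ ?_
  · rw [OpenPartialHomeomorph.restr_source, hO.interior_eq]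
    exact ⟨mem_chart_source H x, mem_extChartAt_source x, hu⟩
  · rw [modifiedChart_source, hs]
    refine ⟨mem_chart_source H' (f x), ?_⟩
    change b ∈ Φ.target
    rw [← hΦb]
    exact Φ.map_source hu
  · exact restr_mem_maximalAtlas _ (IsManifold.chart_mem_maximalAtlas (I := I) x) hO
  · refine modifiedChart_mem_maximalAtlas (IsManifold.chart_mem_maximalAtlas _) ?_ ?_
    · rw [hs]
      exact Λ.contDiff.comp_contDiffOn hΦ2
    · exact hΦ1.comp Λ.symm.contDiff.contDiffOn (fun v hv => (ht v).1 hv)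
  · intro v hv
    have h1 := (((chartAt H x).restr O).extend I).map_target hv
    have h2 := (((chartAt H x).restr O).extend I).right_inv hv
    rw [OpenPartialHomeomorph.extend_source, OpenPartialHomeomorph.restr_source,
      hO.interior_eq] at h1
    set y := (((chartAt H x).restr O).extend I).symm v
    have hy : extChartAt I x y = v := h2
    have hyO : y ∈ O := h1.2
    have h3 : (v, (0 : EuclideanSpace ℝ (Fin (Module.finrank ℝ E' - Module.finrank ℝ E))))
      ∈ Φ.source := by
      rw [← hy]; exact hyO.2
    have h4 : (extChartAt I x).symm v = y := by rw [← hy]; exact (extChartAt I x).left_inv hyO.1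
    have h5 := hΦ (v, 0)
    simp only [h4, show ((0 : E), (0 : EuclideanSpace ℝ (Fin (Module.finrank ℝ E' -
      Module.finrank ℝ E)))) = 0 from rfl, map_zero, add_zero] at h5
    simp only [comp_apply, modifiedChart_extend_apply]
    change Φ' (extChartAt J (f x) (f y)) = _
    rw [← h5]
    simp [Φ', Φ.left_inv h3]

end Submersions

/-! ### Subsets that are locally diffeomorphic to a vector space, and submanifold structures -/

section Submanifolds

variable {E H M E' H' N E'' H'' P : Type*}
  [NormedAddCommGroup E] [NormedSpace ℝ E] [TopologicalSpace H] {I : ModelWithCorners ℝ E H}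
  [TopologicalSpace M] [ChartedSpace H M]
  [NormedAddCommGroup E'] [NormedSpace ℝ E'] [TopologicalSpace H'] {J : ModelWithCorners ℝ E' H'}
  [TopologicalSpace N] [ChartedSpace H' N]
  [NormedAddCommGroup E''] [NormedSpace ℝ E''] [TopologicalSpace H'']
  {L : ModelWithCorners ℝ E'' H''} [TopologicalSpace P] [ChartedSpace H'' P]

variable (I) in
/-- Near `p`, the set `S` is diffeomorphic to an open subset of `ℝᵈ`. -/
def HasDimAt (d : ℕ) (S : Set M) (p : M) : Prop :=
  ∃ (q : EuclideanSpace ℝ (Fin d)) (f : M → EuclideanSpace ℝ (Fin d))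
    (g : EuclideanSpace ℝ (Fin d) → M), SetDiffeoAt I (𝓡 d) S p univ q f g

theorem HasDimAt.mem {d : ℕ} {S : Set M} {p : M} (h : HasDimAt I d S p) : p ∈ S := by
  obtain ⟨_, _, _, h⟩ := h
  exact h.mem

theorem SetDiffeoAt.hasDimAt {d : ℕ} {S : Set M} {p : M} {T : Set N} {q : N} {f : M → N}
    {g : N → M} (h : SetDiffeoAt I J S p T q f g) (hT : HasDimAt J d T q) : HasDimAt I d S p := by
  obtain ⟨_, _, _, hT⟩ := hT
  exact ⟨_, _, _, h.trans hT⟩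

theorem hasDimAt_univ [I.Boundaryless] [IsManifold I ∞ M] [FiniteDimensional ℝ E] {d : ℕ}
    (hd : Module.finrank ℝ E = d) (p : M) : HasDimAt I d (univ : Set M) p := by
  have h : Module.finrank ℝ E = Module.finrank ℝ (EuclideanSpace ℝ (Fin d)) := by
    rw [hd, finrank_euclideanSpace_fin]
  let e : E ≃L[ℝ] EuclideanSpace ℝ (Fin d) := ContinuousLinearEquiv.ofFinrankEq h
  exact ⟨_, _, _, (setDiffeoAt_extChartAt p).trans (e.setDiffeoAt _)⟩

theorem HasDimAt.prod {d d' : ℕ} {S : Set M} {p : M} {T : Set N} {q : N}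
    (hS : HasDimAt I d S p) (hT : HasDimAt J d' T q) :
    HasDimAt (I.prod J) (d + d') (S ×ˢ T) (p, q) := by
  obtain ⟨_, _, _, hS⟩ := hS
  obtain ⟨_, _, _, hT⟩ := hT
  refine (hS.prod hT).hasDimAt ?_
  rw [univ_prod_univ]
  exact hasDimAt_univ (by simp) _

/-- The germs are turned into a chart for the relative topology. The ambient representatives `f` and
`g` are kept because a transition map is then `f' ∘ g`, whose smoothness makes sense before `S` has
any smooth structure. -/
theorem HasDimAt.exists_chart {d : ℕ} {S : Set M} {p : S} (h : HasDimAt I d S p) :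
    ∃ (φ : OpenPartialHomeomorph S (EuclideanSpace ℝ (Fin d)))
      (f : M → EuclideanSpace ℝ (Fin d)) (g : EuclideanSpace ℝ (Fin d) → M),
      p ∈ φ.source ∧ (∀ x, φ x = f x) ∧ (∀ y ∈ φ.target, (φ.symm y : M) = g y) ∧
      (∀ x ∈ φ.source, ContMDiffWithinAt I (𝓡 d) ∞ f S x) ∧ ContMDiffOn (𝓡 d) I ∞ g φ.target := by
  classical
  obtain ⟨q, f, g, h⟩ := h
  have hsm := h.smooth_inv
  have hr := h.right
  rw [SmoothGerm, nhdsWithin_univ] at hsm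
  rw [nhdsWithin_univ] at hr
  obtain ⟨V, hV, hVo, hqV⟩ := eventually_nhds_iff.1 (hr.and hsm)
  obtain ⟨U, hUo, hpU, hU⟩ := mem_nhdsWithin.1 (h.left.and h.smooth)
  have hgV : ContMDiffOn (𝓡 d) I ∞ g V := fun y hy =>
    (contMDiffWithinAt_univ.1 (hV y hy).2).contMDiffWithinAt
  have hUS : ∀ x : S, (x : M) ∈ U → g (f x) = x ∧ ContMDiffWithinAt I (𝓡 d) ∞ f S x :=
    fun x hx => ⟨(hU ⟨hx, x.2⟩).1.2, (hU ⟨hx, x.2⟩).2⟩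
  have hfc : ContinuousOn (fun x : S => f x) (Subtype.val ⁻¹' U) := by
    intro x hx
    refine ContinuousAt.continuousWithinAt ?_
    exact continuousWithinAt_iff_continuousAt_domRestrict f x.2 |>.1 (hUS x hx).2.continuousWithinAt
  let φ : OpenPartialHomeomorph S (EuclideanSpace ℝ (Fin d)) :=
    { toFun := fun x => f x
      -- The default `p` plays no role: on the target, `g` takes values in `S`.
      invFun := fun y => if hy : g y ∈ S then ⟨g y, hy⟩ else p
      source := Subtype.val ⁻¹' U ∩ (fun x : S => f x) ⁻¹' V
      target := V ∩ g ⁻¹' U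
      map_source' := fun x hx => ⟨hx.2, by
        change g (f x) ∈ U
        rw [(hUS x hx.1).1]; exact hx.1⟩
      map_target' := fun y hy => by
        have h1 := (hV y hy.1).1
        rw [dif_pos h1.1]
        refine ⟨hy.2, ?_⟩
        change f (g y) ∈ V
        rw [h1.2]
        exact hy.1
      left_inv' := fun x hx => by
        have h1 := (hUS x hx.1).1
        have h2 : g (f x) ∈ S := by rw [h1]; exact x.2
        rw [dif_pos h2]
        exact Subtype.ext h1
      right_inv' := fun y hy => by
        have h1 := (hV y hy.1).1
        rw [dif_pos h1.1]
        exact h1.2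
      open_source := hfc.isOpen_inter_preimage (hUo.preimage continuous_subtype_val) hVo
      open_target := hgV.continuousOn.isOpen_inter_preimage hVo hUo
      continuousOn_toFun := hfc.mono inter_subset_left
      continuousOn_invFun := by
        rw [Topology.IsInducing.subtypeVal.continuousOn_iff]
        refine (hgV.continuousOn.mono inter_subset_left).congr fun y hy => ?_
        have h1 := (hV y hy.1).1
        simp [h1.1] }
  refine ⟨φ, f, g, ?_, fun x => rfl, ?_, ?_, hgV.mono inter_subset_left⟩
  · exact ⟨hpU, by change f p ∈ V; rw [h.map]; exact hqV⟩
  · intro y hy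
    have h1 := (hV y hy.1).1
    change ((if hy : g y ∈ S then (⟨g y, hy⟩ : S) else p : S) : M) = g y
    rw [dif_pos h1.1]
  · exact fun x hx => (hUS x hx.1).2

/-- A subset that is locally diffeomorphic to `ℝᵈ` carries a submanifold structure. -/
theorem nonempty_submanifoldStructure [I.Boundaryless] [IsManifold I ∞ M] [FiniteDimensional ℝ E]
    {d : ℕ} {S : Set M} (hS : ∀ p ∈ S, HasDimAt I d S p) :
    Nonempty (SubmanifoldStructure I S) := by
  choose φ f g hp hφ hφs hf hg using fun p : S => (hS p p.2).exists_chart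
  let cs : ChartedSpace (EuclideanSpace ℝ (Fin d)) S :=
    { atlas := range φ
      chartAt := φ
      mem_chart_source := hp
      chart_mem_atlas := fun p => mem_range_self p }
  have hM : IsManifold (𝓡 d) ∞ S := by
    refine isManifold_of_contDiffOn (𝓡 d) ∞ S ?_
    rintro _ _ ⟨p, rfl⟩ ⟨p', rfl⟩ y hy
    have hy1 : y ∈ (φ p).target ∧ (φ p).symm y ∈ (φ p').source := by simpa using hy
    have hsub : ∀ z, z ∈ (𝓡 d).symm ⁻¹' ((φ p).symm.trans (φ p')).source ∩ range (𝓡 d) →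
        z ∈ (φ p).target := fun z hz => by
      have : z ∈ (φ p).target ∧ (φ p).symm z ∈ (φ p').source := by simpa using hz
      exact this.1
    have h1 : ContMDiffWithinAt (𝓡 d) (𝓡 d) ∞ (fun z => f p' (g p z)) (φ p).target y := by
      refine ContMDiffWithinAt.comp y (t := S) ?_ (hg p y hy1.1) ?_
      · rw [← hφs p y hy1.1]
        exact hf p' _ hy1.2
      · intro z hz
        rw [← hφs p z hz]
        exact Subtype.coe_prop _
    refine (h1.contDiffWithinAt.mono hsub).congr (fun z hz => ?_) ?_
    · have := hφs p z (hsub z hz)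
      simp [hφ, this]
    · have := hφs p y hy1.1
      simp [hφ, this]
  have hval : ContMDiff (𝓡 d) I ∞ (Subtype.val : S → M) := by
    intro x
    have h1 : ContMDiffOn (𝓡 d) (𝓡 d) ∞ (φ x) (φ x).source :=
      contMDiffOn_of_mem_maximalAtlas (IsManifold.chart_mem_maximalAtlas x)
    have h2 := (hg x).comp h1 (fun y hy => (φ x).map_source hy)
    have h3 : ContMDiffOn (𝓡 d) I ∞ (Subtype.val : S → M) (φ x).source :=
      h2.congr fun y hy => by
        rw [comp_apply, ← hφs x _ ((φ x).map_source hy), (φ x).left_inv hy]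
    exact h3.contMDiffAt ((φ x).open_source.mem_nhds (hp x))
  refine ⟨⟨d, cs, hM, ⟨isImmersion_of_fderiv_injective hval fun x => ?_,
    Topology.IsEmbedding.subtypeVal⟩⟩⟩
  set ψ := extChartAt I (x : M)
  set u := φ x x
  have hu : u ∈ (φ x).target := (φ x).map_source (hp x)
  have hgu : g x u = x := by rw [← hφs x u hu, (φ x).left_inv (hp x)]
  have hev : ∀ᶠ v in 𝓝 u, v ∈ (φ x).target := (φ x).open_target.mem_nhds hu
  change Injective (fderiv ℝ (fun v => ψ ((φ x).symm v : S)) u)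
  have hψ := setDiffeoAt_extChartAt (I := I) (x : M)
  have hgx : SmoothGerm (𝓡 d) I (g x) univ u :=
    SmoothGerm.of_contMDiffOn_open (φ x).open_target (hg x) hu
  have hψg : SmoothGerm (𝓡 d) 𝓘(ℝ, E) (fun v => ψ (g x v)) univ u :=
    hψ.smooth.comp_univ hgx (mem_univ _) hgu
  have hA : fderiv ℝ (fun v => ψ ((φ x).symm v : S)) u = fderiv ℝ (fun v => ψ (g x v)) u := by
    refine Filter.EventuallyEq.fderiv_eq ?_
    filter_upwards [hev] with v hv
    rw [hφs x v hv]
  rw [hA]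
  -- Read in the chart `ψ`, the parametrization `g x` has the left inverse `f x ∘ ψ⁻¹`, which is
  -- smooth within `S'` only; this suffices for injectivity of the derivative.
  set S' : Set E := ψ.symm ⁻¹' S
  have hψx : ψ.symm (ψ (g x u)) = x := by rw [hgu]; exact hψ.map_inv
  have hc : ContMDiffWithinAt 𝓘(ℝ, E) (𝓡 d) ∞ (fun w => f x (ψ.symm w)) S' (ψ (g x u)) := by
    refine ContMDiffWithinAt.comp (I' := I) (t := S) (f := ψ.symm) _ ?_ ?_ (fun w hw => hw)
    · rw [hψx]
      exact hf x x (hp x)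
    · rw [hgu]
      exact hψ.smooth_inv.contMDiffAt.contMDiffWithinAt
  have hleft : ∀ᶠ v in 𝓝 u, ψ.symm (ψ (g x v)) = g x v := by
    have h1 := hψ.left
    rw [nhdsWithin_univ] at h1
    have h2 : Filter.Tendsto (g x) (𝓝 u) (𝓝 (x : M)) := by
      have := hgx.contMDiffAt.continuousAt
      rwa [ContinuousAt, hgu] at this
    filter_upwards [h2.eventually h1] with v hv using hv.2
  refine fderiv_injective_of_left_inverse
    (hψg.eventually_contDiffAt.self_of_nhds.differentiableAt (by simp))
    (hc.contDiffWithinAt.differentiableWithinAt (by simp)) ?_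
  filter_upwards [hleft, hev] with v h1 h2
  constructor
  · change ψ.symm (ψ (g x v)) ∈ S
    rw [h1, ← hφs x v h2]
    exact Subtype.coe_prop _
  · rw [h1, ← hφs x v h2, ← hφ, (φ x).right_inv h2]

theorem isSubmanifold_of_hasDimAt [I.Boundaryless] [IsManifold I ∞ M] [FiniteDimensional ℝ E]
    {d : ℕ} {S : Set M} (hne : S.Nonempty) (hS : ∀ p ∈ S, HasDimAt I d S p) :
    IsSubmanifold I S :=
  ⟨hne, nonempty_submanifoldStructure hS⟩

open Classical in
/-- The inverse of the inclusion of `S`, extended by a constant. -/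
noncomputable def toSubtype (S : Set M) (p₀ : S) (x : M) : S := if h : x ∈ S then ⟨x, h⟩ else p₀

theorem toSubtype_of_mem {S : Set M} (p₀ : S) {x : M} (h : x ∈ S) :
    toSubtype S p₀ x = ⟨x, h⟩ := dif_pos h

@[simp]
theorem toSubtype_coe {S : Set M} (p₀ x : S) : toSubtype S p₀ x = x := dif_pos x.2

namespace SubmanifoldStructure

variable {S : Set M} (A : SubmanifoldStructure I S)

/-- In the charts of the immersion the inclusion is `v ↦ Λ (v, 0)`, so the first component of `Λ⁻¹`
in the ambient chart recovers the chart of `S`. Intrinsic smoothness on `S` can thereby be exchanged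
for ambient smoothness within `S`. -/
theorem contMDiffOn_toSubtype (p₀ : S) :
    letI := A.chartedSpace
    ContMDiffOn I (𝓡 A.dim) ∞ (toSubtype S p₀) S := by
  let := A.chartedSpace
  have := A.isManifold
  refine contMDiffOn_of_smoothGerm fun p hpS => ?_
  obtain ⟨F, _, _, φ, ψ, hx, hfx, hφ, hψ, hsub, Λ, hw⟩ :=
    A.isSmoothEmbedding.isImmersion.isImmersionAt ⟨p, hpS⟩
  have hw' : ∀ y ∈ φ.source, φ.extend (𝓡 A.dim) y = (Λ.symm (ψ.extend I (y : M))).1 := by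
    intro y hy
    have h1 := hw (extend_mem_target φ hy)
    simp only [comp_apply, φ.extend_left_inv hy] at h1
    rw [h1]
    simp
  let b : M → EuclideanSpace ℝ (Fin A.dim) := fun y => (Λ.symm (ψ.extend I y)).1
  have hb : SmoothGerm I (𝓡 A.dim) b S p := by
    have h1 : ContMDiffOn I 𝓘(ℝ, E) ∞ (ψ.extend I) ψ.source := ψ.contMDiffOn_extend hψ
    have h2 : ContDiff ℝ ∞ (fun v => (Λ.symm v).1) := contDiff_fst.comp Λ.symm.contDiff
    exact (SmoothGerm.of_contMDiffOn_open ψ.open_source (h2.contMDiff.comp_contMDiffOn h1)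
      hfx).mono (subset_univ S)
  have hc : SmoothGerm I (𝓡 A.dim) (fun y => (φ.extend (𝓡 A.dim)).symm (b y)) S p := by
    refine SmoothGerm.comp_univ (q := φ.extend (𝓡 A.dim) ⟨p, hpS⟩) ?_ hb hpS (hw' _ hx).symm
    exact SmoothGerm.of_contMDiffOn_open (isOpen_extend_target_of_boundaryless φ)
      (contMDiffOn_extend_symm_of_boundaryless hφ) (extend_mem_target φ hx)
  refine hc.congr ?_
  -- The relative topology enters here: the chart domain is the trace of an open set of `M`, so
  -- ambient closeness to `p` puts points of `S` into the chart.
  obtain ⟨O, hO, hOφ⟩ := isOpen_induced_iff.1 φ.open_source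
  have hpO : p ∈ O := by
    have : (⟨p, hpS⟩ : S) ∈ Subtype.val ⁻¹' O := hOφ ▸ hx
    exact this
  filter_upwards [mem_nhdsWithin_of_mem_nhds (hO.mem_nhds hpO), self_mem_nhdsWithin] with y h1 h2
  have h3 : (⟨y, h2⟩ : S) ∈ φ.source := by rw [← hOφ]; exact h1
  rw [toSubtype_of_mem p₀ h2]
  simp only [b]
  rw [← hw' ⟨y, h2⟩ h3, φ.extend_left_inv h3]

theorem setDiffeoAt (p₀ : S) :
    letI := A.chartedSpace
    SetDiffeoAt I (𝓡 A.dim) S p₀ univ p₀ (toSubtype S p₀) Subtype.val := by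
  let := A.chartedSpace
  have h := SetDiffeoAt.of_contMDiffOn (A.contMDiffOn_toSubtype p₀)
    (A.isSmoothEmbedding.contMDiff.contMDiffOn (s := univ))
    (fun x hx => ⟨mem_univ _, by rw [toSubtype_of_mem p₀ hx]⟩)
    (fun y _ => ⟨y.2, toSubtype_coe p₀ y⟩) p₀.2
  rwa [toSubtype_coe] at h

theorem hasDimAt {p : M} (hp : p ∈ S) : HasDimAt I A.dim S p := by
  let := A.chartedSpace
  have := A.isManifold
  exact (A.setDiffeoAt ⟨p, hp⟩).hasDimAt (hasDimAt_univ (by simp) _)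

/-- A function on a submanifold is smooth if it is the restriction of a function smooth on it. -/
theorem contMDiff_of_contMDiffOn {F : S → N} {F' : M → N} (hF' : ContMDiffOn I J ∞ F' S)
    (h : ∀ x : S, F x = F' x) :
    letI := A.chartedSpace
    ContMDiff (𝓡 A.dim) J ∞ F := by
  let := A.chartedSpace
  have h1 : ContMDiff (𝓡 A.dim) J ∞ (fun x : S => F' x) :=
    contMDiffOn_univ.1 (hF'.comp A.isSmoothEmbedding.contMDiff.contMDiffOn fun x _ => x.2)
  exact (funext h : F = fun x : S => F' x) ▸ h1

/-- A smooth function on a submanifold defines a function smooth on it. -/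
theorem contMDiffOn_comp_toSubtype {F : S → N} (p₀ : S)
    (hF : letI := A.chartedSpace
      ContMDiff (𝓡 A.dim) J ∞ F) :
    ContMDiffOn I J ∞ (fun x => F (toSubtype S p₀ x)) S := by
  let := A.chartedSpace
  have hF : ContMDiff (𝓡 A.dim) J ∞ F := hF
  exact hF.comp_contMDiffOn (A.contMDiffOn_toSubtype p₀)

/-- The submersion criterion for functions on a submanifold. -/
theorem isSubmersion [J.Boundaryless] [IsManifold J ∞ N] [FiniteDimensional ℝ E']
    {F : S → N} {F' : M → N} (hF' : ContMDiffOn I J ∞ F' S)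
    (h : ∀ x : S, F x = F' x)
    (hs : ∀ x : S, ∃ σ : N → M, SmoothGerm J I σ univ (F x) ∧ σ (F x) = x ∧
      ∀ᶠ y in 𝓝 (F x), σ y ∈ S ∧ F' (σ y) = y) :
    letI := A.chartedSpace
    IsSubmersion (𝓡 A.dim) J ∞ F := by
  let := A.chartedSpace
  have := A.isManifold
  refine isSubmersion_of_local_sections (A.contMDiff_of_contMDiffOn hF' h) fun x => ?_
  obtain ⟨σ, h1, h2, h3⟩ := hs x
  refine ⟨fun y => toSubtype S x (σ y), ?_, ?_, ?_⟩
  · refine ((A.contMDiffOn_toSubtype x).smoothGerm (σ (F x))).comp h1 (mem_univ _) ?_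
    rw [nhdsWithin_univ]
    exact h3.mono fun y hy => hy.1
  · simp only [h2, toSubtype_coe]
  · filter_upwards [h3] with y hy
    rw [h, toSubtype_of_mem x hy.1]
    exact hy.2

end SubmanifoldStructure

end Submanifolds

/-! ### Local trivializations and fiber products -/

section FiberProducts

variable {E H M E' H' N E'' H'' P E₃ H₃ Q : Type*}
  [NormedAddCommGroup E] [NormedSpace ℝ E] [TopologicalSpace H] {I : ModelWithCorners ℝ E H}
  [TopologicalSpace M] [ChartedSpace H M]
  [NormedAddCommGroup E'] [NormedSpace ℝ E'] [TopologicalSpace H'] {J : ModelWithCorners ℝ E' H'}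
  [TopologicalSpace N] [ChartedSpace H' N]
  [NormedAddCommGroup E''] [NormedSpace ℝ E''] [TopologicalSpace H'']
  {L : ModelWithCorners ℝ E'' H''} [TopologicalSpace P] [ChartedSpace H'' P]

theorem SetDiffeoAt.refl {S : Set M} {p : M} (hp : p ∈ S) :
    SetDiffeoAt I I S p S p (fun x => x) (fun x => x) :=
  SetDiffeoAt.of_contMDiffOn contMDiffOn_id contMDiffOn_id (fun _ hx => ⟨hx, rfl⟩)
    (fun _ hx => ⟨hx, rfl⟩) hp

/-- A product of vector spaces carries two models, as a vector space and as a product manifold; the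
identity relates them. -/
theorem setDiffeoAt_prod_self (p : E × E') :
    SetDiffeoAt 𝓘(ℝ, E × E') (𝓘(ℝ, E).prod 𝓘(ℝ, E')) univ p univ p (fun x => (x.1, x.2))
      (fun x => (x.1, x.2)) := by
  have h1 : ContMDiff 𝓘(ℝ, E × E') (𝓘(ℝ, E).prod 𝓘(ℝ, E')) ∞ (fun x : E × E' => (x.1, x.2)) :=
    contDiff_fst.contMDiff.prodMk contDiff_snd.contMDiff
  have h2 : ContMDiff (𝓘(ℝ, E).prod 𝓘(ℝ, E')) 𝓘(ℝ, E × E') ∞ (fun x : E × E' => (x.1, x.2)) :=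
    contMDiff_fst.prodMk_space contMDiff_snd
  exact SetDiffeoAt.of_contMDiffOn h1.contMDiffOn h2.contMDiffOn (fun _ _ => ⟨mem_univ _, rfl⟩)
    (fun _ _ => ⟨mem_univ _, rfl⟩) (mem_univ p)

variable (I J) in
/-- `σ` is a germ of a smooth section of `F : S → P` through `p`. -/
structure IsSectionAt (F : M → N) (S : Set M) (P : Set N) (p : M) (σ : N → M) : Prop where
  smooth : SmoothGerm J I σ P (F p)
  map : σ (F p) = p
  right : ∀ᶠ b in 𝓝[P] (F p), σ b ∈ S ∧ F (σ b) = b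

theorem IsSectionAt.tendsto {F : M → N} {S : Set M} {P : Set N} {p : M} {σ : N → M}
    (h : IsSectionAt I J F S P p σ) (hp : F p ∈ P) :
    Filter.Tendsto σ (𝓝[P] (F p)) (𝓝[S] p) := by
  have := h.smooth.tendsto hp (h.right.mono fun b hb => hb.1)
  rwa [h.map] at this

/-- A map with a smooth section is, near the section, diffeomorphic to a projection
`P × ℝᶜ → P` with the section as the zero section. -/
theorem IsSectionAt.exists_trivialization {d k : ℕ} {F : M → N} {S : Set M} {P : Set N} {p : M}
    {σ : N → M} (hσ : IsSectionAt I J F S P p σ) (hS : HasDimAt I d S p)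
    (hP : HasDimAt J k P (F p)) (hF : SmoothGerm I J F S p) (hFP : ∀ᶠ x in 𝓝[S] p, F x ∈ P) :
    k ≤ d ∧ ∃ (T : M → EuclideanSpace ℝ (Fin (d - k)))
      (κ : N × EuclideanSpace ℝ (Fin (d - k)) → M),
      SetDiffeoAt I (J.prod (𝓡 (d - k))) S p (P ×ˢ univ) (F p, 0) (fun x => (F x, T x)) κ ∧
      ∀ᶠ b in 𝓝[P] (F p), T (σ b) = 0 := by
  obtain ⟨q₁, f₁, g₁, h₁⟩ := hS
  obtain ⟨q₂, f₂, g₂, h₂⟩ := hP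
  have hpP : F p ∈ P := h₂.mem
  have tF : Filter.Tendsto F (𝓝[S] p) (𝓝[P] (F p)) := hF.tendsto h₁.mem hFP
  have tσ := hσ.tendsto hpP
  have g₁S : ∀ᶠ v in 𝓝[univ] q₁, g₁ v ∈ S := h₁.right.mono fun v hv => hv.1
  have g₂P : ∀ᶠ v in 𝓝[univ] q₂, g₂ v ∈ P := h₂.right.mono fun v hv => hv.1
  -- `F` and `σ` in the coordinates of `S` and `P`, where the normal form of a map with a section
  -- applies.
  let fh := fun v => f₂ (F (g₁ v))
  let σh := fun w => f₁ (σ (g₂ w))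
  have hfh : SmoothGerm (𝓡 d) (𝓡 k) fh univ q₁ := by
    refine h₂.smooth.comp_of_eq (f := fun v => F (g₁ v)) ?_ (mem_univ _) (by rw [h₁.map_inv]) ?_
    · exact hF.comp_of_eq h₁.smooth_inv (mem_univ _) h₁.map_inv g₁S
    · exact h₁.symm.tendsto.eventually hFP
  have hσh : SmoothGerm (𝓡 k) (𝓡 d) σh univ q₂ := by
    refine h₁.smooth.comp_of_eq (f := fun v => σ (g₂ v)) ?_ (mem_univ _)
      (by rw [h₂.map_inv, hσ.map]) ?_
    · exact hσ.smooth.comp_of_eq h₂.smooth_inv (mem_univ _) h₂.map_inv g₂P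
    · exact h₂.symm.tendsto.eventually (hσ.right.mono fun b hb => hb.1)
  have hsec : ∀ᶠ w in 𝓝 q₂, fh (σh w) = w := by
    rw [← nhdsWithin_univ]
    filter_upwards [(tσ.comp h₂.symm.tendsto).eventually h₁.left,
      h₂.symm.tendsto.eventually hσ.right, h₂.right] with w e1 e2 e3
    simp only [comp_apply] at e1
    simp only [fh, σh, e1.2, e2.2, e3.2]
  have hb : fh q₁ = q₂ := by simp only [fh, h₁.map_inv, h₂.map]
  have hu : σh q₂ = q₁ := by simp only [σh, h₂.map_inv, hσ.map, h₁.map]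
  have hle : k ≤ d := by
    have := finrank_le_of_local_section
      (hfh.eventually_contDiffAt.self_of_nhds.differentiableAt (by simp))
      (hσh.eventually_contDiffAt.self_of_nhds.differentiableAt (by simp)) hu hsec
    simpa using this
  obtain ⟨Λ, Φ, huΦ, hΦ, hΦ1, hΦ2⟩ := exists_submersion_chart
    (F := EuclideanSpace ℝ (Fin (d - k))) hfh.eventually_contDiffAt hσh.eventually_contDiffAt
    hu hb hsec (by simp only [finrank_euclideanSpace_fin]; omega)
  have hΦq : Φ q₁ = (q₂, 0) := by
    rw [hΦ, hb, hu, sub_self, map_zero]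
    rfl
  have h₃ := OpenPartialHomeomorph.setDiffeoAt hΦ1 hΦ2 huΦ
  rw [hΦq] at h₃
  have h₄ := h₂.symm.prod (SetDiffeoAt.refl (I := 𝓡 (d - k))
    (mem_univ (0 : EuclideanSpace ℝ (Fin (d - k)))))
  rw [univ_prod_univ] at h₄
  have h₅ := ((h₁.trans h₃).trans (setDiffeoAt_prod_self _)).trans h₄
  refine ⟨hle, fun x => (Φ (f₁ x)).2, _, h₅.congr ?_, ?_⟩
  · filter_upwards [h₁.left, tF.eventually h₂.left] with x e1 e2
    simp only [Prod.map, hΦ, fh, e1.2, e2.2]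
  -- The fiber coordinate is built from `x - σ (f x)`, which vanishes along the section.
  · filter_upwards [tσ.eventually h₁.left, hσ.right, h₂.left] with b e1 e2 e3
    simp only [hΦ, fh, σh, e1.2, e2.2, e3.2, sub_self, map_zero]
    rfl

/-- The dimension of a fiber product. -/
theorem hasDimAt_fiberProduct {d₁ d₂ k : ℕ} {F₁ : M → P} {F₂ : N → P} {S₁ : Set M} {S₂ : Set N}
    {B : Set P} {p₁ : M} {p₂ : N} (h₁ : HasDimAt I d₁ S₁ p₁) (h₂ : HasDimAt J d₂ S₂ p₂)
    (hB : HasDimAt L k B (F₁ p₁)) (hF₁ : SmoothGerm I L F₁ S₁ p₁)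
    (hFB₁ : ∀ᶠ x in 𝓝[S₁] p₁, F₁ x ∈ B) (hF₂ : SmoothGerm J L F₂ S₂ p₂)
    (hFB₂ : ∀ᶠ x in 𝓝[S₂] p₂, F₂ x ∈ B) {σ : P → M} (hσ : IsSectionAt I L F₁ S₁ B p₁ σ)
    (heq : F₁ p₁ = F₂ p₂) :
    HasDimAt (I.prod J) (d₂ + (d₁ - k)) {x | x.1 ∈ S₁ ∧ x.2 ∈ S₂ ∧ F₁ x.1 = F₂ x.2} (p₁, p₂) := by
  obtain ⟨hle, T, κ, hT, -⟩ := hσ.exists_trivialization h₁ hB hF₁ hFB₁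
  set Z : Set (M × N) := {x | x.1 ∈ S₁ ∧ x.2 ∈ S₂ ∧ F₁ x.1 = F₂ x.2}
  have hpZ : (p₁, p₂) ∈ Z := ⟨h₁.mem, h₂.mem, heq⟩
  have hTp : T p₁ = 0 := congrArg Prod.snd hT.map
  have t1 : Filter.Tendsto Prod.fst (𝓝[Z] (p₁, p₂)) (𝓝[S₁] p₁) :=
    tendsto_nhdsWithin_iff.2 ⟨continuousWithinAt_fst,
      Filter.eventually_of_mem self_mem_nhdsWithin fun x hx => hx.1⟩
  have hF₂' : SmoothGerm (J.prod (𝓡 (d₁ - k))) (L.prod (𝓡 (d₁ - k)))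
      (fun y : N × EuclideanSpace ℝ (Fin (d₁ - k)) => (F₂ y.1, y.2)) (S₂ ×ˢ univ) (p₂, 0) := by
    refine SmoothGerm.prodMk ?_ smoothGerm_snd
    exact hF₂.comp (f := Prod.fst) (p := (p₂, (0 : EuclideanSpace ℝ (Fin (d₁ - k)))))
      smoothGerm_fst ⟨h₂.mem, mem_univ _⟩
      (Filter.eventually_of_mem self_mem_nhdsWithin fun x hx => hx.1)
  have hp₂ : (p₂, (0 : EuclideanSpace ℝ (Fin (d₁ - k)))) ∈
      S₂ ×ˢ (univ : Set (EuclideanSpace ℝ (Fin (d₁ - k)))) := ⟨h₂.mem, mem_univ _⟩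
  have hev : ∀ᶠ y in 𝓝[S₂ ×ˢ univ] (p₂, (0 : EuclideanSpace ℝ (Fin (d₁ - k)))),
      (F₂ y.1, y.2) ∈ B ×ˢ (univ : Set (EuclideanSpace ℝ (Fin (d₁ - k)))) := by
    have t : Filter.Tendsto Prod.fst
        (𝓝[S₂ ×ˢ univ] (p₂, (0 : EuclideanSpace ℝ (Fin (d₁ - k))))) (𝓝[S₂] p₂) :=
      tendsto_nhdsWithin_iff.2 ⟨continuousWithinAt_fst,
        Filter.eventually_of_mem self_mem_nhdsWithin fun x hx => hx.1⟩
    filter_upwards [t.eventually hFB₂] with y hy using ⟨hy, mem_univ _⟩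
  have t2 := hF₂'.tendsto hp₂ hev
  simp only [← heq] at t2
  -- In a trivialization of `F₁`, the base coordinate of the first point is forced to be `F₂` of the
  -- second. So the second point and the fiber coordinate `T` are free coordinates on the fiber
  -- product.
  have key : SetDiffeoAt (I.prod J) (J.prod (𝓡 (d₁ - k))) Z (p₁, p₂) (S₂ ×ˢ univ) (p₂, 0)
      (fun x => (x.2, T x.1)) (fun y => (κ (F₂ y.1, y.2), y.1)) :=
    { mem := hpZ
      map := by simp only [hTp]
      smooth := by
        refine SmoothGerm.prodMk smoothGerm_snd ?_
        have hTs : SmoothGerm I (𝓡 (d₁ - k)) T S₁ p₁ := hT.smooth.snd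
        exact hTs.comp (f := Prod.fst) (p := (p₁, p₂)) smoothGerm_fst hpZ
          (Filter.eventually_of_mem self_mem_nhdsWithin fun x hx => hx.1)
      smooth_inv := by
        refine SmoothGerm.prodMk ?_ smoothGerm_fst
        exact hT.smooth_inv.comp_of_eq hF₂' hp₂ (by simp only [heq]) hev
      left := by
        filter_upwards [t1.eventually hT.left, self_mem_nhdsWithin] with x e1 e2
        refine ⟨⟨e2.2.1, mem_univ _⟩, Prod.ext ?_ rfl⟩
        simp only [← e2.2.2]
        exact e1.2
      right := by
        filter_upwards [t2.eventually hT.right, self_mem_nhdsWithin] with y e1 e2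
        have e3 := e1.2
        simp only [Prod.mk.injEq] at e3
        exact ⟨⟨e1.1, e2.1, e3.1⟩, Prod.ext rfl e3.2⟩ }
  refine key.hasDimAt (h₂.prod ?_)
  exact hasDimAt_univ (by simp) _

end FiberProducts

/-! ### The partial multiplication of a groupoid -/

namespace RelGroupoid

section Algebra

variable {Γ : Type*} (G : RelGroupoid Γ)

/-- The set of composable pairs. -/
def composable : Set (Γ × Γ) := {p | G.eR p.1 = G.eL p.2}

open Classical in
/-- The multiplication, extended to all pairs. -/
noncomputable def pmul (p : Γ × Γ) : Γ :=
  -- The default is arbitrary; smoothness is asserted only on `composable`.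
  if h : G.eR p.1 = G.eL p.2 then G.mul p.1 p.2 h else p.1

variable {G}

theorem pmul_mem {x y : Γ} (h : G.eR x = G.eL y) : (G.pmul (x, y), (x, y)) ∈ G.m := by
  rw [pmul, dif_pos h]
  exact G.mul_mem h

theorem pmul_eq {x y z : Γ} (h : (z, (x, y)) ∈ G.m) : G.pmul (x, y) = z :=
  G.mul_unique (pmul_mem (G.eR_eq_eL h)) h

theorem mem_m_iff {x y z : Γ} : (z, (x, y)) ∈ G.m ↔ G.eR x = G.eL y ∧ G.pmul (x, y) = z :=
  ⟨fun h => ⟨G.eR_eq_eL h, pmul_eq h⟩, fun ⟨h, h'⟩ => h' ▸ pmul_mem h⟩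

theorem mul_eq_pmul {x y : Γ} (h : G.eR x = G.eL y) : G.mul x y h = G.pmul (x, y) :=
  (pmul_eq (G.mul_mem h)).symm

theorem eL_pmul {x y : Γ} (h : G.eR x = G.eL y) : G.eL (G.pmul (x, y)) = G.eL x :=
  G.eL_mul_eq (pmul_mem h)

theorem eR_pmul {x y : Γ} (h : G.eR x = G.eL y) : G.eR (G.pmul (x, y)) = G.eR y :=
  G.eR_mul_eq (pmul_mem h)

theorem eL_s (x : Γ) : G.eL (G.s x) = G.eR x := by
  rw [← G.eR_s, G.involutive]

theorem pmul_s_self (x : Γ) : G.pmul (G.s x, x) = G.eR x := pmul_eq (G.s_mul_self x)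

theorem pmul_self_s (x : Γ) : G.pmul (x, G.s x) = G.eL x := by
  rw [pmul_eq (G.self_mul_s x), G.eR_s]

theorem pmul_eL (x : Γ) : G.pmul (G.eL x, x) = x := pmul_eq (G.eL_mul x)

theorem pmul_eR (x : Γ) : G.pmul (x, G.eR x) = x := pmul_eq (G.mul_eR x)

theorem pmul_s_pmul {x y : Γ} (h : G.eR x = G.eL y) : G.pmul (G.s x, G.pmul (x, y)) = y :=
  pmul_eq (G.left_cancel (pmul_mem h))

theorem pmul_pmul_s {x y : Γ} (h : G.eL x = G.eL y) : G.pmul (x, G.pmul (G.s x, y)) = y := by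
  have := pmul_s_pmul (G := G) (x := G.s x) (y := y) (by rw [G.eR_s, h])
  rwa [G.involutive] at this

theorem pmul_assoc {x y z : Γ} (h : G.eR x = G.eL y) (h' : G.eR y = G.eL z) :
    G.pmul (G.pmul (x, y), z) = G.pmul (x, G.pmul (y, z)) := by
  have h1 : (G.pmul (G.pmul (x, y), z), (G.pmul (x, y), z)) ∈ G.m :=
    pmul_mem (by rw [eR_pmul h, h'])
  obtain ⟨v, hv, hv'⟩ := (G.assoc_iff _ x y z).1 ⟨_, h1, pmul_mem h⟩
  rw [pmul_eq hv', pmul_eq hv]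

theorem eL_of_mem_units {a : Γ} (ha : a ∈ G.units) : G.eL a = a := by
  have h := G.eL_mul a
  exact G.units_eq (G.eL_mem a) ha h

theorem eR_of_mem_units {a : Γ} (ha : a ∈ G.units) : G.eR a = a := by
  have h := G.mul_eR a
  exact (G.units_eq ha (G.eR_mem a) h).symm

end Algebra

/-! ### Smoothness of the structure maps of a differential groupoid -/

section Smooth

variable {E H Γ : Type*} [NormedAddCommGroup E] [NormedSpace ℝ E] [TopologicalSpace H]
  (I : ModelWithCorners ℝ E H) [TopologicalSpace Γ] [ChartedSpace H Γ] (G : RelGroupoid Γ)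

/-- The smoothness properties of the structure maps of a differential groupoid with identities of
dimension `k`. -/
structure SmoothMaps (k : ℕ) : Prop where
  smooth_s : ContMDiff I I ∞ G.s
  smooth_eL : ContMDiff I I ∞ G.eL
  smooth_eR : ContMDiff I I ∞ G.eR
  smooth_pmul : ContMDiffOn (I.prod I) I ∞ G.pmul G.composable
  units_dim : ∀ a ∈ G.units, HasDimAt I k G.units a
  section_eL : ∀ x, ∃ σ, IsSectionAt I I G.eL univ G.units x σ
  section_eR : ∀ x, ∃ σ, IsSectionAt I I G.eR univ G.units x σ

variable {I G}

/-- The equation `m = f iᵀ` forces the submanifold to be the set of composable pairs and `f` to be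
the product; the rest is smoothness and local sections of a submersion. -/
theorem IsDifferential.smooth_pmul_and_section (hG : G.IsDifferential I) :
    ContMDiffOn (I.prod I) I ∞ G.pmul G.composable ∧
    ∀ x y, G.eR x = G.eL y → ∃ σ : Γ → Γ × Γ, SmoothGerm I (I.prod I) σ univ (G.pmul (x, y)) ∧
      σ (G.pmul (x, y)) = (x, y) ∧ ∀ᶠ z in 𝓝 (G.pmul (x, y)), (z, σ z) ∈ G.m := by
  obtain ⟨hm, -, hb, -, -⟩ := hG.manifold
  obtain ⟨-, C, hne, A, f, hsurj, hsub, hr⟩ := hG.m_reduction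
  let _ := A.chartedSpace
  have := A.isManifold
  have hmem : ∀ c : C, (f c, (c : Γ × Γ)) ∈ G.m := by
    intro c
    rw [hr]
    exact ⟨c, rfl, rfl⟩
  have hC : C = G.composable := by
    ext ⟨x, y⟩
    constructor
    · intro h
      exact G.eR_eq_eL (hmem ⟨_, h⟩)
    · intro h
      have h1 := pmul_mem (G := G) (x := x) (y := y) h
      rw [hr] at h1
      obtain ⟨c, -, hc⟩ := h1
      have hc : (x, y) = (c : Γ × Γ) := hc
      rw [hc]
      exact c.2
  have hf : ∀ c : C, f c = G.pmul c := fun c => (pmul_eq (hmem c)).symm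
  subst hC
  constructor
  · obtain ⟨c₀, hc₀⟩ := hne
    refine (A.contMDiffOn_comp_toSubtype ⟨c₀, hc₀⟩ hsub.contMDiff).congr fun p hp => ?_
    rw [toSubtype_of_mem _ hp, hf]
  · intro x y h
    have hp : (x, y) ∈ G.composable := h
    obtain ⟨σ, h1, h2, h3⟩ := (hsub.isSubmersionAt ⟨_, hp⟩).exists_local_section
    rw [hf] at h1 h2 h3
    refine ⟨fun z => (σ z : Γ × Γ), ?_, ?_, ?_⟩
    · exact (A.isSmoothEmbedding.contMDiff.smoothGerm univ _).comp_univ h1 (mem_univ _) rfl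
    · change ((σ (G.pmul (x, y)) : G.composable) : Γ × Γ) = (x, y)
      rw [h2]
    · filter_upwards [h3] with z hz
      have := hmem (σ z)
      rwa [hz] at this

/-- `e_R(x) = s(x)x` and `e_L = e_R ∘ s` are smooth. A section of the product through `(x, s(x))`
sends an identity `a` to a pair with product `a`, whose first member has left identity `a`.
Conjugating by `s` handles `e_R`, and the graph of `e` is a copy of `Γ⁰`. -/
theorem IsDifferential.exists_smoothMaps (hG : G.IsDifferential I) :
    ∃ k, SmoothMaps I G k := by
  obtain ⟨hm, hsec⟩ := hG.smooth_pmul_and_section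
  have hs : ContMDiff I I ∞ G.s := by
    obtain ⟨φ, hφ⟩ := hG.s_diffeo
    rw [← hφ]
    exact φ.contMDiff
  have hR : ContMDiff I I ∞ G.eR := by
    have h1 : ContMDiff I (I.prod I) ∞ (fun x => (G.s x, x)) := hs.prodMk contMDiff_id
    have h2 : ContMDiff I I ∞ (fun x => G.pmul (G.s x, x)) :=
      contMDiffOn_univ.1 (hm.comp h1.contMDiffOn fun x _ => G.eR_eq_eL (G.s_mul_self x))
    exact (funext fun x => (pmul_s_self x).symm : G.eR = fun x => G.pmul (G.s x, x)) ▸ h2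
  have hL : ContMDiff I I ∞ G.eL :=
    (funext fun x => (G.eR_s x).symm : G.eL = fun x => G.eR (G.s x)) ▸ hR.comp hs
  have hsL : ∀ x, ∃ σ, IsSectionAt I I G.eL univ G.units x σ := by
    intro x
    obtain ⟨σ, h1, h2, h3⟩ := hsec x (G.s x) (eL_s x).symm
    rw [pmul_self_s] at h1 h2 h3
    refine ⟨fun a => (σ a).1, (h1.mono (subset_univ _)).fst, by rw [h2], ?_⟩
    filter_upwards [h3.filter_mono nhdsWithin_le_nhds, self_mem_nhdsWithin] with a ha hu
    refine ⟨mem_univ _, ?_⟩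
    rw [← G.eL_mul_eq ha, eL_of_mem_units hu]
  obtain ⟨-, ⟨A⟩⟩ := hG.e_differentiable
  refine ⟨A.dim, hs, hL, hR, hm, fun a ha => ?_, hsL, fun x => ?_⟩
  · have h1 := A.hasDimAt (p := (a, 0)) ((G.mem_e_iff 0).2 ha)
    have h2 : SetDiffeoAt I (I.prod (𝓡 0)) G.units a (G.e : Set (Γ × OnePt)) (a, 0)
        (fun a => (a, 0)) Prod.fst :=
      SetDiffeoAt.of_contMDiffOn (contMDiff_id.prodMk contMDiff_const).contMDiffOn
        contMDiff_fst.contMDiffOn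
        (fun x hx => ⟨(G.mem_e_iff 0).2 hx, rfl⟩)
        (fun y hy => ⟨(G.mem_e_iff y.2).1 hy, Prod.ext rfl (Subsingleton.elim _ _)⟩) ha
    exact h2.hasDimAt h1
  · obtain ⟨σ, hσ⟩ := hsL (G.s x)
    refine ⟨fun a => G.s (σ a), ?_, ?_, ?_⟩
    · rw [← eL_s]
      exact (hs.smoothGerm univ _).comp_univ hσ.smooth (G.eL_mem _) rfl
    · have := hσ.map
      rw [eL_s] at this
      rw [this, G.involutive]
    · rw [← eL_s]
      filter_upwards [hσ.right] with b hb
      exact ⟨mem_univ _, by rw [G.eR_s]; exact hb.2⟩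

/-- A differential subgroupoid: dimension and sections of the left identity map. -/
theorem IsDifferentialSubgroupoid.exists_dim_and_section {K : Set Γ}
    (hK : G.IsDifferentialSubgroupoid I K) (hwide : G.IsHorizontal K) :
    ∃ κ, (∀ x ∈ K, HasDimAt I κ K x) ∧
      ∀ x ∈ K, ∃ σ, IsSectionAt I I G.eL K G.units x σ := by
  obtain ⟨-, A, Gt, hind, hGt⟩ := hK
  let _ := A.chartedSpace
  have := A.isManifold
  -- The subgroupoid is a differential groupoid in its own right, so its left identity map has
  -- sections for the intrinsic structure; these are then transported to `Γ` through the inclusion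
  -- and `toSubtype`.
  obtain ⟨k, hk⟩ := hGt.exists_smoothMaps
  refine ⟨A.dim, fun x hx => A.hasDimAt hx, fun x hx => ?_⟩
  have hsub : G.units ⊆ K := inter_eq_left.1 hwide
  have hu : ∀ a : K, a ∈ Gt.units ↔ (a : Γ) ∈ G.units := fun a => by
    rw [← Gt.mem_e_iff 0, ← G.mem_e_iff 0, hind.e_iff]
  have heL : ∀ y : K, (Gt.eL y : Γ) = G.eL y := fun y =>
    G.eL_unique ((hu _).1 (Gt.eL_mem y)) ((hind.m_iff _ _ _).1 (Gt.eL_mul y))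
  obtain ⟨σ, hσ⟩ := hk.section_eL ⟨x, hx⟩
  have hsm : SmoothGerm I (𝓡 A.dim) (toSubtype K ⟨x, hx⟩) G.units (G.eL x) :=
    ((A.contMDiffOn_toSubtype ⟨x, hx⟩).smoothGerm _).mono hsub
  have hpt : toSubtype K ⟨x, hx⟩ (G.eL x) = Gt.eL ⟨x, hx⟩ := by
    rw [toSubtype_of_mem _ (hsub (G.eL_mem x))]
    exact Subtype.ext (heL ⟨x, hx⟩).symm
  have hto : ∀ᶠ a in 𝓝[G.units] (G.eL x), toSubtype K ⟨x, hx⟩ a ∈ Gt.units := by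
    filter_upwards [self_mem_nhdsWithin] with a ha
    rw [toSubtype_of_mem _ (hsub ha), hu]
    exact ha
  have ht : Filter.Tendsto (toSubtype K ⟨x, hx⟩) (𝓝[G.units] (G.eL x))
      (𝓝[Gt.units] (Gt.eL ⟨x, hx⟩)) := by
    have := hsm.tendsto (G.eL_mem x) hto
    rwa [hpt] at this
  refine ⟨fun a => σ (toSubtype K ⟨x, hx⟩ a), ?_, ?_, ?_⟩
  · have h1 : SmoothGerm (𝓡 A.dim) I (fun a => (σ a : Γ)) Gt.units (Gt.eL ⟨x, hx⟩) :=
      (A.isSmoothEmbedding.contMDiff.smoothGerm univ _).comp_univ hσ.smooth (Gt.eL_mem _) rfl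
    exact h1.comp_of_eq hsm (G.eL_mem x) hpt hto
  · simp only [hpt, hσ.map]
  · filter_upwards [ht.eventually hσ.right, self_mem_nhdsWithin] with a ha ha'
    refine ⟨Subtype.coe_prop _, ?_⟩
    rw [← heL, ha.2, toSubtype_of_mem _ (hsub ha')]

end Smooth

end RelGroupoid

/-! ### The relation `R` -/

namespace RelGroupoid

section Coset

variable {E H Γ E' H' M : Type*} [NormedAddCommGroup E] [NormedSpace ℝ E] [TopologicalSpace H]
  {I : ModelWithCorners ℝ E H} [TopologicalSpace Γ] [ChartedSpace H Γ] {G : RelGroupoid Γ}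
  [NormedAddCommGroup E'] [NormedSpace ℝ E'] [TopologicalSpace H']
  {J : ModelWithCorners ℝ E' H'} [TopologicalSpace M] [ChartedSpace H' M] {k κ n : ℕ}

theorem SmoothMaps.pmul_germ (hG : SmoothMaps I G k) {f g : M → Γ} {S : Set M} {p : M}
    (hf : SmoothGerm J I f S p) (hg : SmoothGerm J I g S p) (hp : p ∈ S)
    (hc : ∀ᶠ x in 𝓝[S] p, G.eR (f x) = G.eL (g x)) :
    SmoothGerm J I (fun x => G.pmul (f x, g x)) S p :=
  (hG.smooth_pmul.smoothGerm (f p, g p)).comp (f := fun x => (f x, g x)) (hf.prodMk hg) hp hc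

theorem SmoothMaps.s_germ (hG : SmoothMaps I G k) {f : M → Γ} {S : Set M} {p : M}
    (hf : SmoothGerm J I f S p) (hp : p ∈ S) : SmoothGerm J I (fun x => G.s (f x)) S p :=
  (hG.smooth_s.smoothGerm univ _).comp_univ hf hp rfl

theorem SmoothMaps.eL_germ (hG : SmoothMaps I G k) {f : M → Γ} {S : Set M} {p : M}
    (hf : SmoothGerm J I f S p) (hp : p ∈ S) : SmoothGerm J I (fun x => G.eL (f x)) S p :=
  (hG.smooth_eL.smoothGerm univ _).comp_univ hf hp rfl

theorem SmoothMaps.eR_germ (hG : SmoothMaps I G k) {f : M → Γ} {S : Set M} {p : M}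
    (hf : SmoothGerm J I f S p) (hp : p ∈ S) : SmoothGerm J I (fun x => G.eR (f x)) S p :=
  (hG.smooth_eR.smoothGerm univ _).comp_univ hf hp rfl

theorem mem_cosetRel_iff {K : Set Γ} {x y : Γ} :
    (x, y) ∈ G.cosetRel K ↔ G.eL x = G.eL y ∧ G.pmul (G.s x, y) ∈ K := by
  constructor
  · rintro ⟨z, hz, h⟩
    have h1 := G.eR_eq_eL h
    simp only [G.eR_s] at h1
    exact ⟨h1, by rw [pmul_eq h]; exact hz⟩
  · rintro ⟨h1, h2⟩
    exact ⟨_, h2, pmul_mem (by rw [G.eR_s, h1])⟩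

theorem pmul_mem_cosetRel {K : Set Γ} {x z : Γ} (hz : z ∈ K) (h : G.eR x = G.eL z) :
    (x, G.pmul (x, z)) ∈ G.cosetRel K := by
  rw [mem_cosetRel_iff, eL_pmul h, pmul_s_pmul h]
  exact ⟨rfl, hz⟩

/-- The data of a differential subgroupoid of dimension `κ` in terms of smooth maps. -/
structure SmoothSub (I : ModelWithCorners ℝ E H) (G : RelGroupoid Γ) (K : Set Γ) (κ : ℕ) :
    Prop where
  dim : ∀ x ∈ K, HasDimAt I κ K x
  section_eL : ∀ x ∈ K, ∃ σ, IsSectionAt I I G.eL K G.units x σ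

variable [I.Boundaryless] [IsManifold I ∞ Γ] [FiniteDimensional ℝ E]

/-- The map `(x, y) ↦ (s(x)y, x)`, with inverse `(z, x) ↦ (x, xz)`, identifies `R` with the fiber
product of `e_L` on `K` and `e_R` on `Γ`. -/
theorem hasDimAt_cosetRel (hn : Module.finrank ℝ E = n) (hG : SmoothMaps I G k) {K : Set Γ}
    (hK : SmoothSub I G K κ) {x y : Γ} (h : (x, y) ∈ G.cosetRel K) :
    HasDimAt (I.prod I) (n + (κ - k)) (G.cosetRel K) (x, y) := by
  obtain ⟨h1, h2⟩ := mem_cosetRel_iff.1 h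
  have hc : G.eR (G.s x) = G.eL y := by rw [G.eR_s, h1]
  obtain ⟨σ, hσ⟩ := hK.section_eL _ h2
  have heq : G.eL (G.pmul (G.s x, y)) = G.eR x := by rw [eL_pmul hc, eL_s]
  have hZ := hasDimAt_fiberProduct (F₂ := G.eR) (hK.dim _ h2) (hasDimAt_univ hn x)
    (hG.units_dim _ (G.eL_mem _)) (hG.smooth_eL.smoothGerm _ _)
    (Filter.Eventually.of_forall fun z => G.eL_mem z) (hG.smooth_eR.smoothGerm _ _)
    (Filter.Eventually.of_forall fun z => G.eR_mem z) hσ heq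
  refine SetDiffeoAt.hasDimAt (SetDiffeoAt.of_contMDiffOn
    (f := fun p : Γ × Γ => (G.pmul (G.s p.1, p.2), p.1))
    (g := fun p : Γ × Γ => (p.2, G.pmul (p.2, p.1))) ?_ ?_ ?_ ?_ h) hZ
  · refine contMDiffOn_of_smoothGerm fun p hp => SmoothGerm.prodMk ?_ smoothGerm_fst
    refine hG.pmul_germ (hG.s_germ smoothGerm_fst hp) smoothGerm_snd hp ?_
    filter_upwards [self_mem_nhdsWithin] with q hq
    rw [G.eR_s, (mem_cosetRel_iff.1 hq).1]
  · refine contMDiffOn_of_smoothGerm fun p hp => SmoothGerm.prodMk smoothGerm_snd ?_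
    refine hG.pmul_germ smoothGerm_snd smoothGerm_fst hp ?_
    filter_upwards [self_mem_nhdsWithin] with q hq
    exact hq.2.2.symm
  · rintro ⟨a, b⟩ hab
    obtain ⟨e1, e2⟩ := mem_cosetRel_iff.1 hab
    have e3 : G.eR (G.s a) = G.eL b := by rw [G.eR_s, e1]
    refine ⟨⟨e2, mem_univ _, ?_⟩, Prod.ext rfl ?_⟩
    · simp only [eL_pmul e3, eL_s]
    · exact pmul_pmul_s e1
  · rintro ⟨a, b⟩ ⟨e1, -, e3⟩
    exact ⟨pmul_mem_cosetRel e1 e3.symm, Prod.ext (pmul_s_pmul e3.symm) rfl⟩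

/-- Smooth local sections of the first projection `R → Γ`. -/
theorem exists_section_cosetRel (hG : SmoothMaps I G k) {K : Set Γ} (hK : SmoothSub I G K κ)
    {x y : Γ} (h : (x, y) ∈ G.cosetRel K) :
    ∃ τ : Γ → Γ, SmoothGerm I I τ univ x ∧ τ x = y ∧ ∀ᶠ z in 𝓝 x, (z, τ z) ∈ G.cosetRel K := by
  obtain ⟨h1, h2⟩ := mem_cosetRel_iff.1 h
  have hc : G.eR (G.s x) = G.eL y := by rw [G.eR_s, h1]
  obtain ⟨σ, hσ⟩ := hK.section_eL _ h2
  have heq : G.eL (G.pmul (G.s x, y)) = G.eR x := by rw [eL_pmul hc, eL_s]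
  have hs := hσ.smooth
  have hm := hσ.map
  have hr := hσ.right
  rw [heq] at hs hm hr
  have hRg : SmoothGerm I I G.eR univ x := hG.smooth_eR.smoothGerm _ _
  have hRu : ∀ᶠ z in 𝓝[univ] x, G.eR z ∈ G.units :=
    Filter.Eventually.of_forall fun z => G.eR_mem z
  have hev : ∀ᶠ z in 𝓝[univ] x, σ (G.eR z) ∈ K ∧ G.eL (σ (G.eR z)) = G.eR z :=
    (hRg.tendsto (mem_univ x) hRu).eventually hr
  -- Multiply on the right by the section of `e_L` on `K` through `s(x)y`: each `z` stays in its
  -- class, and `x` goes to `x(s(x)y) = y`.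
  refine ⟨fun z => G.pmul (z, σ (G.eR z)), ?_, ?_, ?_⟩
  · refine hG.pmul_germ (SmoothGerm.id _ _) (hs.comp hRg (mem_univ x) hRu) (mem_univ x) ?_
    filter_upwards [hev] with z hz using hz.2.symm
  · simp only [hm]
    exact pmul_pmul_s h1
  · rw [← nhdsWithin_univ]
    filter_upwards [hev] with z hz using pmul_mem_cosetRel hz.1 hz.2.symm

/-- The diagonal gives nonemptiness and surjectivity, and the sections just constructed give the
submersion. -/
theorem cosetRel_submanifold_submersion [Nonempty Γ] (hG : SmoothMaps I G k)
    (K : G.HorizontalSubgroupoid) (hK : SmoothSub I G K.carrier κ) :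
    IsSubmanifold (I.prod I) (G.cosetRel K.carrier) ∧
      ∃ A : SubmanifoldStructure (I.prod I) (G.cosetRel K.carrier),
        letI := A.chartedSpace
        Surjective (fun p : G.cosetRel K.carrier => p.1.1) ∧
        IsSubmersion (𝓡 A.dim) I ∞ (fun p : G.cosetRel K.carrier => p.1.1) := by
  have hrefl : ∀ x, (x, x) ∈ G.cosetRel K.carrier := fun x => K.setoid.refl x
  obtain ⟨x₀⟩ := ‹Nonempty Γ›
  obtain ⟨A⟩ := nonempty_submanifoldStructure (I := I.prod I) (S := G.cosetRel K.carrier)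
    fun p hp => hasDimAt_cosetRel rfl hG hK hp
  refine ⟨⟨⟨_, hrefl x₀⟩, ⟨A⟩⟩, A, fun x => ⟨⟨_, hrefl x⟩, rfl⟩, ?_⟩
  refine A.isSubmersion (F' := Prod.fst) contMDiffOn_fst (fun _ => rfl) ?_
  rintro ⟨⟨x, y⟩, h⟩
  obtain ⟨τ, h1, h2, h3⟩ := exists_section_cosetRel hG hK h
  exact ⟨fun z => (z, τ z), (SmoothGerm.id _ _).prodMk h1, Prod.ext rfl h2,
    h3.mono fun z hz => ⟨hz, rfl⟩⟩

end Coset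

end RelGroupoid

/-! ### Quotient manifolds -/

section Quotients

variable {E H M Y : Type*}
  [NormedAddCommGroup E] [NormedSpace ℝ E] [TopologicalSpace H] {I : ModelWithCorners ℝ E H}
  [TopologicalSpace M] [ChartedSpace H M] [TopologicalSpace Y]

variable (I) in
/-- A local slice through `x₀` for the fibers of `π`, parametrized by `ι`, with the projection
`ρ` onto it. -/
structure IsSliceAt (π : M → Y) (d : ℕ) (x₀ : M) (ρ : M → EuclideanSpace ℝ (Fin d))
    (ι : EuclideanSpace ℝ (Fin d) → M) : Prop where
  smooth_proj : SmoothGerm I (𝓡 d) ρ univ x₀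
  smooth_param : SmoothGerm (𝓡 d) I ι univ (ρ x₀)
  map : ι (ρ x₀) = x₀
  proj_param : ∀ᶠ w in 𝓝 (ρ x₀), ρ (ι w) = w
  param_proj : ∀ᶠ x in 𝓝 x₀, π (ι (ρ x)) = π x
  injective : ∀ᶠ w in 𝓝 (ρ x₀, ρ x₀), π (ι w.1) = π (ι w.2) → w.1 = w.2

/-- Smooth local maps along the fibers of `π` connect any two points of a fiber. -/
def FiberTransitive (I : ModelWithCorners ℝ E H) (π : M → Y) : Prop :=
  ∀ x y, π x = π y → ∃ τ : M → M, SmoothGerm I I τ univ x ∧ τ x = y ∧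
    ∀ᶠ z in 𝓝 x, π (τ z) = π z

/-- If `x` is equivalent to `y ∈ U`, the local map that carries `x` to `y` along the fibers carries
the points near `x` into `U`; so the saturation of an open set is open. -/
theorem FiberTransitive.isOpenQuotientMap {π : M → Y} (h : FiberTransitive I π)
    (hπ : Topology.IsQuotientMap π) : IsOpenQuotientMap π := by
  refine ⟨hπ.surjective, hπ.continuous, fun U hU => ?_⟩
  rw [← hπ.isOpen_preimage, isOpen_iff_mem_nhds]
  rintro x ⟨y, hy, hxy⟩
  obtain ⟨τ, h1, h2, h3⟩ := h x y hxy.symm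
  have h4 : ∀ᶠ z in 𝓝 x, τ z ∈ U :=
    h1.contMDiffAt.continuousAt.eventually_mem (by rw [h2]; exact hU.mem_nhds hy)
  filter_upwards [h3, h4] with z e1 e2
  exact ⟨τ z, e2, e1⟩

/-- The chart of the quotient defined by a slice. -/
theorem IsSliceAt.exists_chart {π : M → Y} {d : ℕ} {x₀ : M} {ρ : M → EuclideanSpace ℝ (Fin d)}
    {ι : EuclideanSpace ℝ (Fin d) → M} (h : IsSliceAt I π d x₀ ρ ι) (hπ : IsOpenQuotientMap π) :
    ∃ (φ : OpenPartialHomeomorph Y (EuclideanSpace ℝ (Fin d))) (U : Set M), x₀ ∈ U ∧ IsOpen U ∧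
      φ.source = π '' U ∧ (∀ x ∈ U, φ (π x) = ρ x) ∧ (∀ w, φ.symm w = π (ι w)) ∧
      ContMDiffOn I (𝓡 d) ∞ ρ U ∧ ContMDiffOn (𝓡 d) I ∞ ι φ.target := by
  have h1 := h.smooth_proj
  have h2 := h.smooth_param
  rw [SmoothGerm, nhdsWithin_univ] at h1 h2
  obtain ⟨V, hV, hVo, hxV⟩ := eventually_nhds_iff.1 (h1.and h.param_proj)
  obtain ⟨O₁, hO₁, hO₁o, hxO₁⟩ := eventually_nhds_iff.1 (h2.and h.proj_param)
  have h3 := h.injective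
  rw [nhds_prod_eq, Filter.eventually_prod_self_iff'] at h3
  obtain ⟨O₂, hO₂n, hO₂⟩ := h3
  obtain ⟨O₃, hO₃s, hO₃o, hxO₃⟩ := mem_nhds_iff.1 hO₂n
  set O := O₁ ∩ O₃
  have hOo : IsOpen O := hO₁o.inter hO₃o
  have hιO : ContMDiffOn (𝓡 d) I ∞ ι O := fun w hw => (hO₁ w hw.1).1.mono (subset_univ _)
  have hρV : ContMDiffOn I (𝓡 d) ∞ ρ V := fun x hx => (hV x hx).1.mono (subset_univ _)
  set B := O ∩ ι ⁻¹' V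
  have hBo : IsOpen B := hιO.continuousOn.isOpen_inter_preimage hOo hVo
  -- `B` and `U` are matched so that `ρ` maps `U` to `B` and `ι` maps `B` to `U`.
  set U := V ∩ ρ ⁻¹' B
  have hUo : IsOpen U := hρV.continuousOn.isOpen_inter_preimage hVo hBo
  have hxU : x₀ ∈ U := ⟨hxV, ⟨hxO₁, hxO₃⟩, by change ι (ρ x₀) ∈ V; rw [h.map]; exact hxV⟩
  have hρι : ∀ w ∈ B, ρ (ι w) = w := fun w hw => (hO₁ w hw.1.1).2
  have hιU : ∀ w ∈ B, ι w ∈ U := fun w hw =>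
    ⟨hw.2, by change ρ (ι w) ∈ B; rw [hρι w hw]; exact hw⟩
  have hπι : ∀ x ∈ U, π (ι (ρ x)) = π x := fun x hx => (hV x hx.1).2
  have hinj : ∀ x ∈ U, ∀ y ∈ U, π x = π y → ρ x = ρ y := by
    intro x hx y hy hxy
    refine hO₂ _ (hO₃s hx.2.1.2) _ (hO₃s hy.2.1.2) ?_
    rw [hπι x hx, hπι y hy, hxy]
  have : Nonempty M := ⟨x₀⟩
  -- `ρ` of an arbitrary representative in `U`; by `hinj` the choice does not matter.
  let c : Y → EuclideanSpace ℝ (Fin d) := fun y => ρ (invFunOn π U y)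
  have hc : ∀ x ∈ U, c (π x) = ρ x := fun x hx =>
    hinj _ (invFunOn_mem ⟨x, hx, rfl⟩) x hx (invFunOn_eq ⟨x, hx, rfl⟩)
  let φ : OpenPartialHomeomorph Y (EuclideanSpace ℝ (Fin d)) :=
    { toFun := c
      invFun := fun w => π (ι w)
      source := π '' U
      target := B
      map_source' := by
        rintro _ ⟨x, hx, rfl⟩
        rw [hc x hx]
        exact hx.2
      map_target' := fun w hw => ⟨ι w, hιU w hw, rfl⟩
      left_inv' := by
        rintro _ ⟨x, hx, rfl⟩
        rw [hc x hx, hπι x hx]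
      right_inv' := fun w hw => by rw [hc _ (hιU w hw), hρι w hw]
      open_source := hπ.isOpenMap U hUo
      open_target := hBo
      continuousOn_toFun := by
        rintro _ ⟨x, hx, rfl⟩
        refine ContinuousAt.continuousWithinAt (hπ.continuousAt_comp_iff.1 ?_)
        have hρx : ContinuousAt ρ x := hρV.continuousOn.continuousAt (hVo.mem_nhds hx.1)
        refine hρx.congr ?_
        filter_upwards [hUo.mem_nhds hx] with z hz using (hc z hz).symm
      continuousOn_invFun := hπ.continuous.comp_continuousOn
        (hιO.continuousOn.mono inter_subset_left) }
  exact ⟨φ, U, hxU, hUo, rfl, hc, fun w => rfl, hρV.mono inter_subset_left,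
    hιO.mono inter_subset_left⟩

/-- The quotient of a manifold by an equivalence relation with local slices whose classes are
connected by smooth local maps is a manifold. -/
theorem exists_quotient_manifold {π : M → Y} {d : ℕ} (hq : Topology.IsQuotientMap π)
    (hslice : ∀ x₀, ∃ ρ ι, IsSliceAt I π d x₀ ρ ι) (hfib : FiberTransitive I π) :
    ∃ _ : ChartedSpace (EuclideanSpace ℝ (Fin d)) Y, IsManifold (𝓡 d) ∞ Y ∧
      ContMDiff I (𝓡 d) ∞ π ∧ ∀ x, ∃ σ : Y → M, IsSectionAt I (𝓡 d) π univ univ x σ := by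
  have hπ := hfib.isOpenQuotientMap hq
  choose ρ ι hs using hslice
  choose φ U hxU hUo hsrc hφ hφs hρ hι using fun x₀ => (hs x₀).exists_chart hπ
  have hmem : ∀ x₀, π x₀ ∈ (φ x₀).source := fun x₀ => by
    rw [hsrc]
    exact ⟨x₀, hxU x₀, rfl⟩
  -- Only the class of `x` meets `U x₀`, not necessarily `x`. A fiberwise map brings the points near
  -- `x` into `U x₀`, where the chart is given by the smooth `ρ x₀`.
  have hloc : ∀ x₀ x, π x ∈ (φ x₀).source → ∃ τ : M → M, SmoothGerm I I τ univ x ∧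
      τ x ∈ U x₀ ∧ ∀ᶠ z in 𝓝 x, φ x₀ (π z) = ρ x₀ (τ z) := by
    intro x₀ x hx
    rw [hsrc] at hx
    obtain ⟨y, hy, hyx⟩ := hx
    obtain ⟨τ, h1, h2, h3⟩ := hfib x y hyx.symm
    refine ⟨τ, h1, by rw [h2]; exact hy, ?_⟩
    have h4 : ∀ᶠ z in 𝓝 x, τ z ∈ U x₀ :=
      h1.contMDiffAt.continuousAt.eventually_mem (by rw [h2]; exact (hUo x₀).mem_nhds hy)
    filter_upwards [h3, h4] with z e1 e2
    rw [← e1, hφ x₀ _ e2]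
  have hsmooth : ∀ x₀ x, π x ∈ (φ x₀).source →
      ContMDiffAt I (𝓡 d) ∞ (fun z => φ x₀ (π z)) x := by
    intro x₀ x hx
    obtain ⟨τ, h1, h2, h3⟩ := hloc x₀ x hx
    have h4 : ContMDiffAt I (𝓡 d) ∞ (ρ x₀) (τ x) :=
      (hρ x₀).contMDiffAt ((hUo x₀).mem_nhds h2)
    exact (h4.comp x h1.contMDiffAt).congr_of_eventuallyEq h3
  let cs : ChartedSpace (EuclideanSpace ℝ (Fin d)) Y :=
    { atlas := range φ
      chartAt := fun y => φ (surjInv hπ.surjective y)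
      mem_chart_source := fun y => by
        have := hmem (surjInv hπ.surjective y)
        rwa [surjInv_eq hπ.surjective] at this
      chart_mem_atlas := fun y => mem_range_self _ }
  have hM : IsManifold (𝓡 d) ∞ Y := by
    refine isManifold_of_contDiffOn (𝓡 d) ∞ Y ?_
    rintro _ _ ⟨p, rfl⟩ ⟨p', rfl⟩ w hw
    have hw1 : w ∈ (φ p).target ∧ (φ p).symm w ∈ (φ p').source := by simpa using hw
    rw [hφs] at hw1
    have h1 : ContMDiffAt (𝓡 d) I ∞ (ι p) w :=
      (hι p).contMDiffAt ((φ p).open_target.mem_nhds hw1.1)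
    have h2 := (hsmooth p' _ hw1.2).comp w h1
    have h3 : ContDiffAt ℝ ∞ (fun v => φ p' (π (ι p v))) w := h2.contDiffAt
    refine h3.contDiffWithinAt.congr (fun v hv => ?_) ?_
    · simp [hφs]
    · simp [hφs]
  refine ⟨cs, hM, fun x => ?_, fun x => ?_⟩
  · refine contMDiffAt_iff_target.2 ⟨hπ.continuous.continuousAt, ?_⟩
    refine hsmooth (surjInv hπ.surjective (π x)) x ?_
    have := hmem (surjInv hπ.surjective (π x))
    rwa [surjInv_eq hπ.surjective] at this
  · have hat : φ x ∈ IsManifold.maximalAtlas (𝓡 d) ∞ Y :=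
      IsManifold.subset_maximalAtlas (mem_range_self x)
    have h1 : ContMDiffOn (𝓡 d) (𝓡 d) ∞ (φ x) (φ x).source :=
      contMDiffOn_of_mem_maximalAtlas hat
    refine ⟨fun y => ι x (φ x y), ?_, ?_, ?_⟩
    · exact SmoothGerm.of_contMDiffOn_open (φ x).open_source
        ((hι x).comp h1 fun y hy => (φ x).map_source hy) (hmem x)
    · simp only [hφ x x (hxU x), (hs x).map]
    · rw [nhdsWithin_univ]
      filter_upwards [(φ x).open_source.mem_nhds (hmem x)] with y hy
      exact ⟨mem_univ _, by rw [← hφs x, (φ x).left_inv hy]⟩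

end Quotients

/-! ### Local slices for the cosets of a horizontal subgroupoid -/

namespace RelGroupoid

section Slices

variable {E H Γ : Type*} [NormedAddCommGroup E] [NormedSpace ℝ E] [TopologicalSpace H]
  {I : ModelWithCorners ℝ E H} [TopologicalSpace Γ] [ChartedSpace H Γ] {G : RelGroupoid Γ}
  {k κ n : ℕ}

theorem HorizontalSubgroupoid.units_subset (K : G.HorizontalSubgroupoid) :
    G.units ⊆ K.carrier := inter_eq_left.1 K.isHorizontal

theorem HorizontalSubgroupoid.proj_eq_iff (K : G.HorizontalSubgroupoid) {x y : Γ} :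
    K.proj x = K.proj y ↔ (x, y) ∈ G.cosetRel K.carrier :=
  Quotient.eq (r := K.setoid)

/-- The map `(x, y) ↦ s(x)y` is smooth on the relation `R`. -/
theorem SmoothMaps.contMDiffOn_div (hG : SmoothMaps I G k) (K : Set Γ) :
    ContMDiffOn (I.prod I) I ∞ (fun p : Γ × Γ => G.pmul (G.s p.1, p.2)) (G.cosetRel K) := by
  refine contMDiffOn_of_smoothGerm fun p hp => ?_
  refine hG.pmul_germ (hG.s_germ smoothGerm_fst hp) smoothGerm_snd hp ?_
  filter_upwards [self_mem_nhdsWithin] with q hq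
  rw [G.eR_s, (mem_cosetRel_iff.1 hq).1]

/-- The multiplication by elements of the subgroupoid near the identity `e_R(x₀)`,
in a trivialization of its left identity map. -/
theorem exists_trivialization_at_unit (hG : SmoothMaps I G k)
    (K : G.HorizontalSubgroupoid) (hK : SmoothSub I G K.carrier κ) {a : Γ} (ha : a ∈ G.units) :
    ∃ (T : Γ → EuclideanSpace ℝ (Fin (κ - k))) (m : Γ × EuclideanSpace ℝ (Fin (κ - k)) → Γ),
      SetDiffeoAt I (I.prod (𝓡 (κ - k))) K.carrier a (G.units ×ˢ univ) (a, 0)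
        (fun x => (G.eL x, T x)) m ∧ ∀ᶠ b in 𝓝[G.units] a, m (b, 0) = b := by
  have haL : G.eL a = a := eL_of_mem_units ha
  -- The inclusion of the identities is itself a section of `e_L`; using it makes them the zero
  -- section.
  have hid : IsSectionAt I I G.eL K.carrier G.units a (fun b => b) :=
    { smooth := SmoothGerm.id _ _
      map := haL
      right := Filter.eventually_of_mem self_mem_nhdsWithin fun b hb =>
        ⟨K.units_subset hb, eL_of_mem_units hb⟩ }
  obtain ⟨-, T, m, hT, hT0⟩ := hid.exists_trivialization (hK.dim a (K.units_subset ha))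
    (haL.symm ▸ hG.units_dim a ha) (hG.smooth_eL.smoothGerm _ _)
    (Filter.Eventually.of_forall fun z => G.eL_mem z)
  rw [haL] at hT hT0
  refine ⟨T, m, hT, ?_⟩
  filter_upwards [hT0, hT.left.filter_mono (nhdsWithin_mono a K.units_subset),
    self_mem_nhdsWithin] with b h1 h2 h3
  have := h2.2
  rwa [eL_of_mem_units h3, h1] at this

variable [I.Boundaryless] [IsManifold I ∞ Γ] [FiniteDimensional ℝ E]

set_option maxHeartbeats 2000000 in
/-- Through every point there is a slice for the projection onto the space of cosets. -/
theorem exists_isSliceAt (hn : Module.finrank ℝ E = n) (hG : SmoothMaps I G k)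
    (K : G.HorizontalSubgroupoid) (hK : SmoothSub I G K.carrier κ) (x₀ : Γ) :
    ∃ ρ ι, IsSliceAt I K.proj (n - (κ - k)) x₀ ρ ι := by
  set a₀ := G.eR x₀ with ha₀
  set c := κ - k
  have hu₀ : a₀ ∈ G.units := G.eR_mem x₀
  obtain ⟨T, m, hT, hm0⟩ := exists_trivialization_at_unit hG K hK hu₀
  have hTa : T a₀ = 0 := congrArg Prod.snd hT.map
  have hRc : Filter.Tendsto G.eR (𝓝 x₀) (𝓝[G.units] a₀) :=
    tendsto_nhdsWithin_iff.2 ⟨hG.smooth_eR.continuous.continuousAt,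
      Filter.Eventually.of_forall fun z => G.eR_mem z⟩
  -- the multiplication map near `(x₀, 0)`
  have hb : SmoothGerm (I.prod (𝓡 c)) (I.prod (𝓡 c))
      (fun q : Γ × EuclideanSpace ℝ (Fin c) => (G.eR q.1, q.2)) univ (x₀, 0) :=
    SmoothGerm.prodMk (hG.eR_germ smoothGerm_fst (mem_univ _)) smoothGerm_snd
  have hbu : ∀ᶠ q in 𝓝[univ] (x₀, (0 : EuclideanSpace ℝ (Fin c))),
      (G.eR q.1, q.2) ∈ G.units ×ˢ (univ : Set (EuclideanSpace ℝ (Fin c))) :=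
    Filter.Eventually.of_forall fun q => ⟨G.eR_mem _, mem_univ _⟩
  have hms : SmoothGerm (I.prod (𝓡 c)) I
      (fun q : Γ × EuclideanSpace ℝ (Fin c) => m (G.eR q.1, q.2)) univ (x₀, 0) :=
    hT.smooth_inv.comp_of_eq hb (mem_univ _) rfl hbu
  have hmev : ∀ᶠ q in 𝓝 (x₀, (0 : EuclideanSpace ℝ (Fin c))), m (G.eR q.1, q.2) ∈ K.carrier ∧
      G.eL (m (G.eR q.1, q.2)) = G.eR q.1 ∧ T (m (G.eR q.1, q.2)) = q.2 := by
    rw [← nhdsWithin_univ]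
    filter_upwards [(hb.tendsto (mem_univ _) hbu).eventually hT.right] with q hq
    exact ⟨hq.1, congrArg Prod.fst hq.2, congrArg Prod.snd hq.2⟩
  -- For fixed `y` near `x₀` and small `t`, `Ψ₀ (y, t)` moves within the class of `y`, starting from
  -- `y` at `t = 0`.
  let Ψ₀ : Γ × EuclideanSpace ℝ (Fin c) → Γ := fun q => G.pmul (q.1, m (G.eR q.1, q.2))
  have hΨ₀ : SmoothGerm (I.prod (𝓡 c)) I Ψ₀ univ (x₀, 0) := by
    refine hG.pmul_germ smoothGerm_fst hms (mem_univ _) ?_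
    rw [nhdsWithin_univ]
    filter_upwards [hmev] with q hq using hq.2.1.symm
  have hΨ₀z : ∀ᶠ y in 𝓝 x₀, Ψ₀ (y, 0) = y := by
    filter_upwards [hRc.eventually hm0] with y hy
    simp only [Ψ₀, hy, pmul_eR]
  have hΨ₀x : Ψ₀ (x₀, 0) = x₀ := hΨ₀z.self_of_nhds
  -- the multiplication map in a chart
  have hφ := setDiffeoAt_extChartAt (I := I) x₀
  set φ := extChartAt I x₀
  set u₀ := φ x₀
  have hφl := hφ.left
  have hφr := hφ.right
  rw [nhdsWithin_univ] at hφl hφr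
  have tφ : Filter.Tendsto φ (𝓝 x₀) (𝓝 u₀) := by simpa only [nhdsWithin_univ] using hφ.tendsto
  have tφs : Filter.Tendsto φ.symm (𝓝 u₀) (𝓝 x₀) := by
    simpa only [nhdsWithin_univ] using hφ.symm.tendsto
  have tΨ₀ : Filter.Tendsto Ψ₀ (𝓝 (x₀, 0)) (𝓝 x₀) := by
    have := hΨ₀.contMDiffAt.continuousAt
    rwa [ContinuousAt, hΨ₀x] at this
  let Ψ₁ : E × EuclideanSpace ℝ (Fin c) → E := fun q => φ (Ψ₀ (φ.symm q.1, q.2))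
  have hΨ₁g : SmoothGerm 𝓘(ℝ, E × EuclideanSpace ℝ (Fin c)) 𝓘(ℝ, E) Ψ₁ univ (u₀, 0) := by
    have h1 : SmoothGerm 𝓘(ℝ, E × EuclideanSpace ℝ (Fin c)) (I.prod (𝓡 c))
        (fun q : E × EuclideanSpace ℝ (Fin c) => (φ.symm q.1, q.2)) univ (u₀, 0) :=
      (hφ.smooth_inv.comp_univ (contDiff_fst.contMDiff.smoothGerm _ _) (mem_univ _) rfl).prodMk
        (contDiff_snd.contMDiff.smoothGerm _ _)
    refine hφ.smooth.comp_univ (hΨ₀.comp_univ h1 (mem_univ _) (by rw [hφ.map_inv])) (mem_univ _) ?_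
    rw [hφ.map_inv, hΨ₀x]
  have hΨ₁ := hΨ₁g.eventually_contDiffAt
  have hD := (hΨ₁.self_of_nhds.differentiableAt (by simp)).hasFDerivAt
  set D := fderiv ℝ Ψ₁ (u₀, 0)
  have hΨ₁u : Ψ₁ (u₀, 0) = u₀ := by simp only [Ψ₁, hφ.map_inv, hΨ₀x]; rfl
  have hD1 : ∀ v, D (v, 0) = v := by
    have h1 : HasFDerivAt (fun v => Ψ₁ (v, 0)) (D.comp (ContinuousLinearMap.inl ℝ E _)) u₀ :=
      HasFDerivAt.comp (g := Ψ₁) (f := fun v => (v, (0 : EuclideanSpace ℝ (Fin c)))) u₀ hD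
        (hasFDerivAt_prodMk_left u₀ 0)
    have h2 : HasFDerivAt (fun v => Ψ₁ (v, 0)) (ContinuousLinearMap.id ℝ E) u₀ := by
      refine (hasFDerivAt_id u₀).congr_of_eventuallyEq ?_
      filter_upwards [tφs.eventually hΨ₀z, hφr] with v e1 e2
      simp only [Ψ₁, e1, e2.2, id]
    intro v
    exact congrArg (fun A : E →L[ℝ] E => A v) (h1.unique h2)
  have hD2 : HasFDerivAt (fun t => Ψ₁ (u₀, t)) (D.comp (ContinuousLinearMap.inr ℝ E _)) 0 :=
    HasFDerivAt.comp (g := Ψ₁) (f := fun t => (u₀, t)) (0 : EuclideanSpace ℝ (Fin c)) hD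
      (hasFDerivAt_prodMk_right u₀ 0)
  set j := D.comp (ContinuousLinearMap.inr ℝ E (EuclideanSpace ℝ (Fin c)))
  have tx : Filter.Tendsto (fun t => (x₀, t)) (𝓝 (0 : EuclideanSpace ℝ (Fin c)))
      (𝓝 (x₀, 0)) := (Continuous.prodMk_right x₀).tendsto 0
  -- On the class of `x₀`, division by `x₀` followed by `T` recovers `t` and is smooth within that
  -- class; hence the directions tangent to the class are independent.
  have hj : Injective j := by
    let S : Set E := {w | (x₀, φ.symm w) ∈ G.cosetRel K.carrier}
    have hxR : (x₀, x₀) ∈ G.cosetRel K.carrier := K.setoid.refl x₀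
    have huS : u₀ ∈ S := by
      change (x₀, φ.symm u₀) ∈ G.cosetRel K.carrier
      rw [hφ.map_inv]; exact hxR
    have hq : SmoothGerm 𝓘(ℝ, E) (𝓡 c) (fun w => T (G.pmul (G.s x₀, φ.symm w))) S u₀ := by
      have h1 : SmoothGerm 𝓘(ℝ, E) I (fun w => G.pmul (G.s x₀, φ.symm w)) S u₀ := by
        refine hG.pmul_germ (SmoothGerm.const _ _ _) (hφ.smooth_inv.mono (subset_univ _)) huS ?_
        filter_upwards [self_mem_nhdsWithin] with w hw
        rw [G.eR_s, (mem_cosetRel_iff.1 hw).1]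
      have h2 : SmoothGerm I (𝓡 c) T K.carrier a₀ := hT.smooth.snd
      refine h2.comp_of_eq h1 huS ?_ ?_
      · rw [hφ.map_inv, pmul_s_self]
      · filter_upwards [self_mem_nhdsWithin] with w hw
        exact (mem_cosetRel_iff.1 hw).2
    rw [← hD2.fderiv]
    refine fderiv_injective_of_left_inverse (S := S)
      (q := fun w => T (G.pmul (G.s x₀, φ.symm w))) hD2.differentiableAt ?_ ?_
    · rw [hΨ₁u]
      exact (hq.contMDiffWithinAt huS).contDiffWithinAt.differentiableWithinAt (by simp)
    · filter_upwards [tx.eventually hmev, (tΨ₀.comp tx).eventually hφl] with t e1 e2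
      have e3 : φ.symm (Ψ₁ (u₀, t)) = Ψ₀ (x₀, t) := by
        simp only [Ψ₁, hφ.map_inv]
        exact e2.2
      constructor
      · change (x₀, φ.symm (Ψ₁ (u₀, t))) ∈ G.cosetRel K.carrier
        rw [e3]
        exact pmul_mem_cosetRel e1.1 e1.2.1.symm
      · rw [e3]
        simp only [Ψ₀, pmul_s_pmul e1.2.1.symm]
        exact e1.2.2
  have hcn : c ≤ n := by
    have := LinearMap.finrank_le_finrank_of_injective (f := j.toLinearMap) hj
    rwa [finrank_euclideanSpace_fin, hn] at this
  -- The second factor of `Λ` parametrizes a complement of the directions tangent to the class; the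
  -- slice will be the affine subspace `u₀ + Λ (0, w)` in the chart.
  obtain ⟨Λ, hΛ⟩ := exists_equiv_extending (F := EuclideanSpace ℝ (Fin (n - c))) j hj
    (by simp only [finrank_euclideanSpace_fin, hn]; omega)
  -- the multiplication map restricted to a slice is a local diffeomorphism
  let A : EuclideanSpace ℝ (Fin c) × EuclideanSpace ℝ (Fin (n - c)) →
      E × EuclideanSpace ℝ (Fin c) := fun q => (u₀ + Λ (0, q.2), q.1)
  have hA0 : A (0, 0) = (u₀, 0) := by
    simp [A, show ((0 : EuclideanSpace ℝ (Fin c)), (0 : EuclideanSpace ℝ (Fin (n - c)))) = 0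
      from rfl]
  have hAs : ContDiff ℝ ∞ A :=
    (contDiff_const.add (Λ.contDiff.comp (contDiff_const.prodMk contDiff_snd))).prodMk contDiff_fst
  have hΨ₂ : ∀ᶠ q in 𝓝 (0, 0), ContDiffAt ℝ ∞ (fun q => Ψ₁ (A q)) q := by
    have t := hAs.continuous.tendsto (0, 0)
    rw [hA0] at t
    filter_upwards [t.eventually hΨ₁] with q hq
    exact hq.comp q hAs.contDiffAt
  have hder : HasFDerivAt (fun q => Ψ₁ (A q))
      (Λ : EuclideanSpace ℝ (Fin c) × EuclideanSpace ℝ (Fin (n - c)) →L[ℝ] E) (0, 0) := by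
    let B : EuclideanSpace ℝ (Fin c) × EuclideanSpace ℝ (Fin (n - c)) →L[ℝ] E :=
      (Λ : EuclideanSpace ℝ (Fin c) × EuclideanSpace ℝ (Fin (n - c)) →L[ℝ] E).comp
        ((ContinuousLinearMap.inr ℝ _ _).comp (ContinuousLinearMap.snd ℝ _ _))
    have h1 : HasFDerivAt A (B.prod (ContinuousLinearMap.fst ℝ _ _)) (0, 0) :=
      HasFDerivAt.prodMk (B.hasFDerivAt.const_add u₀) hasFDerivAt_fst
    have h2 : HasFDerivAt Ψ₁ D (A (0, 0)) := by rw [hA0]; exact hD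
    refine (h2.comp (0, 0) h1).congr_fderiv ?_
    refine ContinuousLinearMap.ext fun q => ?_
    change D (Λ (0, q.2), q.1) = Λ q
    have e1 : D (Λ (0, q.2), q.1) = D (Λ (0, q.2), 0) + D (0, q.1) := by
      rw [← map_add]; simp
    have e2 : D (0, q.1) = Λ (q.1, 0) := (hΛ q.1).symm
    rw [e1, hD1, e2, ← map_add]
    simp
  obtain ⟨Φ, hΦ0, hΦ, hΦ1, hΦ2⟩ := exists_smooth_openPartialHomeomorph Λ hΨ₂ hder
  have hΦu : Φ (0, 0) = u₀ := by
    rw [hΦ]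
    change Ψ₁ (A (0, 0)) = u₀
    rw [hA0, hΨ₁u]
  have hΦd := OpenPartialHomeomorph.setDiffeoAt hΦ1 hΦ2 hΦ0
  rw [hΦu] at hΦd
  have tΦs : Filter.Tendsto Φ.symm (𝓝 u₀) (𝓝 (0, 0)) := by
    simpa only [nhdsWithin_univ] using hΦd.symm.tendsto
  let ι : EuclideanSpace ℝ (Fin (n - c)) → Γ := fun w => φ.symm (u₀ + Λ (0, w))
  let ρ : Γ → EuclideanSpace ℝ (Fin (n - c)) := fun x => (Φ.symm (φ x)).2
  have hΦι : ∀ t w, Φ (t, w) = φ (Ψ₀ (ι w, t)) := fun t w => by rw [hΦ]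
  have hι0 : ι 0 = x₀ := by
    have := congrArg Prod.fst hA0
    simp only [A] at this
    simp only [ι, this, hφ.map_inv]
  have hρ0 : ρ x₀ = 0 := congrArg Prod.snd hΦd.map_inv
  have hιs : SmoothGerm (𝓡 (n - c)) I ι univ 0 := by
    have h1 : ContDiff ℝ ∞ (fun w : EuclideanSpace ℝ (Fin (n - c)) => u₀ + Λ (0, w)) :=
      contDiff_const.add (Λ.contDiff.comp (contDiff_const.prodMk contDiff_id))
    refine hφ.smooth_inv.comp_univ (h1.contMDiff.smoothGerm _ _) (mem_univ _) ?_
    exact congrArg Prod.fst hA0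
  have tι : Filter.Tendsto ι (𝓝 0) (𝓝 x₀) := by
    have := hιs.contMDiffAt.continuousAt
    rwa [ContinuousAt, hι0] at this
  have hsrc0 : ∀ᶠ w in 𝓝 (0 : EuclideanSpace ℝ (Fin (n - c))),
      ((0 : EuclideanSpace ℝ (Fin c)), w) ∈ Φ.source :=
    ((Continuous.prodMk_right (0 : EuclideanSpace ℝ (Fin c))).tendsto
      (0 : EuclideanSpace ℝ (Fin (n - c)))).eventually (Φ.open_source.mem_nhds hΦ0)
  refine ⟨ρ, ι, ?_, ?_, ?_, ?_, ?_, ?_⟩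
  · have h1 : SmoothGerm I 𝓘(ℝ, EuclideanSpace ℝ (Fin c) × EuclideanSpace ℝ (Fin (n - c)))
        (fun x => Φ.symm (φ x)) univ x₀ := hΦd.smooth_inv.comp_univ hφ.smooth (mem_univ _) rfl
    exact ((contDiff_snd (𝕜 := ℝ) (n := ∞) (E := EuclideanSpace ℝ (Fin c))
      (F := EuclideanSpace ℝ (Fin (n - c)))).contMDiff.smoothGerm univ _).comp_univ h1
      (mem_univ _) rfl
  · rw [hρ0]; exact hιs
  · rw [hρ0]; exact hι0
  · rw [hρ0]
    filter_upwards [hsrc0, tι.eventually hΨ₀z] with w e1 e2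
    have e3 := hΦι 0 w
    rw [e2] at e3
    simp only [ρ, ← e3, Φ.left_inv e1]
  · have t1 : Filter.Tendsto (fun x => Φ.symm (φ x)) (𝓝 x₀) (𝓝 (0, 0)) := tΦs.comp tφ
    have t2 : Filter.Tendsto (fun x => (ι (Φ.symm (φ x)).2, (Φ.symm (φ x)).1)) (𝓝 x₀)
        (𝓝 (x₀, 0)) :=
      (tι.comp ((continuous_snd.tendsto _).comp t1)).prodMk_nhds ((continuous_fst.tendsto _).comp t1)
    have r1 := hΦd.right
    rw [nhdsWithin_univ] at r1
    filter_upwards [tφ.eventually r1, t2.eventually hmev, (tΨ₀.comp t2).eventually hφl, hφl]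
      with x e1 e2 e3 e4
    rw [K.proj_eq_iff]
    have e5 : φ (Ψ₀ (ι (Φ.symm (φ x)).2, (Φ.symm (φ x)).1)) = φ x := by
      rw [← hΦι]; exact e1.2
    have e6 : Ψ₀ (ι (Φ.symm (φ x)).2, (Φ.symm (φ x)).1) = x := by
      have := e3.2
      simp only [comp_apply, e5] at this
      rw [← this, e4.2]
    have e7 := pmul_mem_cosetRel e2.1 e2.2.1.symm
    change (ι (Φ.symm (φ x)).2, x) ∈ G.cosetRel K.carrier
    have e8 : (ι (Φ.symm (φ x)).2, Ψ₀ (ι (Φ.symm (φ x)).2, (Φ.symm (φ x)).1)) ∈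
      G.cosetRel K.carrier := e7
    rwa [e6] at e8
  · rw [hρ0]
    let W : Set (EuclideanSpace ℝ (Fin (n - c)) × EuclideanSpace ℝ (Fin (n - c))) :=
      {w | (ι w.1, ι w.2) ∈ G.cosetRel K.carrier}
    suffices h : ∀ᶠ w in 𝓝[W] (0, 0), w.1 = w.2 by
      filter_upwards [eventually_nhdsWithin_iff.1 h] with w hw hw'
      exact hw (K.proj_eq_iff.1 hw')
    have f1 : Filter.Tendsto Prod.fst (𝓝[W] (0, 0)) (𝓝 0) := continuousWithinAt_fst
    have f2 : Filter.Tendsto Prod.snd (𝓝[W] (0, 0)) (𝓝 0) := continuousWithinAt_snd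
    have hx₀R : (x₀, x₀) ∈ G.cosetRel K.carrier := K.setoid.refl x₀
    -- Division is continuous on `R`, so equivalent points close to `x₀` have a quotient close to
    -- `a₀` in `K`; it is therefore in the range of the trivialization, with small coordinate `T`.
    have td : Filter.Tendsto (fun w : EuclideanSpace ℝ (Fin (n - c)) ×
        EuclideanSpace ℝ (Fin (n - c)) => G.pmul (G.s (ι w.1), ι w.2)) (𝓝[W] (0, 0))
        (𝓝[K.carrier] a₀) := by
      refine tendsto_nhdsWithin_iff.2 ⟨?_, ?_⟩
      · have h1 := (hG.contMDiffOn_div K.carrier).continuousOn _ hx₀R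
        rw [ContinuousWithinAt, pmul_s_self] at h1
        refine h1.comp (tendsto_nhdsWithin_iff.2 ⟨(tι.comp f1).prodMk_nhds (tι.comp f2), ?_⟩)
        exact self_mem_nhdsWithin
      · filter_upwards [self_mem_nhdsWithin] with w hw
        exact (mem_cosetRel_iff.1 hw).2
    have tT : Filter.Tendsto T (𝓝[K.carrier] a₀) (𝓝 0) := by
      have h2 : SmoothGerm I (𝓡 c) T K.carrier a₀ := hT.smooth.snd
      have := h2.continuousWithinAt hT.mem
      rwa [ContinuousWithinAt, hTa] at this
    have hsrc := ((tT.comp td).prodMk_nhds f1).eventually (Φ.open_source.mem_nhds hΦ0)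
    filter_upwards [td.eventually hT.left, hsrc, f2.eventually hsrc0,
      (tι.comp f2).eventually hΨ₀z, self_mem_nhdsWithin] with w e1 e2 e3 e4 e5
    obtain ⟨e6, e7⟩ := mem_cosetRel_iff.1 e5
    have e8 : G.eL (G.pmul (G.s (ι w.1), ι w.2)) = G.eR (ι w.1) := by
      rw [eL_pmul (by rw [G.eR_s, e6]), eL_s]
    have e9 := e1.2
    rw [e8] at e9
    -- Both sides are the coordinates of `ι w.2`, written once as `ι w.1` times the quotient and
    -- once as itself.
    have e10 : Φ (T (G.pmul (G.s (ι w.1), ι w.2)), w.1) = Φ (0, w.2) := by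
      rw [hΦι, hΦι]
      simp only [comp_apply] at e4
      rw [e4]
      simp only [Ψ₀]
      rw [e9, pmul_pmul_s e6]
    exact congrArg Prod.snd (Φ.injOn e2 e3 e10)

end Slices

end RelGroupoid

/-! ### Smooth actions of differential groupoids -/

namespace RelGroupoid

section Actions

variable {E H Γ E' H' Y : Type*} [NormedAddCommGroup E] [NormedSpace ℝ E] [TopologicalSpace H]
  {I : ModelWithCorners ℝ E H} [TopologicalSpace Γ] [ChartedSpace H Γ] {G : RelGroupoid Γ}
  [NormedAddCommGroup E'] [NormedSpace ℝ E'] [TopologicalSpace H']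
  {J : ModelWithCorners ℝ E' H'} [TopologicalSpace Y] [ChartedSpace H' Y] {k n d : ℕ}

variable (I G J) in
/-- A smooth action `g` of the groupoid `G` on `Y` with submersive anchor `f : Y → Γ⁰`. -/
structure SmoothAction (f : Y → Γ) (g : Γ × Y → Y) : Prop where
  f_mem : ∀ y, f y ∈ G.units
  smooth_f : ContMDiff J I ∞ f
  smooth_g : ContMDiffOn (I.prod J) J ∞ g {p | G.eR p.1 = f p.2}
  section_f : ∀ y, ∃ τ, IsSectionAt J I f univ G.units y τ
  f_g : ∀ {x y}, G.eR x = f y → f (g (x, y)) = G.eL x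
  g_unit : ∀ y, g (f y, y) = y
  g_mul : ∀ {x x' y}, G.eR x = G.eL x' → G.eR x' = f y →
    g (G.pmul (x, x'), y) = g (x, g (x', y))

namespace SmoothAction

variable {f : Y → Γ} {g : Γ × Y → Y}

theorem g_s_g (hA : SmoothAction I G J f g) {x : Γ} {y : Y} (h : G.eR x = f y) :
    g (G.s x, g (x, y)) = y := by
  rw [← hA.g_mul (G.eR_s x) h, pmul_s_self, h, hA.g_unit]

theorem g_g_s (hA : SmoothAction I G J f g) {x : Γ} {y : Y} (h : G.eL x = f y) :
    g (x, g (G.s x, y)) = y := by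
  have := hA.g_s_g (x := G.s x) (y := y) (by rw [G.eR_s, h])
  rwa [G.involutive] at this

theorem hasDimAt (hA : SmoothAction I G J f g) [I.Boundaryless] [IsManifold I ∞ Γ]
    [FiniteDimensional ℝ E] [J.Boundaryless] [IsManifold J ∞ Y] [FiniteDimensional ℝ E']
    (hG : SmoothMaps I G k) (hn : Module.finrank ℝ E = n) (hd : Module.finrank ℝ E' = d)
    {p : Γ × Y} (hp : G.eR p.1 = f p.2) :
    HasDimAt (I.prod J) (d + (n - k)) {p : Γ × Y | G.eR p.1 = f p.2} p := by
  obtain ⟨σ, hσ⟩ := hG.section_eR p.1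
  have h := hasDimAt_fiberProduct (F₂ := f) (hasDimAt_univ hn p.1) (hasDimAt_univ hd p.2)
    (hG.units_dim _ (G.eR_mem _)) (hG.smooth_eR.smoothGerm _ _)
    (Filter.Eventually.of_forall fun z => G.eR_mem z) (hA.smooth_f.smoothGerm _ _)
    (Filter.Eventually.of_forall fun z => hA.f_mem z) hσ hp
  simpa only [mem_univ, true_and] using h

/-- Smooth local sections of the action map. -/
theorem exists_section (hA : SmoothAction I G J f g) (hG : SmoothMaps I G k)
    {x : Γ} {y : Y} (h : G.eR x = f y) :
    ∃ σ : Y → Γ × Y, SmoothGerm J (I.prod J) σ univ (g (x, y)) ∧ σ (g (x, y)) = (x, y) ∧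
      ∀ᶠ z in 𝓝 (g (x, y)), G.eR (σ z).1 = f (σ z).2 ∧ g (σ z) = z := by
  obtain ⟨τ, hτ⟩ := hG.section_eL x
  have hf : SmoothGerm J I f univ (g (x, y)) := hA.smooth_f.smoothGerm _ _
  have hfx : f (g (x, y)) = G.eL x := hA.f_g h
  have hfu : ∀ᶠ z in 𝓝[univ] (g (x, y)), f z ∈ G.units :=
    Filter.Eventually.of_forall fun z => hA.f_mem z
  have hτf : SmoothGerm J I (fun z => τ (f z)) univ (g (x, y)) :=
    hτ.smooth.comp_of_eq hf (mem_univ _) hfx hfu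
  have hev : ∀ᶠ z in 𝓝[univ] (g (x, y)), G.eL (τ (f z)) = f z := by
    have t := hf.tendsto (mem_univ _) hfu
    rw [hfx] at t
    filter_upwards [t.eventually hτ.right] with z hz using hz.2
  have hev' : ∀ᶠ z in 𝓝[univ] (g (x, y)), G.eR (G.s (τ (f z))) = f z := by
    filter_upwards [hev] with z hz
    rw [G.eR_s, hz]
  have hm : τ (f (g (x, y))) = x := by rw [hfx, hτ.map]
  -- With `x' = τ (f z)` one has `e_L(x') = f(z)`, so `z` is `x'` acting on `s(x')z`.
  refine ⟨fun z => (τ (f z), g (G.s (τ (f z)), z)), hτf.prodMk ?_, ?_, ?_⟩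
  · exact (hA.smooth_g.smoothGerm (G.s (τ (f (g (x, y)))), g (x, y))).comp
      (f := fun z => (G.s (τ (f z)), z))
      ((hG.s_germ hτf (mem_univ _)).prodMk (SmoothGerm.id _ _)) (mem_univ _) hev'
  · simp only [hm, hA.g_s_g h]
  · rw [← nhdsWithin_univ]
    filter_upwards [hev, hev'] with z h1 h2
    exact ⟨by simp only [hA.f_g h2, eL_s], hA.g_g_s h1⟩

end SmoothAction

end Actions

/-! ### The quotient by a closed horizontal subgroupoid -/

section QuotientAction

variable {E H Γ : Type*} [NormedAddCommGroup E] [NormedSpace ℝ E] [TopologicalSpace H]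
  {I : ModelWithCorners ℝ E H} [TopologicalSpace Γ] [ChartedSpace H Γ] {G : RelGroupoid Γ}
  {k κ n d : ℕ}

namespace HorizontalSubgroupoid

variable (K : G.HorizontalSubgroupoid)

open Classical in
/-- The action of `Γ` on `Γ/Γ̃`, extended to all pairs. -/
noncomputable def pact (p : Γ × K.QuotientSpace) : K.QuotientSpace :=
  if h : p ∈ K.fiberProd then K.act ⟨p, h⟩ else p.2

theorem act_eq_pact (p : K.fiberProd) : K.act p = K.pact p := by
  rw [pact, dif_pos p.2]

theorem pact_proj {x x' : Γ} (h : G.eR x = G.eL x') :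
    K.pact (x, K.proj x') = K.proj (G.pmul (x, x')) := by
  have h' : (x, K.proj x') ∈ K.fiberProd := h
  rw [pact, dif_pos h', K.act_mk x x' h, mul_eq_pmul]

theorem isQuotientMap_proj : Topology.IsQuotientMap K.proj := isQuotientMap_quotient_mk'

theorem anchor_proj (x : Γ) : (K.anchor (K.proj x) : Γ) = G.eL x := rfl

theorem proj_surjective : Surjective K.proj := Quotient.exists_rep

variable {K}

theorem fiberTransitive (hG : SmoothMaps I G k) (hK : SmoothSub I G K.carrier κ)
    [I.Boundaryless] [IsManifold I ∞ Γ] [FiniteDimensional ℝ E] : FiberTransitive I K.proj := by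
  intro x y h
  obtain ⟨τ, h1, h2, h3⟩ := exists_section_cosetRel hG hK (K.proj_eq_iff.1 h)
  exact ⟨τ, h1, h2, h3.mono fun z hz => (K.proj_eq_iff.2 hz).symm⟩

/-- The pairs with equal left identities form a closed set, on which `(x, y) ↦ s(x)y` is continuous;
`R` is the preimage of `K` there. -/
theorem isClosed_cosetRel [T2Space Γ] (hG : SmoothMaps I G k) (hc : IsClosed K.carrier) :
    IsClosed (G.cosetRel K.carrier) := by
  set B : Set (Γ × Γ) := {p | G.eL p.1 = G.eL p.2}
  have hB : IsClosed B := isClosed_eq (hG.smooth_eL.continuous.comp continuous_fst)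
    (hG.smooth_eL.continuous.comp continuous_snd)
  have hd : ContinuousOn (fun p : Γ × Γ => G.pmul (G.s p.1, p.2)) B := by
    refine hG.smooth_pmul.continuousOn.comp
      ((hG.smooth_s.continuous.comp continuous_fst).prodMk continuous_snd).continuousOn ?_
    intro p hp
    exact (G.eR_s _).trans hp
  have : G.cosetRel K.carrier = B ∩ (fun p : Γ × Γ => G.pmul (G.s p.1, p.2)) ⁻¹' K.carrier := by
    ext ⟨x, y⟩
    exact mem_cosetRel_iff
  rw [this]
  exact hd.preimage_isClosed_of_isClosed hB hc

/-- With `σ` a local section of `π`, the anchor is `e_L ∘ σ` and the action is `(x, y) ↦ π(x σ(y))`.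
Sections of the anchor are `π` of sections of `e_L`, and the action axioms are associativity and the
unit law on representatives. -/
theorem smoothAction [ChartedSpace (EuclideanSpace ℝ (Fin d)) K.QuotientSpace]
    (hG : SmoothMaps I G k) (hπ : ContMDiff I (𝓡 d) ∞ K.proj)
    (hσ : ∀ x, ∃ σ, IsSectionAt I (𝓡 d) K.proj univ univ x σ) :
    SmoothAction I G (𝓡 d) (fun y => (K.anchor y : Γ)) K.pact where
  f_mem y := (K.anchor y).2
  smooth_f := by
    refine contMDiff_of_smoothGerm fun y => ?_
    obtain ⟨x, rfl⟩ := K.proj_surjective y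
    obtain ⟨σ, h⟩ := hσ x
    refine (hG.eL_germ h.smooth (mem_univ _)).congr ?_
    filter_upwards [h.right] with y hy
    rw [← K.anchor_proj, hy.2]
  smooth_g := by
    refine contMDiffOn_of_smoothGerm ?_
    rintro ⟨x, y⟩ hp
    obtain ⟨x', rfl⟩ := K.proj_surjective y
    obtain ⟨σ, h⟩ := hσ x'
    set S : Set (Γ × K.QuotientSpace) := {p | G.eR p.1 = K.anchor p.2}
    have h1 : SmoothGerm (I.prod (𝓡 d)) I (fun p : Γ × K.QuotientSpace => σ p.2) S
        (x, K.proj x') := h.smooth.comp_univ smoothGerm_snd hp rfl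
    have t : Filter.Tendsto Prod.snd (𝓝[S] (x, K.proj x')) (𝓝[univ] (K.proj x')) := by
      rw [nhdsWithin_univ]
      exact continuousWithinAt_snd
    have hev : ∀ᶠ p in 𝓝[S] (x, K.proj x'), K.proj (σ p.2) = p.2 ∧ G.eR p.1 = G.eL (σ p.2) := by
      filter_upwards [t.eventually h.right, self_mem_nhdsWithin] with p e1 e2
      refine ⟨e1.2, ?_⟩
      rw [← K.anchor_proj, e1.2]
      exact e2
    have h2 : SmoothGerm (I.prod (𝓡 d)) I (fun p : Γ × K.QuotientSpace => G.pmul (p.1, σ p.2)) S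
        (x, K.proj x') := hG.pmul_germ smoothGerm_fst h1 hp (hev.mono fun p e => e.2)
    refine ((hπ.smoothGerm univ _).comp_univ h2 hp rfl).congr ?_
    filter_upwards [hev] with p e
    rw [← K.pact_proj e.2, e.1]
  section_f y := by
    obtain ⟨x, rfl⟩ := K.proj_surjective y
    obtain ⟨τ, h⟩ := hG.section_eL x
    refine ⟨fun a => K.proj (τ a), ?_, ?_, ?_⟩
    · exact (hπ.smoothGerm univ _).comp_univ h.smooth (G.eL_mem x) rfl
    · simp only [K.anchor_proj, h.map]
    · filter_upwards [h.right] with a ha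
      exact ⟨mem_univ _, ha.2⟩
  f_g {x y} h := by
    obtain ⟨x', rfl⟩ := K.proj_surjective y
    have h : G.eR x = G.eL x' := h
    rw [K.pact_proj h, K.anchor_proj, eL_pmul h]
  g_unit y := by
    obtain ⟨x, rfl⟩ := K.proj_surjective y
    rw [K.anchor_proj, K.pact_proj (eR_of_mem_units (G.eL_mem x)), pmul_eL]
  g_mul {x x' y} h h' := by
    obtain ⟨z, rfl⟩ := K.proj_surjective y
    have h' : G.eR x' = G.eL z := h'
    rw [K.pact_proj h', K.pact_proj (by rw [eR_pmul h, h']), K.pact_proj (by rw [eL_pmul h', h]),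
      pmul_assoc h h']

variable [I.Boundaryless] [IsManifold I ∞ Γ] [FiniteDimensional ℝ E]

/-- The quotient by a closed horizontal differential subgroupoid is a manifold, and its projection
is a smooth map with local sections. -/
theorem exists_isSmoothManifold [T2Space Γ] [SecondCountableTopology Γ]
    (hn : Module.finrank ℝ E = n) (hG : SmoothMaps I G k) (hK : SmoothSub I G K.carrier κ)
    (hc : IsClosed K.carrier) :
    ∃ _ : ChartedSpace (EuclideanSpace ℝ (Fin (n - (κ - k)))) K.QuotientSpace,
      IsSmoothManifold (𝓡 (n - (κ - k))) K.QuotientSpace ∧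
      ContMDiff I (𝓡 (n - (κ - k))) ∞ K.proj ∧
      ∀ x, ∃ σ, IsSectionAt I (𝓡 (n - (κ - k))) K.proj univ univ x σ := by
  have hfib : FiberTransitive I K.proj := fiberTransitive hG hK
  obtain ⟨cs, hM, h1, h2⟩ := exists_quotient_manifold K.isQuotientMap_proj
    (exists_isSliceAt hn hG K hK) hfib
  have ho := hfib.isOpenQuotientMap K.isQuotientMap_proj
  refine ⟨cs, ⟨hM, inferInstance, inferInstance, ?_, ?_⟩, h1, h2⟩
  -- For an open quotient map, Hausdorffness amounts to closedness of `R`; this is where `hc`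
  -- enters.
  · rw [t2Space_iff_of_isOpenQuotientMap ho]
    convert isClosed_cosetRel hG hc using 1
    ext ⟨x, y⟩
    exact K.proj_eq_iff
  · exact K.isQuotientMap_proj.secondCountableTopology ho.isOpenMap

theorem anchor_submersion [ChartedSpace (EuclideanSpace ℝ (Fin d)) K.QuotientSpace]
    [IsManifold (𝓡 d) ∞ K.QuotientSpace] (hG : SmoothMaps I G k)
    (hA : SmoothAction I G (𝓡 d) (fun y => (K.anchor y : Γ)) K.pact) :
    ∃ A : SubmanifoldStructure I G.units,
      letI := A.chartedSpace
      Surjective K.anchor ∧ IsSubmersion (𝓡 d) (𝓡 A.dim) ∞ K.anchor := by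
  obtain ⟨A⟩ := nonempty_submanifoldStructure hG.units_dim
  refine ⟨A, fun a => ⟨K.proj a, Subtype.ext (eL_of_mem_units a.2)⟩, ?_⟩
  let _ := A.chartedSpace
  have := A.isManifold
  refine isSubmersion_of_local_sections (fun y => ?_) fun y => ?_
  · have h1 := contMDiffOn_univ.1 ((A.contMDiffOn_toSubtype (K.anchor y)).comp
      hA.smooth_f.contMDiffOn (s := univ) fun z _ => hA.f_mem z)
    refine (h1 y).congr_of_eventuallyEq (Filter.Eventually.of_forall fun z => ?_)
    exact (toSubtype_coe _ (K.anchor z)).symm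
  · obtain ⟨τ, h⟩ := hA.section_f y
    have hv : SmoothGerm (𝓡 A.dim) I (Subtype.val : G.units → Γ) univ (K.anchor y) :=
      A.isSmoothEmbedding.contMDiff.smoothGerm _ _
    have hvu : ∀ᶠ a : G.units in 𝓝[univ] (K.anchor y), (a : Γ) ∈ G.units :=
      Filter.Eventually.of_forall fun a => a.2
    refine ⟨fun a => τ a, h.smooth.comp hv (mem_univ _) hvu, h.map, ?_⟩
    rw [← nhdsWithin_univ]
    filter_upwards [(hv.tendsto (mem_univ _) hvu).eventually h.right] with a ha
    exact Subtype.ext ha.2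

theorem act_submersion [Nonempty Γ] [ChartedSpace (EuclideanSpace ℝ (Fin d)) K.QuotientSpace]
    [IsManifold (𝓡 d) ∞ K.QuotientSpace] (hG : SmoothMaps I G k)
    (hA : SmoothAction I G (𝓡 d) (fun y => (K.anchor y : Γ)) K.pact) :
    IsSubmanifold (I.prod (𝓡 d)) K.fiberProd ∧
      ∃ A : SubmanifoldStructure (I.prod (𝓡 d)) K.fiberProd,
        letI := A.chartedSpace
        Surjective K.act ∧ IsSubmersion (𝓡 A.dim) (𝓡 d) ∞ K.act := by
  have hmem : ∀ y, ((K.anchor y : Γ), y) ∈ K.fiberProd := fun y =>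
    eR_of_mem_units (K.anchor y).2
  obtain ⟨x₀⟩ := ‹Nonempty Γ›
  obtain ⟨A⟩ := nonempty_submanifoldStructure (I := I.prod (𝓡 d)) (S := K.fiberProd)
    fun p hp => hA.hasDimAt hG rfl rfl hp
  refine ⟨⟨⟨_, hmem (K.proj x₀)⟩, ⟨A⟩⟩, A, fun y => ⟨⟨_, hmem y⟩, ?_⟩, ?_⟩
  · rw [act_eq_pact]
    exact hA.g_unit y
  · refine A.isSubmersion (F' := K.pact) hA.smooth_g K.act_eq_pact ?_
    rintro ⟨⟨x, y⟩, h⟩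
    rw [act_eq_pact]
    exact hA.exists_section hG h

end HorizontalSubgroupoid

end QuotientAction

end RelGroupoid

/-! ### Velocities of curves, and the tangent and phase lifts of relations -/

section Velocities

variable {E H M E' H' N E'' H'' P : Type*}
  [NormedAddCommGroup E] [NormedSpace ℝ E] [TopologicalSpace H] {I : ModelWithCorners ℝ E H}
  [TopologicalSpace M] [ChartedSpace H M]
  [NormedAddCommGroup E'] [NormedSpace ℝ E'] [TopologicalSpace H'] {J : ModelWithCorners ℝ E' H'}
  [TopologicalSpace N] [ChartedSpace H' N]
  [NormedAddCommGroup E''] [NormedSpace ℝ E''] [TopologicalSpace H'']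
  {L : ModelWithCorners ℝ E'' H''} [TopologicalSpace P] [ChartedSpace H'' P]

variable (I) in
/-- The curve `γ` is smooth at time `0`. -/
abbrev SmoothCurve (γ : ℝ → M) : Prop := ContMDiffAt 𝓘(ℝ, ℝ) I ∞ γ 0

variable (I) in
/-- The derivative of a curve at time `0`, in the model space. -/
noncomputable def curveDeriv (γ : ℝ → M) : E := mfderiv 𝓘(ℝ, ℝ) I γ 0 (1 : ℝ)

variable (I) in
/-- The tangent vector at `x` given by a vector of the model space. -/
def tangentVector (x : M) (v : E) : TangentBundle I M := ⟨x, v⟩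

variable (I) in
/-- The velocity of a curve at time `0`. -/
noncomputable def velocity (γ : ℝ → M) : TangentBundle I M :=
  tangentVector I (γ 0) (curveDeriv I γ)

theorem SmoothCurve.mdifferentiableAt {γ : ℝ → M} (h : SmoothCurve I γ) :
    MDifferentiableAt 𝓘(ℝ, ℝ) I γ 0 := ContMDiffAt.mdifferentiableAt h (by simp)

theorem velocity_congr {γ γ' : ℝ → M} (h : ∀ᶠ t in 𝓝 0, γ t = γ' t) :
    velocity I γ = velocity I γ' := by
  have h1 : mfderiv 𝓘(ℝ, ℝ) I γ 0 = mfderiv 𝓘(ℝ, ℝ) I γ' 0 := Filter.EventuallyEq.mfderiv_eq h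
  have h0 : γ 0 = γ' 0 := h.self_of_nhds
  have h2 : curveDeriv I γ = curveDeriv I γ' :=
    congrArg (fun A : ℝ →L[ℝ] E => A 1) h1
  simp only [velocity, h0, h2]

theorem velocity_eq_iff {γ γ' : ℝ → M} :
    velocity I γ = velocity I γ' ↔ γ 0 = γ' 0 ∧ curveDeriv I γ = curveDeriv I γ' := by
  refine ⟨fun h => ⟨congrArg Bundle.TotalSpace.proj h, ?_⟩, fun h => ?_⟩
  · exact congrArg (fun V : TangentBundle I M => (V.2 : E)) h
  · simp only [velocity, h.1, h.2]

theorem curveDeriv_const (x : M) : curveDeriv I (fun _ : ℝ => x) = 0 := by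
  rw [curveDeriv, mfderiv_const]
  rfl

theorem curveDeriv_prodMk {γ : ℝ → M} {δ : ℝ → N} (hγ : SmoothCurve I γ) (hδ : SmoothCurve J δ) :
    curveDeriv (I.prod J) (fun t => (γ t, δ t)) = (curveDeriv I γ, curveDeriv J δ) := by
  rw [curveDeriv, mfderiv_prodMk hγ.mdifferentiableAt hδ.mdifferentiableAt]
  rfl

theorem velocity_prodMk_eq_iff {γ γ' : ℝ → M} {δ δ' : ℝ → N} (hγ : SmoothCurve I γ)
    (hδ : SmoothCurve J δ) (hγ' : SmoothCurve I γ') (hδ' : SmoothCurve J δ') :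
    velocity (I.prod J) (fun t => (γ t, δ t)) = velocity (I.prod J) (fun t => (γ' t, δ' t)) ↔
      velocity I γ = velocity I γ' ∧ velocity J δ = velocity J δ' := by
  simp only [velocity_eq_iff, curveDeriv_prodMk hγ hδ, curveDeriv_prodMk hγ' hδ', Prod.mk.injEq]
  tauto

theorem velocity_prod_eq_iff {γ γ' : ℝ → M × N} (hγ : SmoothCurve (I.prod J) γ)
    (hγ' : SmoothCurve (I.prod J) γ') :
    velocity (I.prod J) γ = velocity (I.prod J) γ' ↔
      velocity I (fun t => (γ t).1) = velocity I (fun t => (γ' t).1) ∧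
        velocity J (fun t => (γ t).2) = velocity J (fun t => (γ' t).2) :=
  velocity_prodMk_eq_iff hγ.fst hγ.snd hγ'.fst hγ'.snd

/-- `S` may be thin, so the derivative of `F` within `S` is a choice. The curve stays in `S` near
time `0`, so its composite has an ordinary derivative, obtained from that fixed choice. Hence the
velocity of `F ∘ γ` depends only on the velocity of `γ`. -/
theorem velocity_comp {F : M → N} {S : Set M} {γ : ℝ → M} (hγ : SmoothCurve I γ)
    (hS : ∀ᶠ t in 𝓝 0, γ t ∈ S) (hF : ContMDiffWithinAt I J ∞ F S (γ 0)) :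
    velocity J (fun t => F (γ t)) = tangentMapWithin I J F S (velocity I γ) := by
  have h1 := (hF.mdifferentiableWithinAt (by simp)).hasMFDerivWithinAt
  have h2 := (hγ.mdifferentiableAt.hasMFDerivAt).hasMFDerivWithinAt (s := γ ⁻¹' S)
  have h3 := (h1.comp 0 h2 subset_rfl).hasMFDerivAt hS
  have h4 : curveDeriv J (fun t => F (γ t)) =
      mfderivWithin I J F S (γ 0) (mfderiv 𝓘(ℝ, ℝ) I γ 0 (1 : ℝ)) :=
    congrArg (fun A : ℝ →L[ℝ] E' => A 1) h3.mfderiv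
  rw [velocity, h4]
  rfl

theorem velocity_comp_eq {F : M → N} {S : Set M} {γ γ' : ℝ → M} (hγ : SmoothCurve I γ)
    (hγ' : SmoothCurve I γ') (hS : ∀ᶠ t in 𝓝 0, γ t ∈ S) (hS' : ∀ᶠ t in 𝓝 0, γ' t ∈ S)
    (hF : ContMDiffOn I J ∞ F S) (h : velocity I γ = velocity I γ') :
    velocity J (fun t => F (γ t)) = velocity J (fun t => F (γ' t)) := by
  rw [velocity_comp hγ hS (hF _ hS.self_of_nhds), velocity_comp hγ' hS' (hF _ hS'.self_of_nhds), h]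

/-- Every tangent vector is the velocity of a curve. -/
theorem exists_smoothCurve [I.Boundaryless] [IsManifold I ∞ M] (x : M) (v : E) :
    ∃ γ : ℝ → M, SmoothCurve I γ ∧ γ 0 = x ∧ curveDeriv I γ = v := by
  have hφ := setDiffeoAt_extChartAt (I := I) x
  set φ := extChartAt I x with hφdef
  have hl : ContDiff ℝ ∞ (fun t : ℝ => φ x + t • v) :=
    contDiff_const.add (contDiff_id.smul contDiff_const)
  have h0 : φ x + (0 : ℝ) • v = φ x := by simp
  have hx : φ.symm (φ x + (0 : ℝ) • v) = x := by rw [h0, hφ.map_inv]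
  have hs : SmoothCurve I (fun t : ℝ => φ.symm (φ x + t • v)) :=
    (hφ.smooth_inv.comp_univ (hl.contMDiff.smoothGerm univ 0) (mem_univ _) h0).contMDiffAt
  refine ⟨fun t => φ.symm (φ x + t • v), hs, hx, ?_⟩
  have hder : HasMFDerivAt 𝓘(ℝ, ℝ) I (fun t : ℝ => φ.symm (φ x + t • v)) 0
      ((1 : ℝ →L[ℝ] ℝ).smulRight v) := by
    refine ⟨hs.continuousAt, ?_⟩
    have h1 : HasFDerivAt (fun t : ℝ => φ x + t • v) ((1 : ℝ →L[ℝ] ℝ).smulRight v) 0 :=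
      ((hasFDerivAt_id (𝕜 := ℝ) (0 : ℝ)).smul_const v).const_add _
    have hr := hφ.right
    rw [nhdsWithin_univ] at hr
    have ht : Filter.Tendsto (fun t : ℝ => φ x + t • v) (𝓝 0) (𝓝 (φ x)) := by
      have := hl.continuous.tendsto 0
      rwa [h0] at this
    refine (h1.congr_of_eventuallyEq (f₁ := writtenInExtChartAt 𝓘(ℝ, ℝ) I 0
      (fun t : ℝ => φ.symm (φ x + t • v))) ?_).hasFDerivWithinAt
    filter_upwards [ht.eventually hr] with t e
    simp only [writtenInExtChartAt, hx]
    exact e.2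
  exact (congrArg (fun A : ℝ →L[ℝ] E => A 1) hder.mfderiv).trans (one_smul ℝ v)

end Velocities

/-! ### Tangent and phase lifts described by curves in graphs -/

section Lifts

variable {EX HX X EY HY Y EZ HZ Z : Type*}
  [NormedAddCommGroup EX] [NormedSpace ℝ EX] [TopologicalSpace HX] {IX : ModelWithCorners ℝ EX HX}
  [TopologicalSpace X] [ChartedSpace HX X]
  [NormedAddCommGroup EY] [NormedSpace ℝ EY] [TopologicalSpace HY] {IY : ModelWithCorners ℝ EY HY}
  [TopologicalSpace Y] [ChartedSpace HY Y]
  [NormedAddCommGroup EZ] [NormedSpace ℝ EZ] [TopologicalSpace HZ] {IZ : ModelWithCorners ℝ EZ HZ}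
  [TopologicalSpace Z] [ChartedSpace HZ Z]

variable (IX IY) in
/-- The smooth curves `y` and `x` form a curve in the graph of `r`. -/
structure CurveInRel (r : SetRel Y X) (y : ℝ → Y) (x : ℝ → X) : Prop where
  smooth_left : SmoothCurve IY y
  smooth_right : SmoothCurve IX x
  mem : ∀ᶠ t in 𝓝 0, (y t, x t) ∈ r

/-- A curve in the graph is a pair of curves, so equations defining a relation can be differentiated
along curves, without computing tangent spaces of graphs. -/
theorem mem_tangentLift_iff {r : SetRel Y X} {U : TangentBundle IY Y} {V : TangentBundle IX X} :
    (U, V) ∈ tangentLift IX IY r ↔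
      ∃ y x, CurveInRel IX IY r y x ∧ velocity IY y = U ∧ velocity IX x = V := by
  have key : ∀ y x, SmoothCurve IY y → SmoothCurve IX x →
      (⟨(y 0, x 0), mfderiv 𝓘(ℝ, ℝ) (IY.prod IX) (fun t => (y t, x t)) 0 (1 : ℝ)⟩ :
        TangentBundle (IY.prod IX) (Y × X)) =
      (equivTangentBundleProd IY Y IX X).symm (velocity IY y, velocity IX x) := by
    intro y x hy hx
    exact congrArg (tangentVector (IY.prod IX) (y 0, x 0)) (curveDeriv_prodMk hy hx)
  constructor
  · rintro ⟨γ, h1, h2, h3⟩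
    refine ⟨fun t => (γ t).1, fun t => (γ t).2, ⟨h1.fst, h1.snd, h2⟩, ?_⟩
    have h4 := key _ _ h1.fst h1.snd
    have h5 := (equivTangentBundleProd IY Y IX X).symm.injective (h3.trans h4)
    exact ⟨(congrArg Prod.fst h5).symm, (congrArg Prod.snd h5).symm⟩
  · rintro ⟨y, x, h, rfl, rfl⟩
    exact ⟨fun t => (y t, x t), ContMDiffAt.prodMk h.smooth_left h.smooth_right, h.mem,
      (key y x h.smooth_left h.smooth_right).symm⟩

/-- A criterion for the simplicity of the composition of tangent lifts. -/
theorem simpleComp_tangentLift {r : SetRel Z Y} {s : SetRel Y X}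
    (h : ∀ {z y y₁ x z' y' y₁' x'}, CurveInRel IY IZ r z y → CurveInRel IX IY s y₁ x →
      CurveInRel IY IZ r z' y' → CurveInRel IX IY s y₁' x' →
      velocity IY y = velocity IY y₁ → velocity IY y' = velocity IY y₁' →
      velocity IZ z = velocity IZ z' → velocity IX x = velocity IX x' →
      velocity IY y = velocity IY y') :
    GraphRel.SimpleComp (tangentLift IY IZ r) (tangentLift IX IY s) := by
  rintro U W ⟨V, h1, h2⟩
  refine ⟨V, ⟨h1, h2⟩, ?_⟩
  rintro V' ⟨h1', h2'⟩
  obtain ⟨z, y, a1, a2, a3⟩ := mem_tangentLift_iff.1 h1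
  obtain ⟨y₁, x, b1, b2, b3⟩ := mem_tangentLift_iff.1 h2
  obtain ⟨z', y', a1', a2', a3'⟩ := mem_tangentLift_iff.1 h1'
  obtain ⟨y₁', x', b1', b2', b3'⟩ := mem_tangentLift_iff.1 h2'
  rw [← a3, ← a3']
  exact (h a1 b1 a1' b1' (a3.trans b2.symm) (a3'.trans b2'.symm) (a2.trans a2'.symm)
    (b3.trans b3'.symm)).symm

/-- A criterion for the simplicity of the composition of phase lifts: the tangent spaces of
the graphs span the tangent space at the intermediate point. -/
theorem simpleComp_phaseLift {r : SetRel Z Y} {s : SetRel Y X} (hrs : GraphRel.SimpleComp r s)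
    (h : ∀ {z y x}, (z, y) ∈ r → (y, x) ∈ s → ∀ w : EY, ∃ (c : ℝ → Z) (b b₁ : ℝ → Y) (a : ℝ → X),
      CurveInRel IY IZ r c b ∧ CurveInRel IX IY s b₁ a ∧ c 0 = z ∧ b 0 = y ∧ b₁ 0 = y ∧ a 0 = x ∧
      curveDeriv IY b + curveDeriv IY b₁ = w) :
    GraphRel.SimpleComp (phaseLift IY IZ r) (phaseLift IX IY s) := by
  rintro ⟨z, ζ⟩ ⟨x, ξ⟩ ⟨⟨y, η⟩, h1, h2⟩
  refine ⟨⟨y, η⟩, ⟨h1, h2⟩, ?_⟩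
  rintro ⟨y', η'⟩ ⟨h1', h2'⟩
  -- The base points agree by simplicity of `r s` itself; only the covectors remain to be compared.
  obtain rfl : y' = y := by
    obtain ⟨_, -, hu⟩ := hrs z x ⟨y, h1.1, h2.1⟩
    rw [hu y ⟨h1.1, h2.1⟩, hu y' ⟨h1'.1, h2'.1⟩]
  suffices η' = η by rw [this]
  refine ContinuousLinearMap.ext fun w => ?_
  obtain ⟨c, b, b₁, a, hr, hs, rfl, rfl, hb, rfl, hw⟩ := h h1.1 h2.1 w
  have e1 : (velocity IZ c, velocity IY b) ∈ tangentLift IY IZ r :=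
    mem_tangentLift_iff.2 ⟨c, b, hr, rfl, rfl⟩
  have e2 : (tangentVector IY (b 0) (curveDeriv IY b₁), velocity IX a) ∈
      tangentLift IX IY s := by
    refine mem_tangentLift_iff.2 ⟨b₁, a, hs, ?_, rfl⟩
    simp only [velocity, hb]
  set u : EY := curveDeriv IY b
  set u₁ : EY := curveDeriv IY b₁
  -- Both covectors are pinned by `ζ` on the vectors coming from `r`, and by `ξ` on those coming
  -- from `s`.
  have f1 : η' u = η u :=
    (h1'.2 _ _ e1).symm.trans (h1.2 _ _ e1)
  have f2 : η' u₁ = η u₁ :=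
    (h2'.2 _ _ e2).trans (h2.2 _ _ e2).symm
  rw [← hw]
  exact (map_add η' _ _).trans ((congrArg₂ (· + ·) f1 f2).trans (map_add η _ _).symm)

end Lifts

/-! ### The pair groupoid as a differential groupoid -/

section Parametrized

variable {E H M E' H' N E'' H'' P : Type*}
  [NormedAddCommGroup E] [NormedSpace ℝ E] [TopologicalSpace H] {I : ModelWithCorners ℝ E H}
  [TopologicalSpace M] [ChartedSpace H M]
  [NormedAddCommGroup E'] [NormedSpace ℝ E'] [TopologicalSpace H'] {J : ModelWithCorners ℝ E' H'}
  [TopologicalSpace N] [ChartedSpace H' N]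
  [NormedAddCommGroup E''] [NormedSpace ℝ E''] [TopologicalSpace H'']
  {L : ModelWithCorners ℝ E'' H''} [TopologicalSpace P] [ChartedSpace H'' P]

theorem smoothCurve_const (x : M) : SmoothCurve I (fun _ : ℝ => x) := contMDiffAt_const

/-- A set parametrized by a smooth map with a smooth left inverse is a submanifold. -/
theorem isSubmanifold_of_parametrization [I.Boundaryless] [IsManifold I ∞ M]
    [FiniteDimensional ℝ E] [J.Boundaryless] [IsManifold J ∞ N] [FiniteDimensional ℝ E']
    [Nonempty N] {φ : N → M} {ψ : M → N} (hφ : ContMDiff J I ∞ φ) (hψ : ContMDiff I J ∞ ψ)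
    (h : ∀ x, ψ (φ x) = x) {S : Set M} (hS : ∀ y, y ∈ S ↔ φ (ψ y) = y) : IsSubmanifold I S := by
  have hmem : ∀ x, φ x ∈ S := fun x => (hS _).2 (by rw [h])
  obtain ⟨x₀⟩ := ‹Nonempty N›
  refine isSubmanifold_of_hasDimAt (d := Module.finrank ℝ E') ⟨_, hmem x₀⟩ fun p hp => ?_
  exact (SetDiffeoAt.of_contMDiffOn (T := univ) hψ.contMDiffOn hφ.contMDiffOn
    (fun x hx => ⟨mem_univ _, (hS x).1 hx⟩) (fun y _ => ⟨hmem y, h y⟩) hp).hasDimAt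
    (hasDimAt_univ rfl _)

/-- The composition of tangent lifts is simple if the first relation is contained in a smooth
map. -/
theorem simpleComp_tangentLift_of_map {r : SetRel P N} {s : SetRel N M} {F : M → N}
    (hF : ContMDiff I J ∞ F) (hs : ∀ {y x}, (y, x) ∈ s → y = F x) :
    GraphRel.SimpleComp (tangentLift J L r) (tangentLift I J s) := by
  refine simpleComp_tangentLift fun {z y y₁ x z' y' y₁' x'} _ h2 _ h4 e1 e2 _ e4 => ?_
  rw [e1, e2, velocity_congr (h2.mem.mono fun t ht => hs ht),
    velocity_congr (h4.mem.mono fun t ht => hs ht)]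
  exact velocity_comp_eq h2.smooth_right h4.smooth_right (S := univ)
    (Filter.Eventually.of_forall fun _ => mem_univ _)
    (Filter.Eventually.of_forall fun _ => mem_univ _) hF.contMDiffOn e4

theorem SmoothCurve.comp {F : M → N} {S : Set M} {γ : ℝ → M} (hγ : SmoothCurve I γ)
    (hF : ContMDiffWithinAt I J ∞ F S (γ 0)) (hS : ∀ᶠ t in 𝓝 0, γ t ∈ S) :
    SmoothCurve J (fun t => F (γ t)) :=
  (ContMDiffWithinAt.comp 0 hF (hγ.contMDiffWithinAt (s := γ ⁻¹' S)) fun _ h => h).contMDiffAt hS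

end Parametrized

/-! ### Simplicity and transversality in the pair groupoid -/

namespace RelGroupoid

section Pair

variable {Y : Type*}

theorem mem_pair_m_iff {z p q : Y × Y} :
    (z, (p, q)) ∈ (pair Y).m ↔ p.2 = q.1 ∧ z = (p.1, q.2) := by
  constructor
  · rintro ⟨a, b, c, h⟩
    simp only [Prod.mk.injEq] at h
    obtain ⟨rfl, rfl, rfl⟩ := h
    exact ⟨rfl, rfl⟩
  · rintro ⟨h, rfl⟩
    exact ⟨p.1, q.2, p.2, Prod.ext rfl (Prod.ext rfl (Prod.ext h.symm rfl))⟩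

theorem mem_pair_e_iff {a : Y × Y} {o : OnePt} : (a, o) ∈ (pair Y).e ↔ a.1 = a.2 := Iff.rfl

variable {E H : Type*} [NormedAddCommGroup E] [NormedSpace ℝ E] [TopologicalSpace H]
  {J : ModelWithCorners ℝ E H} [TopologicalSpace Y] [ChartedSpace H Y]

theorem pair_simpleComp_m_id :
    GraphRel.SimpleComp (pair Y).m (GraphRel.prod (pair Y).m SetRel.id) := by
  rintro z ⟨⟨p, q⟩, u⟩ ⟨⟨a, b⟩, h1, h2⟩
  refine ⟨⟨a, b⟩, ⟨h1, h2⟩, ?_⟩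
  rintro ⟨a', b'⟩ ⟨-, h2', h3'⟩
  obtain ⟨h2, h3⟩ := h2
  obtain rfl : b = u := h3
  obtain rfl : b' = b := h3'
  exact Prod.ext ((pair Y).mul_unique h2' h2) rfl

theorem pair_simpleComp_id_m :
    GraphRel.SimpleComp (pair Y).m (GraphRel.prod SetRel.id (pair Y).m) := by
  rintro z ⟨u, ⟨p, q⟩⟩ ⟨⟨a, b⟩, h1, h2⟩
  refine ⟨⟨a, b⟩, ⟨h1, h2⟩, ?_⟩
  rintro ⟨a', b'⟩ ⟨-, h3', h2'⟩
  obtain ⟨h3, h2⟩ := h2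
  obtain rfl : a = u := h3
  obtain rfl : a' = a := h3'
  exact Prod.ext rfl ((pair Y).mul_unique h2' h2)

theorem pair_simpleComp_e_id :
    GraphRel.SimpleComp (pair Y).m (GraphRel.prod (pair Y).e SetRel.id) := by
  rintro z ⟨o, u⟩ ⟨⟨a, b⟩, h1, h2⟩
  refine ⟨⟨a, b⟩, ⟨h1, h2⟩, ?_⟩
  rintro ⟨a', b'⟩ ⟨h1', h2', h3'⟩
  obtain ⟨h2, h3⟩ := h2
  obtain rfl : b = u := h3
  obtain rfl : b' = b := h3'
  exact Prod.ext (((pair Y).eL_unique ⟨_, h2'⟩ h1').trans ((pair Y).eL_unique ⟨_, h2⟩ h1).symm) rfl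

theorem pair_simpleComp_id_e :
    GraphRel.SimpleComp (pair Y).m (GraphRel.prod SetRel.id (pair Y).e) := by
  rintro z ⟨u, o⟩ ⟨⟨a, b⟩, h1, h2⟩
  refine ⟨⟨a, b⟩, ⟨h1, h2⟩, ?_⟩
  rintro ⟨a', b'⟩ ⟨h1', h3', h2'⟩
  obtain ⟨h3, h2⟩ := h2
  obtain rfl : a = u := h3
  obtain rfl : a' = a := h3'
  exact Prod.ext rfl (((pair Y).eR_unique ⟨_, h2'⟩ h1').trans ((pair Y).eR_unique ⟨_, h2⟩ h1).symm)

variable [J.Boundaryless] [IsManifold J ∞ Y] [FiniteDimensional ℝ E]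

/-- `m × id` lies in the graph of a globally defined smooth map, which fixes the intermediate
velocity. Outer endpoints move freely with the inner ones fixed, so its graph alone spans for the
phase lift. The composite is parametrized by the four points of three composable pairs. -/
theorem pair_transverse_m_id [Nonempty Y] :
    Transverse (((J.prod J).prod (J.prod J)).prod (J.prod J)) ((J.prod J).prod (J.prod J))
      (J.prod J) (pair Y).m (GraphRel.prod (pair Y).m SetRel.id) where
  tangent := by
    refine simpleComp_tangentLift_of_map
      (F := fun x : ((Y × Y) × (Y × Y)) × (Y × Y) => ((x.1.1.1, x.1.2.2), x.2)) ?_ ?_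
    · exact (contMDiff_fst.fst.fst.prodMk contMDiff_fst.snd.snd).prodMk contMDiff_snd
    · rintro ⟨a, b⟩ ⟨⟨p, q⟩, u⟩ ⟨h1, h2⟩
      exact Prod.ext (mem_pair_m_iff.1 h1).2 h2
  phase := by
    refine simpleComp_phaseLift pair_simpleComp_m_id ?_
    rintro z ⟨a, b⟩ ⟨⟨p, q⟩, u⟩ h1 h2 ⟨A, B⟩
    have h2 : (a, (p, q)) ∈ (pair Y).m ∧ b = u := h2
    obtain ⟨⟨h3, rfl⟩, rfl⟩ := And.imp_left mem_pair_m_iff.1 h2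
    obtain ⟨α, hα, α0, hA⟩ := exists_smoothCurve (I := J.prod J) (p.1, q.2) A
    obtain ⟨β, hβ, β0, hB⟩ := exists_smoothCurve (I := J.prod J) b B
    refine ⟨fun _ => z, fun _ => ((p.1, q.2), b), fun t => (α t, β t),
      fun t => ((((α t).1, p.2), (p.2, (α t).2)), β t),
      ⟨smoothCurve_const _, smoothCurve_const _, Filter.Eventually.of_forall fun _ => h1⟩,
      ⟨hα.prodMk hβ, ?_, Filter.Eventually.of_forall fun t => ⟨mem_pair_m_iff.2 ⟨rfl, rfl⟩, rfl⟩⟩,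
      rfl, rfl, ?_, ?_, ?_⟩
    · exact ((hα.fst.prodMk contMDiffAt_const).prodMk (contMDiffAt_const.prodMk hα.snd)).prodMk hβ
    · simp only [α0, β0]
    · simp only [α0, β0]
      exact Prod.ext (Prod.ext rfl (Prod.ext h3 rfl)) rfl
    · rw [curveDeriv_const, curveDeriv_prodMk hα hβ, hA, hB, zero_add]
  differentiable := by
    refine isSubmanifold_of_parametrization (J := (J.prod J).prod (J.prod J))
      (φ := fun y : (Y × Y) × (Y × Y) =>
        ((y.1.1, y.2.2), (((y.1.1, y.1.2), (y.1.2, y.2.1)), (y.2.1, y.2.2))))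
      (ψ := fun p => (p.2.1.1, p.2.2)) ?_ (contMDiff_snd.fst.fst.prodMk contMDiff_snd.snd)
      (fun _ => rfl) ?_
    · have h1 := (contMDiff_fst (I := J.prod J) (J := J.prod J) (M := Y × Y) (N := Y × Y)
        (n := ∞)).fst
      have h2 := (contMDiff_fst (I := J.prod J) (J := J.prod J) (M := Y × Y) (N := Y × Y)
        (n := ∞)).snd
      have h3 := (contMDiff_snd (I := J.prod J) (J := J.prod J) (M := Y × Y) (N := Y × Y)
        (n := ∞)).fst
      have h4 := (contMDiff_snd (I := J.prod J) (J := J.prod J) (M := Y × Y) (N := Y × Y)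
        (n := ∞)).snd
      exact (h1.prodMk h4).prodMk (((h1.prodMk h2).prodMk (h2.prodMk h3)).prodMk (h3.prodMk h4))
    · rintro ⟨⟨z, z'⟩, ⟨⟨⟨a, b⟩, ⟨c, d⟩⟩, ⟨e, f⟩⟩⟩
      simp only [SetRel.comp, GraphRel.prod, SetRel.id, mem_ofPred_eq, Prod.exists, mem_pair_m_iff,
        Prod.mk.injEq]
      grind

theorem pair_transverse_id_m [Nonempty Y] :
    Transverse ((J.prod J).prod ((J.prod J).prod (J.prod J))) ((J.prod J).prod (J.prod J))
      (J.prod J) (pair Y).m (GraphRel.prod SetRel.id (pair Y).m) where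
  tangent := by
    refine simpleComp_tangentLift_of_map
      (F := fun x : (Y × Y) × ((Y × Y) × (Y × Y)) => (x.1, (x.2.1.1, x.2.2.2))) ?_ ?_
    · exact contMDiff_fst.prodMk (contMDiff_snd.fst.fst.prodMk contMDiff_snd.snd.snd)
    · rintro ⟨a, b⟩ ⟨u, ⟨p, q⟩⟩ ⟨h1, h2⟩
      exact Prod.ext h1 (mem_pair_m_iff.1 h2).2
  phase := by
    refine simpleComp_phaseLift pair_simpleComp_id_m ?_
    rintro z ⟨b, a⟩ ⟨u, ⟨p, q⟩⟩ h1 h2 ⟨B, A⟩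
    have h2 : b = u ∧ (a, (p, q)) ∈ (pair Y).m := h2
    obtain ⟨rfl, ⟨h3, rfl⟩⟩ := And.imp_right mem_pair_m_iff.1 h2
    obtain ⟨α, hα, α0, hA⟩ := exists_smoothCurve (I := J.prod J) (p.1, q.2) A
    obtain ⟨β, hβ, β0, hB⟩ := exists_smoothCurve (I := J.prod J) b B
    refine ⟨fun _ => z, fun _ => (b, (p.1, q.2)), fun t => (β t, α t),
      fun t => (β t, (((α t).1, p.2), (p.2, (α t).2))),
      ⟨smoothCurve_const _, smoothCurve_const _, Filter.Eventually.of_forall fun _ => h1⟩,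
      ⟨hβ.prodMk hα, ?_, Filter.Eventually.of_forall fun t => ⟨rfl, mem_pair_m_iff.2 ⟨rfl, rfl⟩⟩⟩,
      rfl, rfl, ?_, ?_, ?_⟩
    · exact hβ.prodMk ((hα.fst.prodMk contMDiffAt_const).prodMk (contMDiffAt_const.prodMk hα.snd))
    · simp only [α0, β0]
    · simp only [α0, β0]
      exact Prod.ext rfl (Prod.ext rfl (Prod.ext h3 rfl))
    · rw [curveDeriv_const, curveDeriv_prodMk hβ hα, hA, hB, zero_add]
  differentiable := by
    refine isSubmanifold_of_parametrization (J := (J.prod J).prod (J.prod J))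
      (φ := fun y : (Y × Y) × (Y × Y) =>
        ((y.1.1, y.2.2), ((y.1.1, y.1.2), ((y.1.2, y.2.1), (y.2.1, y.2.2)))))
      (ψ := fun p => (p.2.1, p.2.2.2)) ?_ (contMDiff_snd.fst.prodMk contMDiff_snd.snd.snd)
      (fun _ => rfl) ?_
    · have h1 := (contMDiff_fst (I := J.prod J) (J := J.prod J) (M := Y × Y) (N := Y × Y)
        (n := ∞)).fst
      have h2 := (contMDiff_fst (I := J.prod J) (J := J.prod J) (M := Y × Y) (N := Y × Y)
        (n := ∞)).snd
      have h3 := (contMDiff_snd (I := J.prod J) (J := J.prod J) (M := Y × Y) (N := Y × Y)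
        (n := ∞)).fst
      have h4 := (contMDiff_snd (I := J.prod J) (J := J.prod J) (M := Y × Y) (N := Y × Y)
        (n := ∞)).snd
      exact (h1.prodMk h4).prodMk ((h1.prodMk h2).prodMk ((h2.prodMk h3).prodMk (h3.prodMk h4)))
    · rintro ⟨⟨z, z'⟩, ⟨⟨a, b⟩, ⟨⟨c, d⟩, ⟨e, f⟩⟩⟩⟩
      simp only [SetRel.comp, GraphRel.prod, SetRel.id, mem_ofPred_eq, Prod.exists, mem_pair_m_iff,
        Prod.mk.injEq]
      grind

/-- Here the second relation is not a map. Composability determines the inserted identity: both its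
components move like the left endpoint of the given pair. Dually, the graph of `m` lets the first
endpoint move alone, and that of `e × id` supplies the diagonal motions and those of the second
pair. -/
theorem pair_transverse_e_id [Nonempty Y] :
    Transverse ((𝓡 0).prod (J.prod J)) ((J.prod J).prod (J.prod J))
      (J.prod J) (pair Y).m (GraphRel.prod (pair Y).e SetRel.id) where
  tangent := by
    have key : ∀ {z y y₁ x}, CurveInRel ((J.prod J).prod (J.prod J)) (J.prod J) (pair Y).m z y →
        CurveInRel ((𝓡 0).prod (J.prod J)) ((J.prod J).prod (J.prod J))
          (GraphRel.prod (pair Y).e SetRel.id) y₁ x →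
        velocity ((J.prod J).prod (J.prod J)) y = velocity ((J.prod J).prod (J.prod J)) y₁ →
        velocity J (fun t => (y t).1.1) = velocity J (fun t => (x t).2.1) ∧
        velocity J (fun t => (y t).1.2) = velocity J (fun t => (x t).2.1) ∧
        velocity (J.prod J) (fun t => (y t).2) = velocity (J.prod J) (fun t => (x t).2) := by
      intro z y y₁ x h1 h2 e
      have hy := h1.smooth_right
      have hy₁ := h2.smooth_left
      have hx := h2.smooth_right
      rw [velocity_prod_eq_iff hy hy₁, velocity_prod_eq_iff hy.fst hy₁.fst] at e
      obtain ⟨⟨e1, e2⟩, e3⟩ := e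
      have e4 : velocity J (fun t => (y t).1.2) = velocity J (fun t => (y t).2.1) :=
        velocity_congr (h1.mem.mono fun t ht => (mem_pair_m_iff.1 ht).1)
      have e5 : velocity J (fun t => (y₁ t).1.1) = velocity J (fun t => (y₁ t).1.2) :=
        velocity_congr (h2.mem.mono fun t ht => ht.1)
      have e6 : velocity (J.prod J) (fun t => (y₁ t).2) = velocity (J.prod J) (fun t => (x t).2) :=
        velocity_congr (h2.mem.mono fun t ht => ht.2)
      rw [← e3] at e6
      have e7 := ((velocity_prod_eq_iff hy.snd hx.snd).1 e6).1
      exact ⟨by rw [e1, e5, ← e2, e4, e7], by rw [e4, e7], e6⟩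
    refine simpleComp_tangentLift fun {z y y₁ x z' y' y₁' x'} h1 h2 h3 h4 e1 e2 _ e4 => ?_
    obtain ⟨a1, a2, a3⟩ := key h1 h2 e1
    obtain ⟨b1, b2, b3⟩ := key h3 h4 e2
    have e5 := ((velocity_prod_eq_iff h2.smooth_right h4.smooth_right).1 e4).2
    have e6 := ((velocity_prod_eq_iff h2.smooth_right.snd h4.smooth_right.snd).1 e5).1
    rw [velocity_prod_eq_iff h1.smooth_right h3.smooth_right,
      velocity_prod_eq_iff h1.smooth_right.fst h3.smooth_right.fst]
    exact ⟨⟨by rw [a1, b1, e6], by rw [a2, b2, e6]⟩, by rw [a3, b3, e5]⟩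
  phase := by
    refine simpleComp_phaseLift pair_simpleComp_e_id ?_
    rintro z ⟨⟨a, a'⟩, ⟨b, b'⟩⟩ ⟨o, u⟩ h1 h2 ⟨⟨A, B⟩, D⟩
    have h2 : a = a' ∧ (b, b') = u := h2
    obtain ⟨rfl, rfl⟩ := h2
    obtain ⟨h3, rfl⟩ := mem_pair_m_iff.1 h1
    obtain rfl : a = b := h3
    -- Decomposition `(A, B) = (A - B, 0) + (B, B)`, the last term being tangent to the diagonal.
    obtain ⟨α, hα, α0, hA⟩ := exists_smoothCurve (I := J) a (A - B)
    obtain ⟨β, hβ, β0, hB⟩ := exists_smoothCurve (I := J) a B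
    obtain ⟨δ, hδ, δ0, hD⟩ := exists_smoothCurve (I := J.prod J) (a, b') D
    refine ⟨fun t => (α t, b'), fun t => ((α t, a), (a, b')), fun t => ((β t, β t), δ t),
      fun t => (o, δ t),
      ⟨hα.prodMk contMDiffAt_const, (hα.prodMk contMDiffAt_const).prodMk contMDiffAt_const,
        Filter.Eventually.of_forall fun _ => mem_pair_m_iff.2 ⟨rfl, rfl⟩⟩,
      ⟨(hβ.prodMk hβ).prodMk hδ, contMDiffAt_const.prodMk hδ,
        Filter.Eventually.of_forall fun t => ⟨rfl, rfl⟩⟩, ?_, ?_, ?_, ?_, ?_⟩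
    · simp only [α0]
    · simp only [α0]
    · simp only [β0, δ0]
    · simp only [δ0]
    · rw [curveDeriv_prodMk (hα.prodMk contMDiffAt_const) (smoothCurve_const _),
        curveDeriv_prodMk hα (smoothCurve_const _), curveDeriv_prodMk (hβ.prodMk hβ) hδ,
        curveDeriv_prodMk hβ hβ, curveDeriv_const, curveDeriv_const, hA, hB, hD]
      simp
  differentiable := by
    refine isSubmanifold_of_parametrization (J := J.prod J)
      (φ := fun y : Y × Y => (y, ((0 : OnePt), y))) (ψ := Prod.fst)
      (contMDiff_id.prodMk (contMDiff_const.prodMk contMDiff_id)) contMDiff_fst (fun _ => rfl) ?_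
    rintro ⟨x, ⟨o, y⟩⟩
    refine ((pair Y).one_mul x y o).trans ?_
    simp [Subsingleton.elim (0 : OnePt) o]

theorem pair_transverse_id_e [Nonempty Y] :
    Transverse ((J.prod J).prod (𝓡 0)) ((J.prod J).prod (J.prod J))
      (J.prod J) (pair Y).m (GraphRel.prod SetRel.id (pair Y).e) where
  tangent := by
    have key : ∀ {z y y₁ x}, CurveInRel ((J.prod J).prod (J.prod J)) (J.prod J) (pair Y).m z y →
        CurveInRel ((J.prod J).prod (𝓡 0)) ((J.prod J).prod (J.prod J))
          (GraphRel.prod SetRel.id (pair Y).e) y₁ x →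
        velocity ((J.prod J).prod (J.prod J)) y = velocity ((J.prod J).prod (J.prod J)) y₁ →
        velocity J (fun t => (y t).2.1) = velocity J (fun t => (x t).1.2) ∧
        velocity J (fun t => (y t).2.2) = velocity J (fun t => (x t).1.2) ∧
        velocity (J.prod J) (fun t => (y t).1) = velocity (J.prod J) (fun t => (x t).1) := by
      intro z y y₁ x h1 h2 e
      have hy := h1.smooth_right
      have hy₁ := h2.smooth_left
      have hx := h2.smooth_right
      rw [velocity_prod_eq_iff hy hy₁, velocity_prod_eq_iff hy.snd hy₁.snd] at e
      obtain ⟨e3, ⟨e1, e2⟩⟩ := e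
      have e4 : velocity J (fun t => (y t).1.2) = velocity J (fun t => (y t).2.1) :=
        velocity_congr (h1.mem.mono fun t ht => (mem_pair_m_iff.1 ht).1)
      have e5 : velocity J (fun t => (y₁ t).2.1) = velocity J (fun t => (y₁ t).2.2) :=
        velocity_congr (h2.mem.mono fun t ht => ht.2)
      have e6 : velocity (J.prod J) (fun t => (y₁ t).1) = velocity (J.prod J) (fun t => (x t).1) :=
        velocity_congr (h2.mem.mono fun t ht => ht.1)
      rw [← e3] at e6
      have e7 := ((velocity_prod_eq_iff hy.fst hx.fst).1 e6).2
      exact ⟨by rw [← e4, e7], by rw [e2, ← e5, ← e1, ← e4, e7], e6⟩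
    refine simpleComp_tangentLift fun {z y y₁ x z' y' y₁' x'} h1 h2 h3 h4 e1 e2 _ e4 => ?_
    obtain ⟨a1, a2, a3⟩ := key h1 h2 e1
    obtain ⟨b1, b2, b3⟩ := key h3 h4 e2
    have e5 := ((velocity_prod_eq_iff h2.smooth_right h4.smooth_right).1 e4).1
    have e6 := ((velocity_prod_eq_iff h2.smooth_right.fst h4.smooth_right.fst).1 e5).2
    rw [velocity_prod_eq_iff h1.smooth_right h3.smooth_right,
      velocity_prod_eq_iff h1.smooth_right.snd h3.smooth_right.snd]
    exact ⟨by rw [a3, b3, e5], ⟨by rw [a1, b1, e6], by rw [a2, b2, e6]⟩⟩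
  phase := by
    refine simpleComp_phaseLift pair_simpleComp_id_e ?_
    rintro z ⟨⟨b', b⟩, ⟨a, a'⟩⟩ ⟨u, o⟩ h1 h2 ⟨D, ⟨A, B⟩⟩
    have h2 : (b', b) = u ∧ a = a' := h2
    obtain ⟨rfl, rfl⟩ := h2
    obtain ⟨h3, rfl⟩ := mem_pair_m_iff.1 h1
    obtain rfl : b = a := h3
    -- Mirror decomposition `(A, B) = (0, B - A) + (A, A)`.
    obtain ⟨α, hα, α0, hA⟩ := exists_smoothCurve (I := J) b (B - A)
    obtain ⟨β, hβ, β0, hB⟩ := exists_smoothCurve (I := J) b A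
    obtain ⟨δ, hδ, δ0, hD⟩ := exists_smoothCurve (I := J.prod J) (b', b) D
    refine ⟨fun t => (b', α t), fun t => ((b', b), (b, α t)), fun t => (δ t, (β t, β t)),
      fun t => (δ t, o),
      ⟨contMDiffAt_const.prodMk hα, contMDiffAt_const.prodMk (contMDiffAt_const.prodMk hα),
        Filter.Eventually.of_forall fun _ => mem_pair_m_iff.2 ⟨rfl, rfl⟩⟩,
      ⟨hδ.prodMk (hβ.prodMk hβ), hδ.prodMk contMDiffAt_const,
        Filter.Eventually.of_forall fun t => ⟨rfl, rfl⟩⟩, ?_, ?_, ?_, ?_, ?_⟩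
    · simp only [α0]
    · simp only [α0]
    · simp only [β0, δ0]
    · simp only [δ0]
    · rw [curveDeriv_prodMk (smoothCurve_const _) (contMDiffAt_const.prodMk hα),
        curveDeriv_prodMk (smoothCurve_const _) hα, curveDeriv_prodMk hδ (hβ.prodMk hβ),
        curveDeriv_prodMk hβ hβ, curveDeriv_const, curveDeriv_const, hA, hB, hD]
      simp
  differentiable := by
    refine isSubmanifold_of_parametrization (J := J.prod J)
      (φ := fun y : Y × Y => (y, (y, (0 : OnePt)))) (ψ := Prod.fst)
      (contMDiff_id.prodMk (contMDiff_id.prodMk contMDiff_const)) contMDiff_fst (fun _ => rfl) ?_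
    rintro ⟨x, ⟨y, o⟩⟩
    refine ((pair Y).mul_one x y o).trans ?_
    simp [Subsingleton.elim (0 : OnePt) o]

theorem pair_m_reduction [Nonempty Y] :
    IsDifferentiableReduction ((J.prod J).prod (J.prod J)) (J.prod J) (pair Y).m := by
  have h1 := (contMDiff_fst (I := J.prod J) (J := J) (M := Y × Y) (N := Y) (n := ∞)).fst
  have h2 := (contMDiff_fst (I := J.prod J) (J := J) (M := Y × Y) (N := Y) (n := ∞)).snd
  have h3 := contMDiff_snd (I := J.prod J) (J := J) (M := Y × Y) (N := Y) (n := ∞)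
  constructor
  · refine isSubmanifold_of_parametrization (J := (J.prod J).prod J)
      (φ := fun y : (Y × Y) × Y => ((y.1.1, y.2), ((y.1.1, y.1.2), (y.1.2, y.2))))
      (ψ := fun p => (p.2.1, p.1.2))
      ((h1.prodMk h3).prodMk ((h1.prodMk h2).prodMk (h2.prodMk h3)))
      (contMDiff_snd.fst.prodMk contMDiff_fst.snd) (fun _ => rfl) ?_
    rintro ⟨⟨z, z'⟩, ⟨⟨a, b⟩, ⟨c, d⟩⟩⟩
    refine mem_pair_m_iff.trans ?_
    simp only [Prod.mk.injEq]
    grind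
  · set C : Set ((Y × Y) × (Y × Y)) := {p | p.1.2 = p.2.1}
    have hC : IsSubmanifold ((J.prod J).prod (J.prod J)) C := by
      refine isSubmanifold_of_parametrization (J := (J.prod J).prod J)
        (φ := fun y : (Y × Y) × Y => ((y.1.1, y.1.2), (y.1.2, y.2)))
        (ψ := fun p => (p.1, p.2.2)) ((h1.prodMk h2).prodMk (h2.prodMk h3))
        (contMDiff_fst.prodMk contMDiff_snd.snd) (fun _ => rfl) ?_
      rintro ⟨⟨a, b⟩, ⟨c, d⟩⟩
      simp [C]
    obtain ⟨hne, ⟨A⟩⟩ := hC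
    refine ⟨C, hne, A, fun c => (c.1.1.1, c.1.2.2), ?_, ?_, ?_⟩
    · rintro ⟨a, b⟩
      exact ⟨⟨((a, a), (a, b)), rfl⟩, rfl⟩
    · refine A.isSubmersion (F' := fun p => (p.1.1, p.2.2))
        (contMDiff_fst.fst.prodMk contMDiff_snd.snd).contMDiffOn (fun _ => rfl) ?_
      rintro ⟨⟨⟨a, b⟩, ⟨c, d⟩⟩, h⟩
      obtain rfl : b = c := h
      -- The section of the product keeps the middle point `b` fixed.
      exact ⟨fun z => ((z.1, b), (b, z.2)),
        ((contMDiff_fst.prodMk contMDiff_const).prodMk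
          (contMDiff_const.prodMk contMDiff_snd)).smoothGerm _ _, rfl,
        Filter.Eventually.of_forall fun z => ⟨rfl, rfl⟩⟩
    · ext ⟨z, ⟨p, q⟩⟩
      rw [mem_pair_m_iff]
      constructor
      · rintro ⟨h, rfl⟩
        exact ⟨⟨(p, q), h⟩, rfl, rfl⟩
      · rintro ⟨⟨c, hc⟩, e1, e2⟩
        obtain rfl : (p, q) = c := e2
        exact ⟨hc, e1⟩

/-- The pair groupoid of a manifold is a differential groupoid. -/
theorem pair_isDifferential [Nonempty Y] [T2Space Y] [SecondCountableTopology Y] :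
    (pair Y).IsDifferential (J.prod J) where
  manifold := ⟨inferInstance, inferInstance, inferInstance, inferInstance, inferInstance⟩
  m_reduction := pair_m_reduction
  e_differentiable := by
    refine isSubmanifold_of_parametrization (J := J)
      (φ := fun y : Y => ((y, y), (0 : OnePt))) (ψ := fun p => p.1.1)
      ((contMDiff_id.prodMk contMDiff_id).prodMk contMDiff_const) contMDiff_fst.fst
      (fun _ => rfl) ?_
    rintro ⟨⟨x, y⟩, o⟩
    refine mem_pair_e_iff.trans ?_
    simp [Subsingleton.elim (0 : OnePt) o]
  s_diffeo := ⟨Diffeomorph.prodComm J J Y Y ∞, rfl⟩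
  m_m_id := pair_transverse_m_id
  m_id_m := pair_transverse_id_m
  m_e_id := pair_transverse_e_id
  m_id_e := pair_transverse_id_e

end Pair

end RelGroupoid

/-! ### The morphism to the pair groupoid defined by an action -/

namespace RelGroupoid

section ActionMorphism

variable {E H Γ E' H' Y : Type*} [NormedAddCommGroup E] [NormedSpace ℝ E] [TopologicalSpace H]
  {I : ModelWithCorners ℝ E H} [TopologicalSpace Γ] [ChartedSpace H Γ] {G : RelGroupoid Γ}
  [NormedAddCommGroup E'] [NormedSpace ℝ E'] [TopologicalSpace H']
  {J : ModelWithCorners ℝ E' H'} [TopologicalSpace Y] [ChartedSpace H' Y] {k : ℕ}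
  {f : Y → Γ} {g : Γ × Y → Y}

variable (G) in
/-- The relation `Γ ⇸ Y × Y` defined by an action `g` with anchor `f`. -/
def graphOfAction (f : Y → Γ) (g : Γ × Y → Y) : SetRel (Y × Y) Γ :=
  {q | G.eR q.2 = f q.1.2 ∧ q.1.1 = g (q.2, q.1.2)}

namespace SmoothAction

/-- Compatibility with products is `g_mul` and with identities `g_unit`; for inverses, `x` and
`s(x)` act by mutually inverse maps. The anchor formula `f_g` supplies composability. -/
theorem isMorphism (hA : SmoothAction I G J f g) :
    G.IsMorphism (pair Y) (graphOfAction G f g) where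
  map_m := by
    ext ⟨⟨a, b⟩, ⟨x, x'⟩⟩
    constructor
    · rintro ⟨z, ⟨h1, h2⟩, h3⟩
      obtain ⟨h4, rfl⟩ := mem_m_iff.1 h3
      have h5 : G.eR x' = f b := by rw [← eR_pmul h4]; exact h1
      refine ⟨((a, g (x', b)), (g (x', b), b)), mem_pair_m_iff.2 ⟨rfl, rfl⟩, ⟨?_, ?_⟩, ⟨h5, rfl⟩⟩
      · exact h4.trans (hA.f_g h5).symm
      · exact h2.trans (hA.g_mul h4 h5)
    · rintro ⟨⟨⟨p, q⟩, ⟨q', r⟩⟩, h1, ⟨h2, h3⟩, ⟨h4, h5⟩⟩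
      obtain ⟨h6, h7⟩ := mem_pair_m_iff.1 h1
      obtain ⟨rfl, rfl⟩ := Prod.mk.inj h7
      obtain rfl : q = q' := h6
      obtain rfl : q = g (x', b) := h5
      have h2 : G.eR x = f (g (x', b)) := h2
      have h4 : G.eR x' = f b := h4
      have h8 : G.eR x = G.eL x' := h2.trans (hA.f_g h4)
      refine ⟨G.pmul (x, x'), ⟨?_, ?_⟩, pmul_mem h8⟩
      · exact (eR_pmul h8).trans h4
      · exact h3.trans (hA.g_mul h8 h4).symm
  map_s := by
    ext ⟨⟨a, b⟩, x⟩
    constructor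
    · rintro ⟨y, ⟨h1, h2⟩, h3⟩
      obtain rfl : y = G.s x := h3
      have h1 : G.eR (G.s x) = f b := h1
      have h2 : a = g (G.s x, b) := h2
      refine ⟨(b, a), rfl, ?_, ?_⟩
      · change G.eR x = f a
        rw [h2, hA.f_g h1, eL_s]
      · change b = g (x, a)
        rw [h2, hA.g_g_s (by rw [← G.eR_s, h1])]
    · rintro ⟨⟨c, d⟩, h1, ⟨h2, h3⟩⟩
      obtain ⟨rfl, rfl⟩ := Prod.mk.inj h1
      have h2 : G.eR x = f a := h2
      have h3 : b = g (x, a) := h3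
      refine ⟨G.s x, ⟨?_, ?_⟩, rfl⟩
      · change G.eR (G.s x) = f b
        rw [h3, hA.f_g h2, G.eR_s]
      · change a = g (G.s x, b)
        rw [h3, hA.g_s_g h2]
  map_e := by
    ext ⟨⟨a, b⟩, o⟩
    constructor
    · rintro ⟨u, ⟨h1, h2⟩, h3⟩
      have h4 : u = f b := (eR_of_mem_units ⟨o, h3⟩).symm.trans h1
      change a = b
      exact h2.trans (by rw [h4]; exact hA.g_unit b)
    · intro h
      obtain rfl : a = b := h
      exact ⟨f a, ⟨eR_of_mem_units (hA.f_mem a), (hA.g_unit a).symm⟩,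
        (G.mem_e_iff o).2 (hA.f_mem a)⟩

/-- The middle point of the two composed pairs can only be the image of the right end under the
second element. -/
theorem simpleComp_m :
    GraphRel.SimpleComp (pair Y).m
      (GraphRel.prod (graphOfAction G f g) (graphOfAction G f g)) := by
  have key : ∀ {z : Y × Y} {y : (Y × Y) × (Y × Y)} {x : Γ × Γ}, (z, y) ∈ (pair Y).m →
      (y, x) ∈ GraphRel.prod (graphOfAction G f g) (graphOfAction G f g) →
      y = ((z.1, g (x.2, z.2)), (g (x.2, z.2), z.2)) := by
    rintro z ⟨⟨p, q⟩, ⟨q', r⟩⟩ ⟨x, x'⟩ h1 ⟨⟨h2, h3⟩, ⟨h4, h5⟩⟩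
    obtain ⟨h6, rfl⟩ := mem_pair_m_iff.1 h1
    obtain rfl : q = q' := h6
    obtain rfl : q = g (x', r) := h5
    rfl
  rintro z x ⟨y, h1, h2⟩
  refine ⟨y, ⟨h1, h2⟩, ?_⟩
  rintro y' ⟨h1', h2'⟩
  rw [key h1 h2, key h1' h2']

theorem simpleComp_e : GraphRel.SimpleComp (graphOfAction G f g) G.e := by
  rintro z o ⟨y, h1, h2⟩
  refine ⟨y, ⟨h1, h2⟩, ?_⟩
  rintro y' ⟨h1', h2'⟩
  have e : G.eR y = f z.2 := h1.1
  have e' : G.eR y' = f z.2 := h1'.1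
  rw [← eR_of_mem_units ⟨o, h2⟩, ← eR_of_mem_units ⟨o, h2'⟩, e, e']

/-- The infinitesimal form of `simpleComp_m`: the velocity of the middle point is obtained from
those of the second element and the right end, because `g` is smooth on its domain and the curves
stay in that domain. -/
theorem tangent_m (hA : SmoothAction I G J f g) :
    GraphRel.SimpleComp (tangentLift ((J.prod J).prod (J.prod J)) (J.prod J) (pair Y).m)
      (tangentLift (I.prod I) ((J.prod J).prod (J.prod J))
        (GraphRel.prod (graphOfAction G f g) (graphOfAction G f g))) := by
  have key : ∀ {z y y₁ x}, CurveInRel ((J.prod J).prod (J.prod J)) (J.prod J) (pair Y).m z y →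
      CurveInRel (I.prod I) ((J.prod J).prod (J.prod J))
        (GraphRel.prod (graphOfAction G f g) (graphOfAction G f g)) y₁ x →
      velocity ((J.prod J).prod (J.prod J)) y = velocity ((J.prod J).prod (J.prod J)) y₁ →
      velocity J (fun t => (y t).1.1) = velocity J (fun t => (z t).1) ∧
      velocity J (fun t => (y t).2.2) = velocity J (fun t => (z t).2) ∧
      velocity J (fun t => (y t).1.2) = velocity J (fun t => (y t).2.1) ∧
      velocity J (fun t => (y₁ t).2.2) = velocity J (fun t => (z t).2) ∧
      velocity J (fun t => (y t).2.1) = velocity J (fun t => g ((x t).2, (y₁ t).2.2)) := by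
    intro z y y₁ x h1 h2 e
    have hy := h1.smooth_right
    have hy₁ := h2.smooth_left
    rw [velocity_prod_eq_iff hy hy₁, velocity_prod_eq_iff hy.snd hy₁.snd] at e
    obtain ⟨-, ⟨e1, e2⟩⟩ := e
    have e3 : velocity J (fun t => (y t).2.2) = velocity J (fun t => (z t).2) :=
      velocity_congr (h1.mem.mono fun t ht =>
        (congrArg Prod.snd (mem_pair_m_iff.1 ht).2).symm)
    refine ⟨velocity_congr (h1.mem.mono fun t ht =>
      (congrArg Prod.fst (mem_pair_m_iff.1 ht).2).symm), e3,
      velocity_congr (h1.mem.mono fun t ht => (mem_pair_m_iff.1 ht).1), by rw [← e2, e3], ?_⟩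
    rw [e1]
    exact velocity_congr (h2.mem.mono fun t ht => ht.2.2)
  refine simpleComp_tangentLift fun {z y y₁ x z' y' y₁' x'} h1 h2 h3 h4 e1 e2 e3 e4 => ?_
  obtain ⟨a1, a2, a3, a4, a5⟩ := key h1 h2 e1
  obtain ⟨b1, b2, b3, b4, b5⟩ := key h3 h4 e2
  obtain ⟨f1, f2⟩ := (velocity_prod_eq_iff h1.smooth_left h3.smooth_left).1 e3
  obtain ⟨-, f4⟩ := (velocity_prod_eq_iff h2.smooth_right h4.smooth_right).1 e4
  have e5 : velocity J (fun t => g ((x t).2, (y₁ t).2.2)) =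
      velocity J (fun t => g ((x' t).2, (y₁' t).2.2)) := by
    refine velocity_comp_eq (γ := fun t => ((x t).2, (y₁ t).2.2))
      (γ' := fun t => ((x' t).2, (y₁' t).2.2)) (h2.smooth_right.snd.prodMk h2.smooth_left.snd.snd)
      (h4.smooth_right.snd.prodMk h4.smooth_left.snd.snd) (h2.mem.mono fun t ht => ht.2.1)
      (h4.mem.mono fun t ht => ht.2.1) hA.smooth_g ?_
    rw [velocity_prodMk_eq_iff h2.smooth_right.snd h2.smooth_left.snd.snd
      h4.smooth_right.snd h4.smooth_left.snd.snd]
    exact ⟨f4, by rw [a4, b4, f2]⟩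
  rw [velocity_prod_eq_iff h1.smooth_right h3.smooth_right,
    velocity_prod_eq_iff h1.smooth_right.fst h3.smooth_right.fst,
    velocity_prod_eq_iff h1.smooth_right.snd h3.smooth_right.snd]
  exact ⟨⟨by rw [a1, b1, f1], by rw [a3, b3, a5, b5, e5]⟩, ⟨by rw [a5, b5, e5], by rw [a2, b2, f2]⟩⟩

/-- The intermediate velocity is that of a curve of identities, hence fixed by the derivative of
`e_R`; along the graph of `h`, `e_R` equals `f` of the second component of the target. So it is the
velocity of that composite. -/
theorem tangent_e (hA : SmoothAction I G J f g) (hG : SmoothMaps I G k) :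
    GraphRel.SimpleComp (tangentLift I (J.prod J) (graphOfAction G f g))
      (tangentLift (𝓡 0) I G.e) := by
  have key : ∀ {z y y₁ x}, CurveInRel I (J.prod J) (graphOfAction G f g) z y →
      CurveInRel (𝓡 0) I G.e y₁ x → velocity I y = velocity I y₁ →
      velocity I y = velocity I (fun t => f (z t).2) := by
    intro z y y₁ x h1 h2 e
    have e1 : velocity I (fun t => G.eR (y t)) = velocity I (fun t => G.eR (y₁ t)) :=
      velocity_comp_eq h1.smooth_right h2.smooth_left (S := univ)
        (Filter.Eventually.of_forall fun _ => mem_univ _)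
        (Filter.Eventually.of_forall fun _ => mem_univ _) hG.smooth_eR.contMDiffOn e
    have e2 : velocity I (fun t => G.eR (y₁ t)) = velocity I y₁ :=
      velocity_congr (h2.mem.mono fun t ht => eR_of_mem_units ⟨_, ht⟩)
    have e3 : velocity I (fun t => G.eR (y t)) = velocity I (fun t => f (z t).2) :=
      velocity_congr (h1.mem.mono fun t ht => ht.1)
    rw [e, ← e2, ← e1, e3]
  refine simpleComp_tangentLift fun {z y y₁ x z' y' y₁' x'} h1 h2 h3 h4 e1 e2 e3 _ => ?_
  rw [key h1 h2 e1, key h3 h4 e2]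
  exact velocity_comp_eq h1.smooth_left.snd h3.smooth_left.snd (S := univ)
    (Filter.Eventually.of_forall fun _ => mem_univ _)
    (Filter.Eventually.of_forall fun _ => mem_univ _) hA.smooth_f.contMDiffOn
    ((velocity_prod_eq_iff h1.smooth_left h3.smooth_left).1 e3).2

/-- The graph of the pair product gives all vectors whose two middle components agree. The graph of
`h × h` must supply the discrepancy `B - C`: move `q` and let `x` follow through a section of `e_R`.
-/
theorem phase_m (hA : SmoothAction I G J f g) (hG : SmoothMaps I G k) [J.Boundaryless]
    [IsManifold J ∞ Y] :
    GraphRel.SimpleComp (phaseLift ((J.prod J).prod (J.prod J)) (J.prod J) (pair Y).m)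
      (phaseLift (I.prod I) ((J.prod J).prod (J.prod J))
        (GraphRel.prod (graphOfAction G f g) (graphOfAction G f g))) := by
  refine simpleComp_phaseLift simpleComp_m ?_
  rintro z ⟨⟨p, q⟩, ⟨q', r⟩⟩ ⟨x, x'⟩ h1 ⟨⟨h2, h3⟩, h4⟩ ⟨⟨A, B⟩, ⟨C, D⟩⟩
  obtain ⟨h6, rfl⟩ := mem_pair_m_iff.1 h1
  obtain rfl : q = q' := h6
  have h2 : G.eR x = f q := h2
  have h3 : p = g (x, q) := h3
  obtain ⟨ν, hν, ν0, hB⟩ := exists_smoothCurve (I := J) q (B - C)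
  obtain ⟨σ, hσ⟩ := hG.section_eR x
  have hfν : SmoothCurve I (fun t => f (ν t)) := (hA.smooth_f (ν 0)).comp 0 hν
  have hf0 : f (ν 0) = G.eR x := by rw [ν0, h2]
  have hfu : ∀ᶠ t in 𝓝 0, f (ν t) ∈ G.units := Filter.Eventually.of_forall fun t => hA.f_mem _
  have hξ : SmoothCurve I (fun t => σ (f (ν t))) := by
    refine hfν.comp (F := σ) ?_ hfu
    rw [hf0]
    exact hσ.smooth.contMDiffWithinAt (G.eR_mem x)
  have hξ0 : σ (f (ν 0)) = x := by rw [hf0, hσ.map]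
  have hξR : ∀ᶠ t in 𝓝 0, G.eR (σ (f (ν t))) = f (ν t) := by
    have t1 : Filter.Tendsto (fun t => f (ν t)) (𝓝 0) (𝓝[G.units] (G.eR x)) := by
      rw [← hf0]
      exact tendsto_nhdsWithin_iff.2 ⟨hfν.continuousAt, hfu⟩
    filter_upwards [t1.eventually hσ.right] with t ht using ht.2
  have hη : SmoothCurve J (fun t => g (σ (f (ν t)), ν t)) := by
    refine SmoothCurve.comp (γ := fun t => (σ (f (ν t)), ν t)) (hξ.prodMk hν) (hA.smooth_g _ ?_) hξR
    exact hξR.self_of_nhds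
  -- Moving `q` and `x` also moves the first endpoint `g (x, q)`; this velocity is compensated in
  -- the free curve `α`.
  set A' := curveDeriv J (fun t => g (σ (f (ν t)), ν t))
  obtain ⟨α, hα, α0, hA'⟩ := exists_smoothCurve (I := J) p (A - A')
  obtain ⟨β, hβ, β0, hC⟩ := exists_smoothCurve (I := J) q C
  obtain ⟨δ, hδ, δ0, hD⟩ := exists_smoothCurve (I := J) r D
  refine ⟨fun t => (α t, δ t), fun t => ((α t, β t), (β t, δ t)),
    fun t => ((g (σ (f (ν t)), ν t), ν t), (q, r)), fun t => (σ (f (ν t)), x'),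
    ⟨hα.prodMk hδ, (hα.prodMk hβ).prodMk (hβ.prodMk hδ),
      Filter.Eventually.of_forall fun t => mem_pair_m_iff.2 ⟨rfl, rfl⟩⟩,
    ⟨(hη.prodMk hν).prodMk contMDiffAt_const, hξ.prodMk contMDiffAt_const,
      hξR.mono fun t ht => ⟨⟨ht, rfl⟩, h4⟩⟩, ?_, ?_, ?_, ?_, ?_⟩
  · simp only [α0, δ0]
  · simp only [α0, β0, δ0]
  · simp only [hξ0]
    rw [ν0, ← h3]
  · simp only [hξ0]
  · rw [curveDeriv_prodMk (hα.prodMk hβ) (hβ.prodMk hδ), curveDeriv_prodMk hα hβ,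
      curveDeriv_prodMk hβ hδ, curveDeriv_prodMk (hη.prodMk hν) (smoothCurve_const _),
      curveDeriv_prodMk hη hν, curveDeriv_const, hA', hB, hC, hD]
    simp [A']

/-- Any curve in `Γ` through `u` lifts to the graph of `h`: a section of the anchor turns its right
identities into a curve in `Y` on which it can act. So the graph of `h` alone spans. -/
theorem phase_e (hA : SmoothAction I G J f g) (hG : SmoothMaps I G k) [I.Boundaryless]
    [IsManifold I ∞ Γ] :
    GraphRel.SimpleComp (phaseLift I (J.prod J) (graphOfAction G f g)) (phaseLift (𝓡 0) I G.e) := by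
  refine simpleComp_phaseLift simpleComp_e ?_
  rintro ⟨p, q⟩ u o ⟨h1, h2⟩ h3 w
  have h1 : G.eR u = f q := h1
  have h2 : p = g (u, q) := h2
  obtain ⟨γ, hγ, γ0, hw⟩ := exists_smoothCurve (I := I) u w
  obtain ⟨τ, hτ⟩ := hA.section_f q
  have hRγ : SmoothCurve I (fun t => G.eR (γ t)) := (hG.smooth_eR (γ 0)).comp 0 hγ
  have hR0 : G.eR (γ 0) = f q := by rw [γ0, h1]
  have hRu : ∀ᶠ t in 𝓝 0, G.eR (γ t) ∈ G.units := Filter.Eventually.of_forall fun t => G.eR_mem _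
  have hν : SmoothCurve J (fun t => τ (G.eR (γ t))) := by
    refine hRγ.comp (F := τ) ?_ hRu
    rw [hR0]
    exact hτ.smooth.contMDiffWithinAt (hA.f_mem q)
  have hν0 : τ (G.eR (γ 0)) = q := by rw [hR0, hτ.map]
  have hνf : ∀ᶠ t in 𝓝 0, G.eR (γ t) = f (τ (G.eR (γ t))) := by
    have t1 : Filter.Tendsto (fun t => G.eR (γ t)) (𝓝 0) (𝓝[G.units] (f q)) := by
      rw [← hR0]
      exact tendsto_nhdsWithin_iff.2 ⟨hRγ.continuousAt, hRu⟩
    filter_upwards [t1.eventually hτ.right] with t ht using ht.2.symm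
  have hη : SmoothCurve J (fun t => g (γ t, τ (G.eR (γ t)))) := by
    refine SmoothCurve.comp (γ := fun t => (γ t, τ (G.eR (γ t)))) (hγ.prodMk hν)
      (hA.smooth_g _ ?_) hνf
    exact hνf.self_of_nhds
  refine ⟨fun t => (g (γ t, τ (G.eR (γ t))), τ (G.eR (γ t))), γ, fun _ => u, fun _ => o,
    ⟨hη.prodMk hν, hγ, hνf.mono fun t ht => ⟨ht, rfl⟩⟩,
    ⟨smoothCurve_const _, smoothCurve_const _, Filter.Eventually.of_forall fun _ => h3⟩,
    ?_, γ0, rfl, rfl, ?_⟩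
  · simp only [hν0]
    rw [γ0, ← h2]
  · rw [curveDeriv_const, hw, add_zero]

variable [I.Boundaryless] [IsManifold I ∞ Γ] [FiniteDimensional ℝ E] [J.Boundaryless]
  [IsManifold J ∞ Y] [FiniteDimensional ℝ E']

/-- The graph is that of `g` over `Γ ×_f Y`, up to reordering, so it is diffeomorphic to this fiber
product. -/
theorem isDifferentiableRel [Nonempty Y] (hA : SmoothAction I G J f g) (hG : SmoothMaps I G k) :
    IsDifferentiableRel I (J.prod J) (graphOfAction G f g) := by
  obtain ⟨y₀⟩ := ‹Nonempty Y›
  refine isSubmanifold_of_hasDimAt (d := Module.finrank ℝ E' + (Module.finrank ℝ E - k))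
    ⟨((y₀, y₀), f y₀), eR_of_mem_units (hA.f_mem y₀), (hA.g_unit y₀).symm⟩ fun q hq => ?_
  refine (SetDiffeoAt.of_contMDiffOn (T := {p : Γ × Y | G.eR p.1 = f p.2})
    (f := fun q : (Y × Y) × Γ => (q.2, q.1.2)) (g := fun p => ((g p, p.2), p.1))
    (contMDiff_snd.prodMk contMDiff_fst.snd).contMDiffOn ?_ ?_ ?_ hq).hasDimAt
    (hA.hasDimAt hG rfl rfl hq.1)
  · exact (hA.smooth_g.prodMk contMDiffOn_snd).prodMk contMDiffOn_fst
  · rintro ⟨⟨a, b⟩, x⟩ ⟨h1, h2⟩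
    exact ⟨h1, Prod.ext (Prod.ext h2.symm rfl) rfl⟩
  · rintro ⟨x, y⟩ h
    exact ⟨⟨h, rfl⟩, rfl⟩

/-- The graph is parametrized by triples `(x, (x', b))` with `x` composable with `x'` and `x'`
acting on `b`: a fiber product over `Γ⁰` of `Γ` with `Γ ×_f Y`, by `e_R` and the left identity of
`x'`. -/
theorem isDifferentiableRel_comp_m [Nonempty Y] (hA : SmoothAction I G J f g)
    (hG : SmoothMaps I G k) :
    IsDifferentiableRel (I.prod I) (J.prod J) ((graphOfAction G f g).comp G.m) := by
  obtain ⟨y₀⟩ := ‹Nonempty Y›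
  have hmem : ∀ {a b : Y} {x x' : Γ}, ((a, b), (x, x')) ∈ (graphOfAction G f g).comp G.m ↔
      G.eR x = G.eL x' ∧ G.eR x' = f b ∧ a = g (x, g (x', b)) := by
    intro a b x x'
    constructor
    · rintro ⟨z, ⟨h1, h2⟩, h3⟩
      obtain ⟨h4, rfl⟩ := mem_m_iff.1 h3
      have h5 : G.eR x' = f b := (eR_pmul h4).symm.trans h1
      exact ⟨h4, h5, h2.trans (hA.g_mul h4 h5)⟩
    · rintro ⟨h1, h2, h3⟩
      exact ⟨G.pmul (x, x'), ⟨(eR_pmul h1).trans h2, h3.trans (hA.g_mul h1 h2).symm⟩, pmul_mem h1⟩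
  set T : Set (Γ × (Γ × Y)) := {q | q.1 ∈ (univ : Set Γ) ∧ q.2 ∈ {p : Γ × Y | G.eR p.1 = f p.2} ∧
    G.eR q.1 = G.eL q.2.1}
  have hT : ∀ q ∈ T, HasDimAt (I.prod (I.prod J))
      ((Module.finrank ℝ E' + (Module.finrank ℝ E - k)) + (Module.finrank ℝ E - k)) T q := by
    rintro ⟨x, p⟩ ⟨-, h1, h2⟩
    obtain ⟨σ, hσ⟩ := hG.section_eR x
    exact hasDimAt_fiberProduct (F₂ := fun p : Γ × Y => G.eL p.1) (hasDimAt_univ rfl x)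
      (hA.hasDimAt hG rfl rfl h1) (hG.units_dim _ (G.eR_mem _)) (hG.smooth_eR.smoothGerm _ _)
      (Filter.Eventually.of_forall fun z => G.eR_mem z)
      ((hG.smooth_eL.comp contMDiff_fst).smoothGerm _ _)
      (Filter.Eventually.of_forall fun z => G.eL_mem z.1) hσ h2
  have hg1 : ContMDiffOn (I.prod (I.prod J)) J ∞ (fun q : Γ × (Γ × Y) => g q.2) T :=
    hA.smooth_g.comp contMDiffOn_snd fun q hq => hq.2.1
  have hg2 : ContMDiffOn (I.prod (I.prod J)) J ∞ (fun q : Γ × (Γ × Y) => g (q.1, g q.2)) T := by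
    refine hA.smooth_g.comp (contMDiffOn_fst.prodMk hg1) fun q hq => ?_
    exact hq.2.2.trans (hA.f_g hq.2.1).symm
  refine isSubmanifold_of_hasDimAt
    (d := (Module.finrank ℝ E' + (Module.finrank ℝ E - k)) + (Module.finrank ℝ E - k))
    ⟨((y₀, y₀), (f y₀, f y₀)), hmem.2 ⟨?_, ?_, ?_⟩⟩ fun q hq => ?_
  · rw [eR_of_mem_units (hA.f_mem y₀), eL_of_mem_units (hA.f_mem y₀)]
  · exact eR_of_mem_units (hA.f_mem y₀)
  · rw [hA.g_unit, hA.g_unit]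
  · have hto : ∀ q ∈ ((graphOfAction G f g).comp G.m : Set ((Y × Y) × (Γ × Γ))),
        (q.2.1, (q.2.2, q.1.2)) ∈ T ∧
        ((g (q.2.1, g (q.2.2, q.1.2)), q.1.2), (q.2.1, q.2.2)) = q := by
      rintro ⟨⟨a, b⟩, ⟨x, x'⟩⟩ h
      obtain ⟨h1, h2, h3⟩ := hmem.1 h
      exact ⟨⟨mem_univ _, h2, h1⟩, Prod.ext (Prod.ext h3.symm rfl) rfl⟩
    refine (SetDiffeoAt.of_contMDiffOn (T := T)
      (f := fun q : (Y × Y) × (Γ × Γ) => (q.2.1, (q.2.2, q.1.2)))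
      (g := fun q => ((g (q.1, g q.2), q.2.2), (q.1, q.2.1)))
      (contMDiff_snd.fst.prodMk (contMDiff_snd.snd.prodMk contMDiff_fst.snd)).contMDiffOn
      ?_ hto ?_ hq).hasDimAt (hT _ (hto q hq).1)
    · exact (hg2.prodMk contMDiff_snd.snd.contMDiffOn).prodMk
        (contMDiffOn_fst.prodMk contMDiff_snd.fst.contMDiffOn)
    · rintro ⟨x, ⟨x', b⟩⟩ ⟨-, h1, h2⟩
      exact ⟨hmem.2 ⟨h2, h1, rfl⟩, rfl⟩

/-- A smooth action defines a morphism of differential groupoids to the pair groupoid. -/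
theorem isDifferentialMorphism [Nonempty Y] [T2Space Y] [SecondCountableTopology Y]
    (hGd : G.IsDifferential I) (hA : SmoothAction I G J f g) (hG : SmoothMaps I G k) :
    IsDifferentialMorphism I (J.prod J) G (pair Y) (graphOfAction G f g) where
  source := hGd
  target := pair_isDifferential
  morphism := hA.isMorphism
  differentiable := hA.isDifferentiableRel hG
  -- The morphism equations replace `m'(h × h)` by `hm` here and `he` by `e'` below, whose
  -- differentiability is already established.
  m_h_h := ⟨hA.tangent_m, hA.phase_m hG, hA.isMorphism.map_m ▸ hA.isDifferentiableRel_comp_m hG⟩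
  h_e := ⟨hA.tangent_e hG, hA.phase_e hG,
    hA.isMorphism.map_e.symm ▸ (pair_isDifferential (J := J)).e_differentiable⟩

end SmoothAction

theorem HorizontalSubgroupoid.actionRel_eq (K : G.HorizontalSubgroupoid) :
    K.actionRel = graphOfAction G (fun y => (K.anchor y : Γ)) K.pact := by
  ext ⟨⟨a, b⟩, x⟩
  constructor
  · rintro ⟨p, h⟩
    simp only [Prod.mk.injEq] at h
    obtain ⟨⟨rfl, rfl⟩, rfl⟩ := h
    exact ⟨p.2, K.act_eq_pact p⟩
  · rintro ⟨h1, h2⟩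
    refine ⟨⟨(x, b), h1⟩, ?_⟩
    rw [K.act_eq_pact, ← h2]

end ActionMorphism

end RelGroupoid

theorem lemma6p19 {n : ℕ} {Γ : Type*} [TopologicalSpace Γ]
    [ChartedSpace (EuclideanSpace ℝ (Fin n)) Γ] (G : RelGroupoid Γ)
    (hG : G.IsDifferential (𝓡 n)) (K : G.HorizontalSubgroupoid)
    (hK : G.IsDifferentialSubgroupoid (𝓡 n) K.carrier) :
    -- `R` is a submanifold of `Γ × Γ`, and `R → Γ`, `(x, y) ↦ x`, is a surjective submersion
    (IsSubmanifold ((𝓡 n).prod (𝓡 n)) (G.cosetRel K.carrier) ∧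
      ∃ A : SubmanifoldStructure ((𝓡 n).prod (𝓡 n)) (G.cosetRel K.carrier),
        letI := A.chartedSpace
        Function.Surjective (fun p : G.cosetRel K.carrier => p.1.1) ∧
        IsSubmersion (𝓡 A.dim) (𝓡 n) ∞ (fun p : G.cosetRel K.carrier => p.1.1)) ∧
    (IsClosed K.carrier →
      -- `Y` is a manifold, with its quotient topology and with `π : Γ → Y` a submersion
      ∃ (d : ℕ) (_ : ChartedSpace (EuclideanSpace ℝ (Fin d)) K.QuotientSpace),
        IsSmoothManifold (𝓡 d) K.QuotientSpace ∧
        IsSubmersion (𝓡 n) (𝓡 d) ∞ K.proj ∧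
        -- `f : Y → Γ⁰` is a surjective submersion
        (∃ A : SubmanifoldStructure (𝓡 n) G.units,
          letI := A.chartedSpace
          Function.Surjective K.anchor ∧ IsSubmersion (𝓡 d) (𝓡 A.dim) ∞ K.anchor) ∧
        -- `Γ ×_f Y` is a submanifold of `Γ × Y`, and `g` is a surjective submersion
        (IsSubmanifold ((𝓡 n).prod (𝓡 d)) K.fiberProd ∧
          ∃ A : SubmanifoldStructure ((𝓡 n).prod (𝓡 d)) K.fiberProd,
            letI := A.chartedSpace
            Function.Surjective K.act ∧ IsSubmersion (𝓡 A.dim) (𝓡 d) ∞ K.act) ∧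
        -- `h` is a morphism of differential groupoids
        RelGroupoid.IsDifferentialMorphism (𝓡 n) ((𝓡 d).prod (𝓡 d)) G
          (RelGroupoid.pair K.QuotientSpace) K.actionRel) := by
  obtain ⟨hM, -, -, hT2, hsc⟩ := hG.manifold
  have hne : Nonempty Γ := by
    obtain ⟨⟨⟨⟨x, -⟩, -⟩, -⟩, -⟩ := hG.m_reduction
    exact ⟨x⟩
  obtain ⟨k, hk⟩ := hG.exists_smoothMaps
  obtain ⟨κ, hκ, hσ⟩ := hK.exists_dim_and_section K.isHorizontal
  have hS : RelGroupoid.SmoothSub (𝓡 n) G K.carrier κ := ⟨hκ, hσ⟩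
  refine ⟨RelGroupoid.cosetRel_submanifold_submersion hk K hS, fun hc => ?_⟩
  obtain ⟨cs, hY, hπ, hsec⟩ := RelGroupoid.HorizontalSubgroupoid.exists_isSmoothManifold
    finrank_euclideanSpace_fin hk hS hc
  have hA := RelGroupoid.HorizontalSubgroupoid.smoothAction hk hπ hsec
  have hYM := hY.isManifold
  have hYT := hY.t2Space
  have hYS := hY.secondCountable
  have hYne : Nonempty K.QuotientSpace := hne.map K.proj
  refine ⟨_, cs, hY, ?_, RelGroupoid.HorizontalSubgroupoid.anchor_submersion hk hA,
    RelGroupoid.HorizontalSubgroupoid.act_submersion hk hA, ?_⟩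
  · refine isSubmersion_of_local_sections hπ fun x => ?_
    obtain ⟨σ, h⟩ := hsec x
    refine ⟨σ, h.smooth, h.map, ?_⟩
    rw [← nhdsWithin_univ]
    exact h.right.mono fun y hy => hy.2
  · rw [K.actionRel_eq]
    exact hA.isDifferentialMorphism hG hk
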